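/- **Setting.** Let $\sigma_0>0$, $\epsilon>0$, $s\in\mathbb N^*$, $k(t)=e^{-t^2/2}$, $\varphi(\theta)=k\big(\frac{\cdot-\theta}{\sigma_0}\big)$ for $\theta\in\mathbb R$. Let $(b_T)_{T\ge2}$ be positive numbers with $b_T\to\infty$ and $\Delta_T:=2b_T/T\to0$. Put $t_j=-b_T+j\Delta_T$ ($1\le j\le T$), $\lambda_T=\Delta_T\sum_{j=1}^T\delta_{t_j}$, $\Theta_T=[-(1-\epsilon)b_T,(1-\epsilon)b_T]$, let $\lambda_\infty$ be Lebesgue measure and $\Theta_\infty=\mathbb R$. For $T\in\{2,3,\dots\}\cup\{\infty\}$ let $\langle\cdot,\cdot\rangle_T$, $\|\cdot\|_T$ be the scalar product and norm of $L^2(\lambda_T)$, $\phi_T(\theta)=\varphi(\theta)/\|\varphi(\theta)\|_T$, $\mathcal K_T(\theta,\theta')=\langle\phi_T(\theta),\phi_T(\theta')\rangle_T$, $g_T(\theta)=\partial^2_{xy}\mathcal K_T(\theta,\theta)$, $\mathfrak d_T(\theta,\theta')=\big|\int_{\theta'}^{\theta}\sqrt{g_T}\big|$. With $D_0f=f$ and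 $D_{i+1}f=g_T^{i/2}\,\partial\big(D_if/g_T^{i/2}\big)$, let $\mathcal K_T^{[i,j]}(\theta,\theta')=g_T(\theta)^{-i/2}g_T(\theta')^{-j/2}D_{i,j}\mathcal K_T(\theta,\theta')$, where $D_{i,j}$ applies $D_i$ in the first and $D_j$ in the second variable, and $h_T(\theta)=\mathcal K_T^{[3,3]}(\theta,\theta)$. Let $$\rho_T=\max\Big(\sup_{\Theta_T}\sqrt{g_T/g_\infty},\ \sup_{\Theta_T}\sqrt{g_\infty/g_T}\Big),\qquad \mathcal V_T=\max\Big(\max_{0\le i,j\le2}\sup_{\Theta_T^2}|\mathcal K_T^{[i,j]}-\mathcal K_\infty^{[i,j]}|,\ \sup_{\Theta_T}|h_T-h_\infty|\Big).$$ Let $L_{i,j}=\sup_{\mathbb R^2}|\mathcal K_\infty^{[i,j]}|$, $\varepsilon_\infty(r)=1-\sup\{|\mathcal K_\infty(\theta,\theta')|:\mathfrak d_\infty(\theta',\theta)\ge r\}$, $\nu_\infty(r)=-\sup\{\mathcal K_\infty^{[0,2]}(\theta,\theta'):\mathfrak d_\infty(\theta',\theta)\le r\}$, $$H^{(1)}(r)=\tfrac12\wedge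 L_{2,0}\wedge L_{2,1}\wedge\tfrac{\nu_\infty(2r)}{10}\wedge\tfrac{\varepsilon_\infty(r/2)}{10},\qquad H^{(2)}(r)=\tfrac16\wedge\tfrac{8\varepsilon_\infty(r/2)}{10(5+2L_{1,0})}\wedge\tfrac{8\nu_\infty(2r)}{9(2L_{2,0}+2L_{2,1}+4)}.$$ Let $r=\operatorname{argmax}_{0\le r'\le1/2}H^{(2)}(r')$ and $u_\infty=\frac9{10}H^{(2)}(r)$. Let $\delta_\infty(u,s)\in[0,\infty]$ be the infimum (with $\inf\emptyset=+\infty$) of the $\delta>0$ such that $\sum_{k\ne\ell}|\mathcal K_\infty^{[i,j]}(\theta_\ell,\theta_k)|\le u$ for all $1\le\ell\le s$, $i\in\{0,1\}$, $j\in\{0,1,2\}$ and all $(\theta_1,\dots,\theta_s)\in\mathbb R^s$ with $\mathfrak d_\infty(\theta_k,\theta_\ell)>\delta$ for $k\neq\ell$. **Model.** Let $K\in\mathbb N$, $\beta^\star\in\mathbb R^K$ with support $S^\star$ of cardinality $s$, $\vartheta^\star\in\mathbb R^K$ with $\theta^\star_k\in\Theta_T$ for $k\in S^\star$; write $\beta\Phi_T(\vartheta)=\sum_k\beta_k\phi_T(\theta_k)$.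 One observes $y=\beta^\star\Phi_T(\vartheta^\star)+w_T$ in $L^2(\lambda_T)$, where $w_T(t)=\sum_jG_j\mathbf 1_{\{t_j=t\}}$ and $(G_1,\dots,G_T)$ is a centered Gaussian vector with, for some $\sigma_1>0$, $\mathbb E[G_j^2]=\sigma_1^2$ and $|\mathbb E[G_iG_j]|\le\sigma_1^2/T$ for $i\ne j$. Put $\sigma=\sqrt2\,\sigma_1$. For $\kappa>0$ an estimator is any minimizer $(\hat\beta,\hat\vartheta)$ of $\frac12\|y-\beta\Phi_T(\vartheta)\|_T^2+\kappa\|\beta\|_{\ell_1}$ over $\beta\in\mathbb R^K$, $\vartheta\in\Theta_T^K$. Put $\tilde S_k(r)=\{\ell:\hat\beta_\ell\ne0,\ \mathfrak d_T(\hat\theta_\ell,\theta^\star_k)\le r\}$ and $\tilde S(r)=\bigcup_{k\in S^\star}\tilde S_k(r)$. **Claim.** There are universal constants $\mathcal C_0,\dots,\mathcal C_5\in(0,\infty)$ such that for all $\sigma_0,\epsilon,s$ and $(b_T)$ as above there is $T_0$ such that for every $T\ge T_0$, $T\geq 2$: $$\rho_T\le2,\qquad \mathcal V_T\le H^{(1)}(r),\qquad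 (s-1)\mathcal V_T\le\tfrac1{10}H^{(2)}(r),$$ and, for all $K,\beta^\star,\vartheta^\star,\sigma_1$ and noise as above such that $|\theta^\star_k-\theta^\star_\ell|>\sqrt2\,\sigma_0\max(1,4\delta_\infty(u_\infty,s))$ for all distinct $k,\ell\in S^\star$, for every $\tau>0$ and every $\kappa>0$ with $\kappa\ge\mathcal C_1\sigma\sqrt{\Delta_T\log\tau}$, with probability at least $$1-\mathcal C_2\Big(\frac{\sqrt2\,b_T}{\sigma_0\,\tau\sqrt{\log\tau}}\vee\frac1\tau\Big)$$ every estimator $(\hat\beta,\hat\vartheta)$ satisfies, simultaneously, $$\sqrt{\Delta_T}\,\Big(\sum_{j=1}^T\big(\hat\beta\Phi_T(\hat\vartheta)-\beta^\star\Phi_T(\vartheta^\star)\big)(t_j)^2\Big)^{1/2}\le\mathcal C_0\sqrt s\,\kappa,\qquad \big|\|\hat\beta\|_{\ell_1}-\|\beta^\star\|_{\ell_1}\big|\le\mathcal C_3\,\kappa s,$$ $$\sum_{k\in S^\star}\Big||\beta^\star_k|-\sum_{\ell\in\tilde S_k(r)}|\hat\beta_\ell|\Big|\le\mathcal C_3\,\kappa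 s,\qquad \sum_{k\in S^\star}\Big|\beta^\star_k-\sum_{\ell\in\tilde S_k(r)}\hat\beta_\ell\Big|\le\mathcal C_4\,\kappa s,\qquad \sum_{\ell\notin\tilde S(r)}|\hat\beta_\ell|\le\mathcal C_5\,\kappa s.$$ (For $\tau\le1$ the quantity $\sqrt{\log\tau}$ and the quotient by it are read as $0$; the substance is the case $\tau>1$.) -/

import Mathlib

open MeasureTheory ProbabilityTheory Filter Topology
open scoped ENNReal

noncomputable section

namespace SpikeDeconv

/-! ### Kernels on the real line, their Riemannian metric and covariant derivatives -/

/-- `g_K(θ) = ∂²_{x,y} K(θ, θ)`. -/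
def metricCoeff (K : ℝ → ℝ → ℝ) (θ : ℝ) : ℝ :=
  deriv (fun x => deriv (fun y => K x y) θ) θ

/-- The Riemannian distance `|G(θ) - G(θ')|`, where `G` is a primitive of `√g_K`. -/
def rdist (K : ℝ → ℝ → ℝ) (θ θ' : ℝ) : ℝ :=
  |∫ t in θ'..θ, √(metricCoeff K t)|

/-- Covariant derivative of order `i` of a function of one variable, for the metric `g`:
`D_0 f = f` and `D_{i+1} f = g^{i/2} ∂ (D_i f / g^{i/2})`. -/
def covDeriv (g : ℝ → ℝ) : ℕ → (ℝ → ℝ) → ℝ → ℝ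
  | 0, f => f
  | i + 1, f => fun θ => √(g θ) ^ i * deriv (fun t => covDeriv g i f t / √(g t) ^ i) θ

/-- Covariant derivative of order `(i, j)` of a function of two variables. -/
def covDeriv₂ (g : ℝ → ℝ) (i j : ℕ) (F : ℝ → ℝ → ℝ) (θ θ' : ℝ) : ℝ :=
  covDeriv g i (fun x => covDeriv g j (fun y => F x y) θ') θ

/-- The normalized covariant derivative `K^{[i,j]}` of a kernel with respect to its own metric. -/
def kernelDeriv (K : ℝ → ℝ → ℝ) (i j : ℕ) (θ θ' : ℝ) : ℝ :=
  covDeriv₂ (metricCoeff K) i j K θ θ' /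
    (√(metricCoeff K θ) ^ i * √(metricCoeff K θ') ^ j)

/-- `h_K(θ) = K^{[3,3]}(θ, θ)`. -/
def hFun (K : ℝ → ℝ → ℝ) (θ : ℝ) : ℝ := kernelDeriv K 3 3 θ θ

/-- `L_{i,j} = sup_{Θ²} |K^{[i,j]}|`. -/
def supDeriv (K : ℝ → ℝ → ℝ) (Θ : Set ℝ) (i j : ℕ) : ℝ :=
  sSup {x | ∃ θ ∈ Θ, ∃ θ' ∈ Θ, x = |kernelDeriv K i j θ θ'|}

/-- `ε(r) = 1 - sup {|K(θ, θ')| : θ, θ' ∈ Θ, d(θ', θ) ≥ r}`. -/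
def epsFun (K : ℝ → ℝ → ℝ) (Θ : Set ℝ) (r : ℝ) : ℝ :=
  1 - sSup {x | ∃ θ ∈ Θ, ∃ θ' ∈ Θ, r ≤ rdist K θ' θ ∧ x = |K θ θ'|}

/-- `ν(r) = - sup {K^{[0,2]}(θ, θ') : θ, θ' ∈ Θ, d(θ', θ) ≤ r}`. -/
def nuFun (K : ℝ → ℝ → ℝ) (Θ : Set ℝ) (r : ℝ) : ℝ :=
  -sSup {x | ∃ θ ∈ Θ, ∃ θ' ∈ Θ, rdist K θ' θ ≤ r ∧ x = kernelDeriv K 0 2 θ θ'}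

/-- The function `H^{(1)}(r, ρ)` of the limit kernel. -/
def H₁ (K : ℝ → ℝ → ℝ) (Θ : Set ℝ) (r ρ : ℝ) : ℝ :=
  1 / 2 ⊓ supDeriv K Θ 2 0 ⊓ supDeriv K Θ 2 1 ⊓ nuFun K Θ (ρ * r) / 10 ⊓
    epsFun K Θ (r / ρ) / 10

/-- The function `H^{(2)}(r, ρ)` of the limit kernel. -/
def H₂ (K : ℝ → ℝ → ℝ) (Θ : Set ℝ) (r ρ : ℝ) : ℝ :=
  1 / 6 ⊓ 8 * epsFun K Θ (r / ρ) / (10 * (5 + 2 * supDeriv K Θ 1 0)) ⊓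
    8 * nuFun K Θ (ρ * r) / (9 * (2 * supDeriv K Θ 2 0 + 2 * supDeriv K Θ 2 1 + 4))

/-- The vectors of `s` parameters in `Θ` that are pairwise at Riemannian distance `> δ`. -/
def separated (K : ℝ → ℝ → ℝ) (Θ : Set ℝ) (s : ℕ) (δ : ℝ) : Set (Fin s → ℝ) :=
  {ϑ | (∀ k, ϑ k ∈ Θ) ∧ ∀ k l, k ≠ l → δ < rdist K (ϑ l) (ϑ k)}

/-- The minimal separation `δ(u, s)` that makes the coherence at most `u`; it takes values in
`[0, ∞]`, with `inf ∅ = ∞`. -/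
def deltaFun (K : ℝ → ℝ → ℝ) (Θ : Set ℝ) (u : ℝ) (s : ℕ) : ℝ≥0∞ :=
  ⨅ δ ∈ {δ : ℝ | 0 < δ ∧ ∀ i ≤ 1, ∀ j ≤ 2, ∀ ϑ ∈ separated K Θ s δ, ∀ l : Fin s,
      ∑ k ∈ Finset.univ.erase l, |kernelDeriv K i j (ϑ l) (ϑ k)| ≤ u},
    ENNReal.ofReal δ

/-- `ρ`: the comparison constant of the metrics of two kernels on `Θ`. -/
def rhoConst (K K' : ℝ → ℝ → ℝ) (Θ : Set ℝ) : ℝ :=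
  max (sSup ((fun θ => √(metricCoeff K θ / metricCoeff K' θ)) '' Θ))
    (sSup ((fun θ => √(metricCoeff K' θ / metricCoeff K θ)) '' Θ))

/-- `V`: the proximity of two kernels on `Θ`, the maximum of
`max_{i,j ≤ 2} sup_{Θ²} |K^{[i,j]} - K'^{[i,j]}|` and `sup_Θ |h_K - h_{K'}|`. -/
def proximity (K K' : ℝ → ℝ → ℝ) (Θ : Set ℝ) : ℝ :=
  max
    (⨆ i : Fin 3, ⨆ j : Fin 3,
      sSup {x | ∃ θ ∈ Θ, ∃ θ' ∈ Θ, x = |kernelDeriv K i j θ θ' - kernelDeriv K' i j θ θ'|})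
    (sSup ((fun θ => |hFun K θ - hFun K' θ|) '' Θ))

/-! ### The Gaussian dictionary -/

/-- `k(t) = exp(-t²/2)`. -/
def gauss (t : ℝ) : ℝ := Real.exp (-t ^ 2 / 2)

/-- The feature `φ(θ) = k((· - θ)/σ₀)`. -/
def feature (σ₀ θ : ℝ) : ℝ → ℝ := fun t => gauss ((t - θ) / σ₀)

/-- Scalar product of `L²(lam)`. -/
def ip (lam : Measure ℝ) (f g : ℝ → ℝ) : ℝ := ∫ t, f t * g t ∂lam

/-- Norm of `L²(lam)`. -/
def l2norm (lam : Measure ℝ) (f : ℝ → ℝ) : ℝ := √(ip lam f f)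

/-- The feature normalized in `L²(lam)`. -/
def nfeature (lam : Measure ℝ) (σ₀ θ : ℝ) : ℝ → ℝ :=
  fun t => feature σ₀ θ t / l2norm lam (feature σ₀ θ)

/-- The mixture `β Φ(ϑ)` of normalized features. -/
def mixture (lam : Measure ℝ) (σ₀ : ℝ) {K : ℕ} (β ϑ : Fin K → ℝ) : ℝ → ℝ :=
  fun t => ∑ k, β k * nfeature lam σ₀ (ϑ k) t

/-- The kernel of the dictionary in `L²(lam)`. -/
def kernel (lam : Measure ℝ) (σ₀ : ℝ) (θ θ' : ℝ) : ℝ :=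
  ip lam (nfeature lam σ₀ θ) (nfeature lam σ₀ θ')

/-- The limit kernel, for the Lebesgue measure. -/
abbrev kernelInf (σ₀ : ℝ) : ℝ → ℝ → ℝ := kernel volume σ₀

/-! ### The regular grid on `[-b, b]` -/

/-- The grid step `(b - a)/T` with `a = -b`. -/
def gridStep (b : ℝ) (T : ℕ) : ℝ := (b - -b) / T

/-- The grid points `-b + j Δ`, `j = 1, …, T` (indexed from `0`). -/
def gridPoint (b : ℝ) (T : ℕ) (j : Fin T) : ℝ := -b + ((j : ℝ) + 1) * gridStep b T

/-- The measure `Δ ∑ⱼ δ_{tⱼ}`. -/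
def gridMeasure (b : ℝ) (T : ℕ) : Measure ℝ :=
  ENNReal.ofReal (gridStep b T) • ∑ j : Fin T, Measure.dirac (gridPoint b T j)

/-- The kernel of the dictionary in `L²(gridMeasure b T)`. -/
abbrev kernelGrid (b : ℝ) (T : ℕ) (σ₀ : ℝ) : ℝ → ℝ → ℝ := kernel (gridMeasure b T) σ₀

/-- The set `[-(1-ε) b, (1-ε) b]` over which the locations are optimized. -/
def paramSet (b ε : ℝ) : Set ℝ := Set.Icc ((1 - ε) * -b) ((1 - ε) * b)

/-- The function `∑ⱼ Gⱼ 1_{tⱼ}` on the line that is built from a vector `G`. -/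
def gridFun (b : ℝ) (T : ℕ) (G : Fin T → ℝ) : ℝ → ℝ :=
  fun t => ∑ j, Set.indicator {gridPoint b T j} (fun _ => G j) t

/-- The `ℓ₂` norm of the vector of the values on the grid. -/
def gridNorm (b : ℝ) (T : ℕ) (f : ℝ → ℝ) : ℝ := √(∑ j : Fin T, f (gridPoint b T j) ^ 2)

/-! ### Noise and estimators -/

/-- `G` is a centered Gaussian vector with `E[Gⱼ²] = σ₁²` and `|E[Gᵢ Gⱼ]| ≤ σ₁²/T`
for `i ≠ j`. -/
structure IsNoise {Ω : Type*} [MeasurableSpace Ω] (P : Measure Ω) {T : ℕ} (σ₁ : ℝ)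
    (G : Ω → Fin T → ℝ) : Prop where
  gaussian : HasGaussianLaw G P
  centered : ∀ j, ∫ ω, G ω j ∂P = 0
  variance : ∀ j, ∫ ω, G ω j ^ 2 ∂P = σ₁ ^ 2
  covariance : ∀ i j, i ≠ j → |∫ ω, G ω i * G ω j ∂P| ≤ σ₁ ^ 2 / T

/-- The objective `½ ‖y - β Φ(ϑ)‖² + κ ‖β‖_{ℓ₁}`. -/
def objective (lam : Measure ℝ) (σ₀ κ : ℝ) (y : ℝ → ℝ) {K : ℕ} (β ϑ : Fin K → ℝ) : ℝ :=
  1 / 2 * l2norm lam (fun t => y t - mixture lam σ₀ β ϑ t) ^ 2 + κ * ∑ k, |β k|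

/-- `(β, ϑ)` minimizes the objective over `ℝᴷ × Θᴷ`. -/
def IsEstimator (lam : Measure ℝ) (σ₀ κ : ℝ) (Θ : Set ℝ) (y : ℝ → ℝ) {K : ℕ}
    (β ϑ : Fin K → ℝ) : Prop :=
  (∀ k, ϑ k ∈ Θ) ∧ ∀ β' ϑ' : Fin K → ℝ, (∀ k, ϑ' k ∈ Θ) →
    objective lam σ₀ κ y β ϑ ≤ objective lam σ₀ κ y β' ϑ'

open Classical in
/-- The support of a vector. -/
def supp {K : ℕ} (β : Fin K → ℝ) : Finset (Fin K) := {k | β k ≠ 0}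

open Classical in
/-- The indices in the support of `β` whose parameter is at Riemannian distance at most `r`
from `θ`. -/
def near (Kn : ℝ → ℝ → ℝ) (r : ℝ) {K : ℕ} (β ϑ : Fin K → ℝ) (θ : ℝ) : Finset (Fin K) :=
  {l ∈ supp β | rdist Kn (ϑ l) θ ≤ r}

/-- The near region: the union of the `near` sets of the true active parameters. -/
def nearAll (Kn : ℝ → ℝ → ℝ) (r : ℝ) {K : ℕ} (β ϑ βs ϑs : Fin K → ℝ) : Finset (Fin K) :=
  (supp βs).biUnion fun k => near Kn r β ϑ (ϑs k)

end SpikeDeconv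

end

/-! Measure locations in units of `√2 * σ₀`. The limit kernel becomes `exp (-(x - y)² / 2)` with the
Euclidean metric, so the quantities that enter the bounds are controlled by numerical estimates free
of `σ₀`, `ε` and `b`. This is why the constants are universal.

Convergence. A product of two Gaussian features is a Gaussian in the difference of the locations
times a Gaussian centred at their midpoint. Hence, for any measure, the kernel is the limit kernel
times a ratio of values of one mass function (`kernel_eq`). On the grid this mass is a Riemann sum.
Since the locations keep a distance `ε * b T` from the endpoints, it converges uniformly together
with all its derivatives (`massSeq_unifConv`). The class `SmoothConv` is stable under sums,
products, linear substitutions and inverse square roots, so the kernels, their metrics and their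
normalized covariant derivatives converge too. The bounds on `rhoConst` and `proximity` follow. The
error bounds use two further consequences: the Riemannian distances agree up to a factor two
(`GridLimit.rdist_bounds`), and the normalized features form a curve in a Euclidean space whose Gram
kernel is nearly Gaussian, derivatives included (`NearGaussian`).

Deterministic part. Separation makes the Gram matrix of the features and their derivatives at the
true locations close to the identity. Values and slopes can therefore be interpolated by a vector of
norm at most `2 * √s` (`NearGaussian.exists_interpolation`). Interpolating the signs of the true
coefficients with zero slopes gives a function that falls below one quadratically near the true
locations and by a fixed amount far from them. Interpolating prescribed values and slopes gives a
function close to an affine one near each location. Testing the residual against both controls the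
local mass errors, first and second moments and far mass of the estimator. The noise term is at most
a small multiple of `κ` times the same quantities, so minimality closes the loop
(`NearGaussian.error_bounds`).

Probabilistic part. The small correlations at most double the variance of linear forms of the noise.
On a unit interval a function is bounded by the integrals of its modulus and of that of its
derivative. Jensen's inequality and a Chernoff bound control these integrals, and a union bound over
about `b T / σ₀` cells gives the event (`IsNoise.exists_event`). -/

namespace SpikeDeconv

/-! ### Families of functions of two variables that converge with all their derivatives -/

/-- A family of functions on the plane (`none` is the index of the limit) whose limit is bounded
and which converges uniformly on the squares `S n × S n`. -/
structure UnifConv (S : ℕ → Set ℝ) (F : Option ℕ → ℝ × ℝ → ℝ) : Prop where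
  bdd : ∃ C, ∀ p, |F none p| ≤ C
  conv : ∀ η > 0, ∀ᶠ n in atTop, ∀ p : ℝ × ℝ, p.1 ∈ S n → p.2 ∈ S n →
    |F (some n) p - F none p| ≤ η

/-- Directional derivative of a family. -/
noncomputable def dirDeriv (v : ℝ × ℝ) (F : Option ℕ → ℝ × ℝ → ℝ) : Option ℕ → ℝ × ℝ → ℝ :=
  fun i p => fderiv ℝ (F i) p v

/-- Uniform convergence of the directional derivatives of order at most `n`. -/
def SmoothConv (S : ℕ → Set ℝ) : ℕ → (Option ℕ → ℝ × ℝ → ℝ) → Prop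
  | 0, F => UnifConv S F
  | n + 1, F => UnifConv S F ∧ (∀ i, Differentiable ℝ (F i)) ∧
      ∀ v, SmoothConv S n (dirDeriv v F)

variable {S : ℕ → Set ℝ} {F G : Option ℕ → ℝ × ℝ → ℝ}

lemma SmoothConv.unifConv {n : ℕ} (h : SmoothConv S n F) : UnifConv S F := by
  cases n with
  | zero => exact h
  | succ n => exact h.1

lemma SmoothConv.of_succ {n : ℕ} (h : SmoothConv S (n + 1) F) : SmoothConv S n F := by
  induction n generalizing F with
  | zero => exact h.1
  | succ n ih => exact ⟨h.1, h.2.1, fun v => ih (h.2.2 v)⟩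

lemma UnifConv.add (hF : UnifConv S F) (hG : UnifConv S G) :
    UnifConv S (fun i p => F i p + G i p) := by
  obtain ⟨C, hC⟩ := hF.bdd
  obtain ⟨D, hD⟩ := hG.bdd
  refine ⟨⟨C + D, fun p => (abs_add_le _ _).trans (add_le_add (hC p) (hD p))⟩, fun η hη => ?_⟩
  filter_upwards [hF.conv (η / 2) (by positivity), hG.conv (η / 2) (by positivity)]
    with n h1 h2 p hp hp'
  have := abs_add_le (F (some n) p - F none p) (G (some n) p - G none p)
  have e : F (some n) p + G (some n) p - (F none p + G none p) =
    F (some n) p - F none p + (G (some n) p - G none p) := by ring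
  rw [e]
  linarith [h1 p hp hp', h2 p hp hp']

/-- Only the limits need to be bounded: the product of the two errors is of second order, and the
cross terms involve limits only. -/
lemma UnifConv.mul (hF : UnifConv S F) (hG : UnifConv S G) :
    UnifConv S (fun i p => F i p * G i p) := by
  obtain ⟨C, hC⟩ := hF.bdd
  obtain ⟨D, hD⟩ := hG.bdd
  have hC0 : 0 ≤ C := (abs_nonneg _).trans (hC 0)
  have hD0 : 0 ≤ D := (abs_nonneg _).trans (hD 0)
  refine ⟨⟨C * D, fun p => by
    rw [abs_mul]; exact mul_le_mul (hC p) (hD p) (abs_nonneg _) hC0⟩, fun η hη => ?_⟩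
  -- The `1` in the minimum gives `a² ≤ a`, which absorbs the product of the errors.
  set a := min 1 (η / (C + D + 1)) with ha
  have ha0 : 0 < a := by positivity
  filter_upwards [hF.conv a ha0, hG.conv a ha0] with n h1 h2 p hp hp'
  have e : F (some n) p * G (some n) p - F none p * G none p =
    (F (some n) p - F none p) * (G (some n) p - G none p) +
    ((F (some n) p - F none p) * G none p + F none p * (G (some n) p - G none p)) := by ring
  have h3 := h1 p hp hp'
  have h4 := h2 p hp hp'
  have ha1 : a ≤ 1 := min_le_left _ _
  have ha2 : a * (C + D + 1) ≤ η := by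
    rw [← le_div_iff₀ (by positivity)]; exact min_le_right _ _
  rw [e]
  calc _ ≤ |F (some n) p - F none p| * |G (some n) p - G none p| +
        (|F (some n) p - F none p| * |G none p| + |F none p| * |G (some n) p - G none p|) := by
        rw [← abs_mul, ← abs_mul, ← abs_mul]
        exact (abs_add_le _ _).trans (add_le_add le_rfl (abs_add_le _ _))
    _ ≤ a * 1 + (a * D + C * a) := by
        gcongr
        · exact h4.trans ha1
        · exact hD p
        · exact hC p
    _ ≤ η := by linarith

lemma unifConv_const (c : ℝ) : UnifConv S (fun _ _ => c) :=
  ⟨⟨|c|, fun _ => le_rfl⟩, fun η hη => Eventually.of_forall fun n p _ _ => by simpa using hη.le⟩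

lemma smoothConv_const (n : ℕ) (c : ℝ) : SmoothConv S n (fun _ _ => c) := by
  induction n generalizing c with
  | zero => exact unifConv_const c
  | succ n ih =>
    refine ⟨unifConv_const c, fun i => differentiable_const c, fun v => ?_⟩
    have : dirDeriv v (fun _ _ => c) = fun _ _ => 0 := by
      funext i p; simp [dirDeriv]
    rw [this]; exact ih 0

lemma SmoothConv.add {n : ℕ} (hF : SmoothConv S n F) (hG : SmoothConv S n G) :
    SmoothConv S n (fun i p => F i p + G i p) := by
  induction n generalizing F G with
  | zero => exact UnifConv.add hF hG
  | succ n ih =>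
    refine ⟨hF.1.add hG.1, fun i => (hF.2.1 i).add (hG.2.1 i), fun v => ?_⟩
    have : dirDeriv v (fun i p => F i p + G i p) =
        fun i p => dirDeriv v F i p + dirDeriv v G i p := by
      funext i p
      simp only [dirDeriv]
      rw [fderiv_fun_add (hF.2.1 i p) (hG.2.1 i p)]; rfl
    rw [this]; exact ih (hF.2.2 v) (hG.2.2 v)

lemma SmoothConv.mul {n : ℕ} (hF : SmoothConv S n F) (hG : SmoothConv S n G) :
    SmoothConv S n (fun i p => F i p * G i p) := by
  induction n generalizing F G with
  | zero => exact UnifConv.mul hF hG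
  | succ n ih =>
    refine ⟨hF.1.mul hG.1, fun i => (hF.2.1 i).mul (hG.2.1 i), fun v => ?_⟩
    have : dirDeriv v (fun i p => F i p * G i p) =
        fun i p => F i p * dirDeriv v G i p + G i p * dirDeriv v F i p := by
      funext i p
      simp only [dirDeriv]
      rw [fderiv_fun_mul (hF.2.1 i p) (hG.2.1 i p)]; rfl
    rw [this]; exact (ih hF.of_succ (hG.2.2 v)).add (ih hG.of_succ (hF.2.2 v))

lemma SmoothConv.comp {n : ℕ} (hF : SmoothConv S n F) (A : ℝ × ℝ →L[ℝ] ℝ × ℝ)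
    (hA : ∀ n p, p.1 ∈ S n → p.2 ∈ S n → (A p).1 ∈ S n ∧ (A p).2 ∈ S n) :
    SmoothConv S n (fun i p => F i (A p)) := by
  have key : ∀ F : Option ℕ → ℝ × ℝ → ℝ, UnifConv S F → UnifConv S (fun i p => F i (A p)) := by
    intro F hF
    obtain ⟨C, hC⟩ := hF.bdd
    refine ⟨⟨C, fun p => hC _⟩, fun η hη => ?_⟩
    filter_upwards [hF.conv η hη] with n hn p hp hp'
    exact hn _ (hA n p hp hp').1 (hA n p hp hp').2
  induction n generalizing F with
  | zero => exact key F hF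
  | succ n ih =>
    refine ⟨key F hF.1, fun i => (hF.2.1 i).comp A.differentiable, fun v => ?_⟩
    have : dirDeriv v (fun i p => F i (A p)) = fun i p => dirDeriv (A v) F i (A p) := by
      funext i p
      simp only [dirDeriv]
      have h := ((hF.2.1 i (A p)).hasFDerivAt.comp p A.hasFDerivAt).fderiv
      simp only [Function.comp_def] at h
      rw [h]; rfl
    rw [this]; exact ih (hF.2.2 (A v))

/-- Functions of a linear form, given with all their derivatives. -/
lemma smoothConv_of_seq (ζ : ℕ → Option ℕ → ℝ → ℝ) (l : ℝ × ℝ →L[ℝ] ℝ)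
    (hd : ∀ j i x, HasDerivAt (ζ j i) (ζ (j + 1) i x) x)
    (h0 : ∀ j, UnifConv S (fun i p => ζ j i (l p))) (n j : ℕ) :
    SmoothConv S n (fun i p => ζ j i (l p)) := by
  induction n generalizing j with
  | zero => exact h0 j
  | succ n ih =>
    have hh : ∀ i p, HasFDerivAt (fun p => ζ j i (l p)) (ζ (j + 1) i (l p) • l) p := fun i p =>
      (hd j i (l p)).comp_hasFDerivAt p l.hasFDerivAt
    refine ⟨h0 j, fun i p => (hh i p).differentiableAt, fun v => ?_⟩
    have : dirDeriv v (fun i p => ζ j i (l p)) = fun i p => ζ (j + 1) i (l p) * l v := by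
      funext i p
      simp only [dirDeriv, (hh i p).fderiv]; rfl
    rw [this]; exact (ih (j + 1)).mul (smoothConv_const n _)

lemma abs_inv_sqrt_sub_le {a b c : ℝ} (hc : 0 < c) (ha : c ≤ a) (hb : c ≤ b) :
    |(√a)⁻¹ - (√b)⁻¹| ≤ |a - b| / (c * √c) := by
  have hc' := Real.sqrt_pos.2 hc
  have ha' := Real.sqrt_le_sqrt ha
  have hb' := Real.sqrt_le_sqrt hb
  have hca := hc'.trans_le ha'
  have hcb := hc'.trans_le hb'
  have e : (√a)⁻¹ - (√b)⁻¹ = -(a - b) / (√a * √b * (√a + √b)) := by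
    have h1 : a = √a ^ 2 := (Real.sq_sqrt (hc.le.trans ha)).symm
    have h2 : b = √b ^ 2 := (Real.sq_sqrt (hc.le.trans hb)).symm
    rw [show a - b = (√a - √b) * (√a + √b) by nlinarith]
    field_simp
    ring
  rw [e, abs_div, abs_neg, abs_of_pos (show 0 < √a * √b * (√a + √b) by positivity)]
  apply div_le_div_of_nonneg_left (abs_nonneg _) (by positivity)
  calc c * √c = √c * √c * √c := by rw [Real.mul_self_sqrt hc.le]
    _ ≤ √a * √b * (√a + √b) := by
      gcongr
      linarith

/-- A lower bound on the limit is enough: the approximations eventually exceed `c / 2` on the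
squares, where the inverse square root is Lipschitz. -/
lemma UnifConv.inv_sqrt (hF : UnifConv S F) {c : ℝ} (hc : 0 < c) (hlim : ∀ p, c ≤ F none p) :
    UnifConv S (fun i p => (√(F i p))⁻¹) := by
  refine ⟨⟨(√c)⁻¹, fun p => ?_⟩, fun η hη => ?_⟩
  · rw [abs_of_nonneg (by positivity)]
    have := Real.sqrt_pos.2 hc
    gcongr
    exact hlim p
  · have hc2 : 0 < c / 2 := by positivity
    have hs : 0 < c / 2 * √(c / 2) := mul_pos hc2 (Real.sqrt_pos.2 hc2)
    filter_upwards [hF.conv (c / 2) hc2, hF.conv (η * (c / 2 * √(c / 2))) (by positivity)]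
      with n h1 h2 p hp hp'
    have h3 := (abs_le.1 (h1 p hp hp')).1
    refine (abs_inv_sqrt_sub_le hc2 (by linarith [hlim p]) (by linarith [hlim p])).trans ?_
    rw [div_le_iff₀ hs]
    exact h2 p hp hp'

/-- The derivative of `F^(-1/2)` is `-1/2 * (F^(-1/2))³ * F'`, a product of functions already known
to converge to one order less, so induction applies. -/
lemma SmoothConv.inv_sqrt {n : ℕ} (hF : SmoothConv S n F) (hpos : ∀ i p, 0 < F i p)
    {c : ℝ} (hc : 0 < c) (hlim : ∀ p, c ≤ F none p) :
    SmoothConv S n (fun i p => (√(F i p))⁻¹) := by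
  induction n with
  | zero => exact UnifConv.inv_sqrt hF hc hlim
  | succ n ih =>
    have hh : ∀ i p, HasFDerivAt (fun p => (√(F i p))⁻¹)
        ((-(√(F i p) ^ 2)⁻¹) • ((1 / (2 * √(F i p))) • fderiv ℝ (F i) p)) p := fun i p =>
      (hasDerivAt_inv (Real.sqrt_pos.2 (hpos i p)).ne').comp_hasFDerivAt p
        ((hF.2.1 i p).hasFDerivAt.sqrt (hpos i p).ne')
    refine ⟨hF.1.inv_sqrt hc hlim, fun i p => (hh i p).differentiableAt, fun v => ?_⟩
    have : dirDeriv v (fun i p => (√(F i p))⁻¹) = fun i p =>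
        -(1 / 2) * ((√(F i p))⁻¹ * ((√(F i p))⁻¹ * (√(F i p))⁻¹)) * dirDeriv v F i p := by
      funext i p
      have h1 := Real.sqrt_pos.2 (hpos i p)
      simp only [dirDeriv, (hh i p).fderiv, _root_.smul_apply, smul_eq_mul]
      field_simp
    rw [this]
    have h := ih hF.of_succ
    exact ((smoothConv_const n _).mul (h.mul (h.mul h))).mul (hF.2.2 v)

end SpikeDeconv

namespace SpikeDeconv

/-! ### Derivatives of the Gaussian profile -/

/-- The `n`-th derivative of the Gaussian profile. -/
noncomputable def hg (n : ℕ) : ℝ → ℝ := iteratedDeriv n gauss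

lemma contDiff_gauss {n : WithTop ℕ∞} : ContDiff ℝ n gauss := by
  unfold gauss; fun_prop

lemma hg_hasDerivAt (n : ℕ) (x : ℝ) : HasDerivAt (hg n) (hg (n + 1) x) x := by
  have h : Differentiable ℝ (hg n) :=
    (contDiff_gauss (n := (n + 1 : ℕ))).differentiable_iteratedDeriv n (by exact_mod_cast n.lt_succ_self)
  have := (h x).hasDerivAt
  rwa [hg, ← iteratedDeriv_succ] at this

lemma hg_continuous (n : ℕ) : Continuous (hg n) :=
  continuous_iff_continuousAt.2 fun x => (hg_hasDerivAt n x).continuousAt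

lemma hg_zero (x : ℝ) : hg 0 x = Real.exp (-x ^ 2 / 2) := by simp [hg, gauss]

lemma hg_one (x : ℝ) : hg 1 x = -x * Real.exp (-x ^ 2 / 2) := by
  refine (hg_hasDerivAt 0 x).unique ?_
  have h : HasDerivAt (fun x : ℝ => Real.exp (-x ^ 2 / 2)) (-x * Real.exp (-x ^ 2 / 2)) x := by
    have h1 : HasDerivAt (fun x : ℝ => -x ^ 2 / 2) (-x) x := by
      refine (((hasDerivAt_pow 2 x).fun_neg).div_const 2).congr_deriv ?_
      norm_num
      ring
    rw [mul_comm]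
    exact h1.exp
  simpa only [funext hg_zero] using h

lemma hg_two (x : ℝ) : hg 2 x = (x ^ 2 - 1) * Real.exp (-x ^ 2 / 2) := by
  refine (hg_hasDerivAt 1 x).unique ?_
  have h0 := hg_hasDerivAt 0 x
  rw [zero_add, hg_one, funext hg_zero] at h0
  rw [funext hg_one]
  refine ((hasDerivAt_id' x).fun_neg.fun_mul h0).congr_deriv ?_
  ring

lemma hg_three (x : ℝ) : hg 3 x = (3 * x - x ^ 3) * Real.exp (-x ^ 2 / 2) := by
  refine (hg_hasDerivAt 2 x).unique ?_
  have h0 := hg_hasDerivAt 0 x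
  rw [zero_add, hg_one, funext hg_zero] at h0
  rw [funext hg_two]
  refine (((hasDerivAt_pow 2 x).sub_const 1).fun_mul h0).congr_deriv ?_
  norm_num
  ring

/-- For monomials, `|x|^n ≤ n! * exp |x|` and `|x| ≤ 1 + x² / 4`. -/
lemma exists_abs_aeval_le (P : Polynomial ℤ) :
    ∃ C, ∀ x : ℝ, |Polynomial.aeval x P| ≤ C * Real.exp (x ^ 2 / 4) := by
  induction P using Polynomial.induction_on' with
  | add p q hp hq =>
    obtain ⟨C, hC⟩ := hp
    obtain ⟨D, hD⟩ := hq
    refine ⟨C + D, fun x => ?_⟩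
    rw [map_add, add_mul]
    exact (abs_add_le _ _).trans (add_le_add (hC x) (hD x))
  | monomial n a =>
    refine ⟨|(a : ℝ)| * (n.factorial * Real.exp 1), fun x => ?_⟩
    rw [Polynomial.aeval_monomial]
    simp only [algebraMap_int_eq, eq_intCast, abs_mul, abs_pow]
    rw [mul_assoc, mul_assoc, ← Real.exp_add]
    refine mul_le_mul_of_nonneg_left ?_ (abs_nonneg _)
    have h1 := Real.pow_div_factorial_le_exp |x| (abs_nonneg x) n
    rw [div_le_iff₀' (by positivity)] at h1
    refine h1.trans ?_
    gcongr
    nlinarith [sq_abs x, sq_nonneg (|x| - 2)]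

lemma exists_abs_hg_le (n : ℕ) : ∃ C, ∀ x, |hg n x| ≤ C * Real.exp (-(1 / 4) * x ^ 2) := by
  obtain ⟨C, hC⟩ := exists_abs_aeval_le (Polynomial.hermite n)
  refine ⟨C, fun x => ?_⟩
  have h : hg n x = (-1 : ℝ) ^ n * Polynomial.aeval x (Polynomial.hermite n) *
      Real.exp (-(x ^ 2 / 2)) := by
    rw [← Polynomial.deriv_gaussian_eq_hermite_mul_gaussian, hg, iteratedDeriv_eq_iterate]
    have : gauss = fun y => Real.exp (-(y ^ 2 / 2)) := by
      funext y
      rw [gauss, neg_div]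
    rw [this]
  rw [h, abs_mul, abs_mul, abs_pow, abs_neg, abs_one, one_pow, one_mul,
    abs_of_pos (Real.exp_pos _)]
  calc _ ≤ C * Real.exp (x ^ 2 / 4) * Real.exp (-(x ^ 2 / 2)) := by
        gcongr; exact hC x
    _ = _ := by rw [mul_assoc, ← Real.exp_add]; congr 2; ring

lemma exists_abs_hg_le_const (n : ℕ) : ∃ C, ∀ x, |hg n x| ≤ C := by
  obtain ⟨C, hC⟩ := exists_abs_hg_le n
  refine ⟨C, fun x => (hC x).trans ?_⟩
  have hC0 : 0 ≤ C := by
    have := (abs_nonneg _).trans (hC 0)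
    simpa using this
  refine mul_le_of_le_one_right hC0 (Real.exp_le_one_iff.2 (by nlinarith [sq_nonneg x]))

lemma integrable_hg (n : ℕ) : Integrable (hg n) := by
  obtain ⟨C, hC⟩ := exists_abs_hg_le n
  exact ((integrable_exp_neg_mul_sq (by norm_num : (0 : ℝ) < 1 / 4)).const_mul C).mono'
    (hg_continuous n).aestronglyMeasurable (Eventually.of_forall hC)

lemma integral_hg_succ (n : ℕ) : ∫ x, hg (n + 1) x = 0 :=
  integral_eq_zero_of_hasDerivAt_of_integrable (hg_hasDerivAt n) (integrable_hg _)
    (integrable_hg _)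

lemma integral_hg_zero : ∫ x, hg 0 x = √(2 * Real.pi) := by
  have h := integral_gaussian (1 / 2)
  rw [show Real.pi / (1 / 2) = 2 * Real.pi by ring] at h
  rw [← h]
  congr 1
  funext x
  rw [hg_zero]
  congr 1
  ring

/-! ### Riemann sums on the grid -/

lemma gridStep_pos {b : ℝ} {T : ℕ} (hb : 0 < b) (hT : 0 < T) : 0 < gridStep b T := by
  unfold gridStep
  have : (0 : ℝ) < T := by exact_mod_cast hT
  exact div_pos (by linarith) this

/-- On one cell `F` differs from its value at the right endpoint by at most its total variation
there. Summed over the cells, this bounds the error by the step times the integral of `|F'|`,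
whatever the translation. -/
lemma abs_sub_integral_le {F F' : ℝ → ℝ} (hF : ∀ x, HasDerivAt F (F' x) x)
    (hc : Continuous F') {a b : ℝ} (hab : a ≤ b) :
    |(b - a) * F b - ∫ x in a..b, F x| ≤ (b - a) * ∫ x in a..b, |F' x| := by
  have hFc : Continuous F := continuous_iff_continuousAt.2 fun x => (hF x).continuousAt
  have e : (b - a) * F b - ∫ x in a..b, F x = ∫ x in a..b, (F b - F x) := by
    rw [intervalIntegral.integral_sub (by simp) (hFc.intervalIntegrable _ _)]
    simp
  rw [e]
  have h := intervalIntegral.norm_integral_le_of_norm_le_const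
    (a := a) (b := b) (f := fun x => F b - F x) (C := ∫ x in a..b, |F' x|) ?_
  · rw [Real.norm_eq_abs, abs_of_nonneg (sub_nonneg.2 hab)] at h
    linarith
  · intro x hx
    rw [Set.uIoc_of_le hab] at hx
    have hFx : ∫ y in x..b, F' y = F b - F x :=
      intervalIntegral.integral_eq_sub_of_hasDerivAt (fun y _ => hF y)
        (hc.intervalIntegrable _ _)
    rw [← hFx, Real.norm_eq_abs]
    refine (intervalIntegral.abs_integral_le_integral_abs hx.2).trans ?_
    refine intervalIntegral.integral_mono_interval hx.1.le hx.2 le_rfl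
      (Eventually.of_forall fun y => abs_nonneg _) (hc.abs.intervalIntegrable _ _)

/-- Riemann sums of a smooth integrable function on a translated regular grid. -/
lemma abs_riemann_sub_le {F F' : ℝ → ℝ} (hF : ∀ x, HasDerivAt F (F' x) x)
    (hc : Continuous F') (hi : Integrable F') {b : ℝ} {T : ℕ} (hb : 0 < b) (hT : 0 < T) (m : ℝ) :
    |gridStep b T * ∑ j : Fin T, F (gridPoint b T j - m) - ∫ x in (-b - m)..(b - m), F x| ≤
      gridStep b T * ∫ x, |F' x| := by
  have hΔ := gridStep_pos hb hT
  set Δ := gridStep b T with hΔd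
  have hFc : Continuous F := continuous_iff_continuousAt.2 fun x => (hF x).continuousAt
  set a : ℕ → ℝ := fun k => -b + k * Δ - m with ha
  have ha0 : a 0 = -b - m := by simp [ha]
  have haT : a T = b - m := by
    have : (T : ℝ) ≠ 0 := by exact_mod_cast hT.ne'
    simp only [ha, hΔd, gridStep]
    field_simp
    ring
  have hstep : ∀ k, a (k + 1) - a k = Δ := fun k => by simp only [ha]; push_cast; ring
  have hsum1 := intervalIntegral.sum_integral_adjacent_intervals (a := a) (n := T) (f := F)
    (μ := volume) (fun k _ => hFc.intervalIntegrable _ _)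
  have hsum2 := intervalIntegral.sum_integral_adjacent_intervals (a := a) (n := T)
    (f := fun x => |F' x|) (μ := volume) (fun k _ => hc.abs.intervalIntegrable _ _)
  rw [ha0, haT] at hsum1 hsum2
  have hgrid : ∑ j : Fin T, F (gridPoint b T j - m) = ∑ k ∈ Finset.range T, F (a (k + 1)) := by
    rw [Finset.sum_range]
    refine Finset.sum_congr rfl fun j _ => ?_
    simp only [ha, gridPoint]
    push_cast
    rfl
  rw [hgrid, ← hsum1, Finset.mul_sum, ← Finset.sum_sub_distrib]
  refine (Finset.abs_sum_le_sum_abs _ _).trans ?_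
  calc _ ≤ ∑ k ∈ Finset.range T, Δ * ∫ x in (a k)..(a (k + 1)), |F' x| := by
        refine Finset.sum_le_sum fun k _ => ?_
        have := abs_sub_integral_le hF hc (a := a k) (b := a (k + 1)) (by linarith [hstep k])
        rwa [hstep k] at this
    _ = Δ * ∫ x in (-b - m)..(b - m), |F' x| := by rw [← Finset.mul_sum, hsum2]
    _ ≤ _ := by
        refine mul_le_mul_of_nonneg_left ?_ hΔ.le
        rw [intervalIntegral.integral_of_le (by linarith)]
        exact setIntegral_le_integral hi.abs (Eventually.of_forall fun x => abs_nonneg _)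

/-- Uniform convergence of the Riemann sums over the translations by `[-(1-ε)b, (1-ε)b]`. -/
lemma riemann_tendsto {F F' : ℝ → ℝ} (hF : ∀ x, HasDerivAt F (F' x) x)
    (hc : Continuous F') (hi : Integrable F') (hi0 : Integrable F) {b : ℕ → ℝ} {ε : ℝ}
    (hε : 0 < ε) (hbpos : ∀ T, 2 ≤ T → 0 < b T) (hb : Tendsto b atTop atTop)
    (hΔ : Tendsto (fun T => gridStep (b T) T) atTop (𝓝 0)) {η : ℝ} (hη : 0 < η) :
    ∀ᶠ T in atTop, ∀ m ∈ paramSet (b T) ε,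
      |gridStep (b T) T * ∑ j : Fin T, F (gridPoint (b T) T j - m) - ∫ x, F x| ≤ η := by
  have h1 : Tendsto (fun p : ℝ × ℝ => ∫ x in p.1..p.2, F x) (atBot ×ˢ atTop) (𝓝 (∫ x, F x)) :=
    intervalIntegral_tendsto_integral hi0 tendsto_fst tendsto_snd
  have h2 := (Metric.tendsto_nhds.1 h1 (η / 2) (by positivity))
  rw [Filter.eventually_prod_iff] at h2
  obtain ⟨p, hp, q, hq, hpq⟩ := h2
  obtain ⟨A, hA⟩ := eventually_atBot.1 hp
  obtain ⟨B, hB⟩ := eventually_atTop.1 hq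
  have h3 : Tendsto (fun T => gridStep (b T) T * ∫ x, |F' x|) atTop (𝓝 0) := by
    simpa using hΔ.mul_const (∫ x, |F' x|)
  filter_upwards [hb.eventually_ge_atTop (max (-A) B / ε), eventually_ge_atTop 2,
    h3.eventually (gt_mem_nhds (show 0 < η / 2 by positivity))] with T h4 h5 h6 m hm
  have hm' := Set.mem_Icc.1 hm
  rw [div_le_iff₀ hε] at h4
  have h7 := abs_riemann_sub_le hF hc hi (hbpos T h5) (by omega : 0 < T) m
  -- Since `|m| ≤ (1 - ε) * b T`, the endpoints lie beyond `-ε * b T` and `ε * b T`, so the tails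
  -- vanish uniformly in `m`.
  have h8 := hpq (hA (-b T - m) (by nlinarith [le_max_left (-A) B]))
    (hB (b T - m) (by nlinarith [le_max_right (-A) B]))
  rw [Real.dist_eq] at h8
  have := abs_sub_le (gridStep (b T) T * ∑ j : Fin T, F (gridPoint (b T) T j - m))
    (∫ x in (-b T - m)..(b T - m), F x) (∫ x, F x)
  simp only at h8
  linarith

end SpikeDeconv

namespace SpikeDeconv

/-! ### The kernel in terms of the mass function -/

/-- The mass `∫ exp(-(t-m)²/σ₀²) dlam(t)`. -/
noncomputable def massFun (lam : Measure ℝ) (σ₀ m : ℝ) : ℝ := ∫ t, gauss (√2 / σ₀ * (t - m)) ∂lam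

/-- The parallelogram identity `(t-θ)² + (t-θ')² = (θ-θ')²/2 + 2(t-(θ+θ')/2)²`. It separates the
variable of integration from the difference of the locations. -/
lemma feature_mul_feature {σ₀ : ℝ} (hσ : 0 < σ₀) (θ θ' t : ℝ) :
    feature σ₀ θ t * feature σ₀ θ' t =
      gauss ((√2 * σ₀)⁻¹ * (θ - θ')) * gauss (√2 / σ₀ * (t - (θ + θ') / 2)) := by
  have h2 : √2 ^ 2 = (2 : ℝ) := Real.sq_sqrt (by norm_num)
  have h2' : (√2)⁻¹ ^ 2 = (2 : ℝ)⁻¹ := by rw [inv_pow, h2]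
  simp only [feature, gauss, ← Real.exp_add]
  congr 1
  simp only [mul_pow, div_pow, mul_inv, h2, h2', inv_pow]
  field_simp
  ring

lemma ip_feature {σ₀ : ℝ} (hσ : 0 < σ₀) (lam : Measure ℝ) (θ θ' : ℝ) :
    ip lam (feature σ₀ θ) (feature σ₀ θ') =
      gauss ((√2 * σ₀)⁻¹ * (θ - θ')) * massFun lam σ₀ ((θ + θ') / 2) := by
  simp only [ip, feature_mul_feature hσ, massFun]
  rw [integral_const_mul]

lemma l2norm_feature {σ₀ : ℝ} (hσ : 0 < σ₀) (lam : Measure ℝ) (θ : ℝ) :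
    l2norm lam (feature σ₀ θ) = √(massFun lam σ₀ θ) := by
  rw [l2norm, ip_feature hσ]
  simp [gauss]

lemma kernel_eq {σ₀ : ℝ} (hσ : 0 < σ₀) (lam : Measure ℝ) (θ θ' : ℝ) :
    kernel lam σ₀ θ θ' = gauss ((√2 * σ₀)⁻¹ * (θ - θ')) * massFun lam σ₀ ((θ + θ') / 2) *
      ((√(massFun lam σ₀ θ))⁻¹ * (√(massFun lam σ₀ θ'))⁻¹) := by
  rw [← ip_feature hσ, kernel, ip, ip, ← integral_mul_const]
  refine integral_congr_ae (Eventually.of_forall fun t => ?_)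
  simp only [nfeature, l2norm_feature hσ]
  ring

lemma integral_gridMeasure {b : ℝ} {T : ℕ} (hΔ : 0 ≤ gridStep b T) (f : ℝ → ℝ) :
    ∫ t, f t ∂gridMeasure b T = gridStep b T * ∑ j : Fin T, f (gridPoint b T j) := by
  rw [gridMeasure, integral_smul_measure, ENNReal.toReal_ofReal hΔ, smul_eq_mul,
    integral_finsetSum_measure fun j _ => integrable_dirac (by simp)]
  simp

/-- The derivatives of the mass functions; `none` is the index of the limit. -/
noncomputable def massSeq (b : ℕ → ℝ) (σ₀ : ℝ) (j : ℕ) : Option ℕ → ℝ → ℝ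
  | none => fun _ => if j = 0 then (√2 / σ₀)⁻¹ * √(2 * Real.pi) else 0
  | some n => fun m => gridStep (b (n + 2)) (n + 2) * ∑ i : Fin (n + 2),
      (-(√2 / σ₀)) ^ j * hg j (√2 / σ₀ * (gridPoint (b (n + 2)) (n + 2) i - m))

/-- The measures of the sequence, indexed from `T = 2`; `none` is the index of the limit. -/
noncomputable def lamSeq (b : ℕ → ℝ) : Option ℕ → Measure ℝ
  | none => volume
  | some n => gridMeasure (b (n + 2)) (n + 2)

lemma massFun_lamSeq {b : ℕ → ℝ} (hb : ∀ T, 2 ≤ T → 0 < b T) {σ₀ : ℝ} (hσ : 0 < σ₀)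
    (i : Option ℕ) (m : ℝ) : massFun (lamSeq b i) σ₀ m = massSeq b σ₀ 0 i m := by
  have hh : gauss = hg 0 := by simp [hg]
  cases i with
  | none =>
    simp only [massFun, lamSeq, massSeq, if_true, hh]
    rw [integral_sub_right_eq_self (fun t => hg 0 (√2 / σ₀ * t)),
      Measure.integral_comp_mul_left, integral_hg_zero, smul_eq_mul, abs_of_pos (by positivity)]
  | some n =>
    simp only [massFun, lamSeq, massSeq]
    rw [integral_gridMeasure (gridStep_pos (hb _ (by omega)) (by omega)).le]
    simp [hh]

lemma massSeq_hasDerivAt (b : ℕ → ℝ) (σ₀ : ℝ) (j : ℕ) (i : Option ℕ) (x : ℝ) :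
    HasDerivAt (massSeq b σ₀ j i) (massSeq b σ₀ (j + 1) i x) x := by
  cases i with
  | none => exact hasDerivAt_const _ _
  | some n =>
    simp only [massSeq]
    refine HasDerivAt.const_mul _ (HasDerivAt.fun_sum fun i _ => ?_)
    have h1 : HasDerivAt (fun m => √2 / σ₀ * (gridPoint (b (n + 2)) (n + 2) i - m))
        (-(√2 / σ₀)) x := by
      simpa using ((hasDerivAt_id' x).const_sub (gridPoint (b (n + 2)) (n + 2) i)).const_mul
        (√2 / σ₀)
    refine (((hg_hasDerivAt j _).comp x h1).const_mul ((-(√2 / σ₀)) ^ j)).congr_deriv ?_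
    ring

lemma massSeq_pos {b : ℕ → ℝ} (hb : ∀ T, 2 ≤ T → 0 < b T) {σ₀ : ℝ} (hσ : 0 < σ₀)
    (i : Option ℕ) (m : ℝ) : 0 < massSeq b σ₀ 0 i m := by
  cases i with
  | none => simp only [massSeq, if_true]; positivity
  | some n =>
    simp only [massSeq]
    refine mul_pos (gridStep_pos (hb _ (by omega)) (by omega))
      (Finset.sum_pos (fun i _ => ?_) Finset.univ_nonempty)
    rw [hg_zero]; positivity

/-- The sets over which the kernels are compared. -/
def squareSeq (b : ℕ → ℝ) (ε : ℝ) (n : ℕ) : Set ℝ := paramSet (b (n + 2)) ε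

variable {b : ℕ → ℝ} {ε σ₀ : ℝ}

/-- Each derivative of the mass is again a Riemann sum. It tends to the integral of a derivative of
the Gaussian, which vanishes from order one on, in agreement with a constant limit mass. -/
lemma massSeq_unifConv (hσ : 0 < σ₀) (hε : 0 < ε)
    (hbpos : ∀ T, 2 ≤ T → 0 < b T) (hb : Tendsto b atTop atTop)
    (hΔ : Tendsto (fun T => gridStep (b T) T) atTop (𝓝 0)) (j : ℕ) {η : ℝ} (hη : 0 < η) :
    ∀ᶠ n in atTop, ∀ m ∈ squareSeq b ε n,
      |massSeq b σ₀ j (some n) m - massSeq b σ₀ j none m| ≤ η := by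
  set a := √2 / σ₀ with ha
  have ha0 : 0 < a := by positivity
  have hF : ∀ x, HasDerivAt (fun x => (-a) ^ j * hg j (a * x))
      ((-a) ^ j * (hg (j + 1) (a * x) * a)) x := fun x => by
    have h1 : HasDerivAt (fun x => a * x) a x := by simpa using (hasDerivAt_id' x).const_mul a
    exact ((hg_hasDerivAt j _).comp x h1).const_mul _
  have hlim : ∫ x, (-a) ^ j * hg j (a * x) = massSeq b σ₀ j none 0 := by
    rw [integral_const_mul, Measure.integral_comp_mul_left]
    cases j with
    | zero => simp [massSeq, integral_hg_zero, abs_of_pos ha0, ← ha]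
    | succ j => simp [massSeq, integral_hg_succ]
  have h := riemann_tendsto hF
    (continuous_const.mul (((hg_continuous _).comp (continuous_const_mul a)).mul continuous_const))
    ((((integrable_hg (j + 1)).comp_mul_left' ha0.ne').mul_const a).const_mul _)
    (((integrable_hg j).comp_mul_left' ha0.ne').const_mul _) hε hbpos hb hΔ hη
  filter_upwards [(tendsto_add_atTop_nat 2).eventually h] with n hn m hm
  have := hn m hm
  rw [hlim] at this
  exact this

lemma paramSet_mid {b : ℝ} {x y : ℝ} (hx : x ∈ paramSet b ε) (hy : y ∈ paramSet b ε) :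
    (x + y) / 2 ∈ paramSet b ε := by
  rw [paramSet, Set.mem_Icc] at *
  constructor <;> linarith [hx.1, hx.2, hy.1, hy.2]

/-- The kernels of the sequence as functions on the plane. -/
noncomputable def kernelSeq (b : ℕ → ℝ) (σ₀ : ℝ) (i : Option ℕ) (p : ℝ × ℝ) : ℝ :=
  kernel (lamSeq b i) σ₀ p.1 p.2

lemma kernelSeq_smoothConv (hσ : 0 < σ₀) (hε : 0 < ε)
    (hbpos : ∀ T, 2 ≤ T → 0 < b T) (hb : Tendsto b atTop atTop)
    (hΔ : Tendsto (fun T => gridStep (b T) T) atTop (𝓝 0)) (n : ℕ) :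
    SmoothConv (squareSeq b ε) n (kernelSeq b σ₀) := by
  set c := (√2 * σ₀)⁻¹ with hc
  have hm : ∀ l : ℝ × ℝ →L[ℝ] ℝ, (∀ n (p : ℝ × ℝ), p.1 ∈ squareSeq b ε n →
      p.2 ∈ squareSeq b ε n → l p ∈ squareSeq b ε n) →
      SmoothConv (squareSeq b ε) n (fun i p => massSeq b σ₀ 0 i (l p)) := fun l hl =>
    smoothConv_of_seq (massSeq b σ₀) l (massSeq_hasDerivAt b σ₀) (fun j =>
      ⟨⟨|massSeq b σ₀ j none 0|, fun p => le_rfl⟩, fun η hη => by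
        filter_upwards [massSeq_unifConv hσ hε hbpos hb hΔ j hη] with n hn p hp hp'
        exact hn _ (hl n p hp hp')⟩) n 0
  have hpos := massSeq_pos hbpos hσ
  have h1 := hm (ContinuousLinearMap.fst ℝ ℝ ℝ) fun n p hp _ => hp
  have h2 := hm (ContinuousLinearMap.snd ℝ ℝ ℝ) fun n p _ hp => hp
  have h3 := hm ((2 : ℝ)⁻¹ • (ContinuousLinearMap.fst ℝ ℝ ℝ + ContinuousLinearMap.snd ℝ ℝ ℝ))
    fun n p hp hp' => by
      have := paramSet_mid hp hp'
      simpa [squareSeq, div_eq_inv_mul, mul_add] using this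
  have h4 : SmoothConv (squareSeq b ε) n (fun _ p => hg 0
      ((c • (ContinuousLinearMap.fst ℝ ℝ ℝ - ContinuousLinearMap.snd ℝ ℝ ℝ)) p)) :=
    smoothConv_of_seq (fun j _ => hg j) _ (fun j _ => hg_hasDerivAt j) (fun j =>
      ⟨(exists_abs_hg_le_const j).imp fun C hC p => hC _,
        fun η hη => Eventually.of_forall fun n p _ _ => by simpa using hη.le⟩) n 0
  have h5 := (h4.mul h3).mul
    ((h1.inv_sqrt (fun i p => hpos i _) (hpos none 0) (fun p => le_rfl)).mul
      (h2.inv_sqrt (fun i p => hpos i _) (hpos none 0) (fun p => le_rfl)))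
  convert h5 using 1
  funext i p
  rw [kernelSeq, kernel_eq hσ]
  simp only [massFun_lamSeq hbpos hσ]
  simp [hg, div_eq_inv_mul, hc, mul_add]

end SpikeDeconv

namespace SpikeDeconv

open scoped RealInnerProductSpace

/-! ### Normalized covariant derivatives as iterated derivatives -/

/-- The iterates of `g^{-1/2} ∂`. -/
noncomputable def normDeriv (g : ℝ → ℝ) : ℕ → (ℝ → ℝ) → ℝ → ℝ
  | 0, f => f
  | i + 1, f => fun θ => deriv (normDeriv g i f) θ / √(g θ)

/-- Dividing the recursion `D_{i+1} f = g^{i/2} ∂(D_i f / g^{i/2})` by `g^{(i+1)/2}` leaves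
`g^{-1/2} ∂` applied to the previous normalized derivative. In this form a single induction handles
all orders. -/
lemma covDeriv_div {g : ℝ → ℝ} (hg : ∀ x, 0 < g x) (i : ℕ) (f : ℝ → ℝ) :
    (fun θ => covDeriv g i f θ / √(g θ) ^ i) = normDeriv g i f := by
  induction i with
  | zero => funext θ; simp [covDeriv, normDeriv]
  | succ i ih =>
    funext θ
    have := Real.sqrt_pos.2 (hg θ)
    simp only [covDeriv, normDeriv, ih]
    field_simp
    ring

lemma normDeriv_mul_const (g : ℝ → ℝ) (i : ℕ) (f : ℝ → ℝ) (a : ℝ) :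
    normDeriv g i (fun x => f x * a) = fun x => normDeriv g i f x * a := by
  induction i with
  | zero => rfl
  | succ i ih =>
    funext θ
    simp only [normDeriv, ih, deriv_mul_const_field]
    ring

lemma kernelDeriv_eq {K : ℝ → ℝ → ℝ} (hg : ∀ x, 0 < metricCoeff K x) (i j : ℕ) (θ θ' : ℝ) :
    kernelDeriv K i j θ θ' =
      normDeriv (metricCoeff K) i (fun x => normDeriv (metricCoeff K) j (K x) θ') θ := by
  set g := metricCoeff K with hgd
  have h1 : (fun x => normDeriv g j (K x) θ') =
      fun x => covDeriv g j (K x) θ' * (√(g θ') ^ j)⁻¹ := by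
    funext x
    rw [← covDeriv_div hg]
    exact div_eq_mul_inv _ _
  rw [h1, normDeriv_mul_const, ← covDeriv_div hg, kernelDeriv, covDeriv₂, ← hgd]
  field_simp

/-! ### The features as a curve in a Euclidean space -/

/-- The vector of the values on the grid of a function, scaled so as to be an isometry. -/
noncomputable def gridVec (b : ℝ) (T : ℕ) (f : ℝ → ℝ) : EuclideanSpace ℝ (Fin T) :=
  WithLp.toLp 2 fun j => √(gridStep b T) * f (gridPoint b T j)

lemma inner_gridVec {b : ℝ} {T : ℕ} (hΔ : 0 ≤ gridStep b T) (f g : ℝ → ℝ) :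
    ⟪gridVec b T f, gridVec b T g⟫ = ip (gridMeasure b T) f g := by
  rw [ip, integral_gridMeasure hΔ, PiLp.inner_apply, Finset.mul_sum]
  refine Finset.sum_congr rfl fun j _ => ?_
  have := Real.mul_self_sqrt hΔ
  simp only [gridVec, RCLike.inner_apply, conj_trivial]
  linear_combination (f (gridPoint b T j) * g (gridPoint b T j)) * this

/-- The normalized feature as a vector. -/
noncomputable def featVec (b : ℝ) (T : ℕ) (σ₀ θ : ℝ) : EuclideanSpace ℝ (Fin T) :=
  gridVec b T (nfeature (gridMeasure b T) σ₀ θ)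

lemma inner_featVec {b : ℝ} {T : ℕ} (hΔ : 0 ≤ gridStep b T) (σ₀ θ θ' : ℝ) :
    ⟪featVec b T σ₀ θ, featVec b T σ₀ θ'⟫ = kernelGrid b T σ₀ θ θ' := inner_gridVec hΔ _ _

lemma massFun_grid {b : ℝ} {T : ℕ} (hΔ : 0 ≤ gridStep b T) (σ₀ m : ℝ) :
    massFun (gridMeasure b T) σ₀ m =
      gridStep b T * ∑ j : Fin T, gauss (√2 / σ₀ * (gridPoint b T j - m)) :=
  integral_gridMeasure hΔ _

lemma massFun_grid_pos {b : ℝ} {T : ℕ} (hb : 0 < b) (hT : 0 < T) (σ₀ m : ℝ) :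
    0 < massFun (gridMeasure b T) σ₀ m := by
  have hΔ := gridStep_pos hb hT
  rw [massFun_grid hΔ.le]
  have : Nonempty (Fin T) := ⟨⟨0, hT⟩⟩
  exact mul_pos hΔ (Finset.sum_pos (fun i _ => Real.exp_pos _) Finset.univ_nonempty)

lemma contDiff_inv_sqrt_massFun {b : ℝ} {T : ℕ} (hb : 0 < b) (hT : 0 < T) (σ₀ : ℝ)
    {n : WithTop ℕ∞} : ContDiff ℝ n fun m => (√(massFun (gridMeasure b T) σ₀ m))⁻¹ := by
  have h : ContDiff ℝ n fun m => massFun (gridMeasure b T) σ₀ m := by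
    simp only [massFun_grid (gridStep_pos hb hT).le, gauss]
    fun_prop
  exact (h.sqrt fun m => (massFun_grid_pos hb hT σ₀ m).ne').inv fun m =>
    (Real.sqrt_pos.2 (massFun_grid_pos hb hT σ₀ m)).ne'

lemma featVec_apply {b : ℝ} {T : ℕ} {σ₀ : ℝ} (hσ : 0 < σ₀) (θ : ℝ) (j : Fin T) :
    featVec b T σ₀ θ j = √(gridStep b T) * (gauss ((gridPoint b T j - θ) / σ₀) *
      (√(massFun (gridMeasure b T) σ₀ θ))⁻¹) := by
  simp [featVec, gridVec, nfeature, l2norm_feature hσ, feature, div_eq_mul_inv]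

lemma contDiff_featVec {b : ℝ} {T : ℕ} (hb : 0 < b) (hT : 0 < T) {σ₀ : ℝ} (hσ : 0 < σ₀)
    {n : WithTop ℕ∞} : ContDiff ℝ n (featVec b T σ₀) := by
  rw [contDiff_euclidean]
  intro j
  simp only [featVec_apply hσ, gauss]
  have := contDiff_inv_sqrt_massFun hb hT σ₀ (n := n)
  fun_prop

/-- Up to a positive Gaussian factor, the coordinates of the derivative are the values at the grid
points of an affine function of positive slope, which cannot vanish at two distinct points. This is
where `2 ≤ T` matters: it makes the metric positive. -/
lemma deriv_featVec_ne_zero {b : ℝ} {T : ℕ} (hb : 0 < b) (hT : 2 ≤ T) {σ₀ : ℝ} (hσ : 0 < σ₀)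
    (θ : ℝ) : deriv (featVec b T σ₀) θ ≠ 0 := by
  have hT0 : 0 < T := by omega
  have hΔ := gridStep_pos hb hT0
  set N : ℝ → ℝ := fun m => (√(massFun (gridMeasure b T) σ₀ m))⁻¹ with hN
  have hNd : HasDerivAt N (deriv N θ) θ :=
    ((contDiff_inv_sqrt_massFun hb hT0 σ₀ (n := 1)).differentiable one_ne_zero θ).hasDerivAt
  have hN0 : 0 < N θ := inv_pos.2 (Real.sqrt_pos.2 (massFun_grid_pos hb hT0 σ₀ θ))
  have hd := ((contDiff_featVec hb hT0 hσ (n := 1)).differentiable one_ne_zero θ).hasDerivAt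
  intro h0
  rw [h0] at hd
  have key : ∀ j : Fin T, (gridPoint b T j - θ) / σ₀ ^ 2 * N θ + deriv N θ = 0 := by
    intro j
    have h1 : HasDerivAt (fun x => featVec b T σ₀ x j) 0 θ := by
      exact (EuclideanSpace.proj (𝕜 := ℝ) j).hasFDerivAt.comp_hasDerivAt θ hd
    have h2 : HasDerivAt (fun x => gauss ((gridPoint b T j - x) / σ₀))
        (gauss ((gridPoint b T j - θ) / σ₀) * ((gridPoint b T j - θ) / σ₀ ^ 2)) θ := by
      have h3 : HasDerivAt (fun x => -((gridPoint b T j - x) / σ₀) ^ 2 / 2)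
          ((gridPoint b T j - θ) / σ₀ ^ 2) θ := by
        refine ((((((hasDerivAt_id' θ).const_sub (gridPoint b T j)).div_const σ₀).fun_pow
          2).fun_neg).div_const 2).congr_deriv ?_
        field_simp
        norm_num
        field_simp
      exact h3.exp
    have h4 := (h2.fun_mul hNd).const_mul √(gridStep b T)
    have h5 := h4.congr_of_eventuallyEq
      (Eventually.of_forall fun x => featVec_apply hσ x j) |>.unique h1
    have h6 := Real.sqrt_pos.2 hΔ
    have h7 : 0 < gauss ((gridPoint b T j - θ) / σ₀) := Real.exp_pos _
    have h8 : √(gridStep b T) * gauss ((gridPoint b T j - θ) / σ₀) *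
      ((gridPoint b T j - θ) / σ₀ ^ 2 * N θ + deriv N θ) = 0 := by
      rw [← h5]; ring
    rcases mul_eq_zero.1 h8 with h | h
    · exact absurd h (mul_pos h6 h7).ne'
    · exact h
  have k0 := key ⟨0, hT0⟩
  have k1 := key ⟨1, by omega⟩
  have hp : gridPoint b T ⟨1, by omega⟩ - gridPoint b T ⟨0, hT0⟩ = gridStep b T := by
    simp only [gridPoint]; push_cast; ring
  have : gridStep b T / σ₀ ^ 2 * N θ = 0 := by
    rw [← hp]
    linear_combination k1 - k0
  exact absurd this (by positivity)

lemma metricCoeff_inner {E : Type*} [NormedAddCommGroup E] [InnerProductSpace ℝ E] {φ : ℝ → E}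
    (hφ : Differentiable ℝ φ) (θ : ℝ) :
    metricCoeff (fun x y => ⟪φ x, φ y⟫) θ = ⟪deriv φ θ, deriv φ θ⟫ := by
  have h1 : ∀ x, deriv (fun y => ⟪φ x, φ y⟫) θ = ⟪φ x, deriv φ θ⟫ := fun x => by
    simpa using (HasDerivAt.inner ℝ (hasDerivAt_const θ (φ x)) (hφ θ).hasDerivAt).deriv
  simp only [metricCoeff, h1]
  simpa using (HasDerivAt.inner ℝ (hφ θ).hasDerivAt (hasDerivAt_const θ (deriv φ θ))).deriv

lemma metricCoeff_kernelGrid_pos {b : ℝ} {T : ℕ} (hb : 0 < b) (hT : 2 ≤ T) {σ₀ : ℝ}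
    (hσ : 0 < σ₀) (θ : ℝ) : 0 < metricCoeff (kernelGrid b T σ₀) θ := by
  have hT0 : 0 < T := by omega
  have h : kernelGrid b T σ₀ = fun x y => ⟪featVec b T σ₀ x, featVec b T σ₀ y⟫ := by
    funext x y; rw [inner_featVec (gridStep_pos hb hT0).le]
  rw [h, metricCoeff_inner ((contDiff_featVec hb hT0 hσ (n := 1)).differentiable one_ne_zero)]
  exact real_inner_self_pos.2 (deriv_featVec_ne_zero hb hT hσ θ)

/-! ### The limit kernel -/

variable {b : ℕ → ℝ} {ε σ₀ : ℝ}

lemma kernelInf_eq (hσ : 0 < σ₀) (θ θ' : ℝ) :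
    kernelInf σ₀ θ θ' = hg 0 ((√2 * σ₀)⁻¹ * (θ - θ')) := by
  have h : ∀ m, massFun volume σ₀ m = massFun volume σ₀ 0 := fun m => by
    simp only [massFun, sub_zero]
    exact integral_sub_right_eq_self (fun t => gauss (√2 / σ₀ * t)) m
  have hpos : 0 < massFun volume σ₀ 0 := by
    have h1 := massFun_lamSeq (b := fun _ => 1) (fun _ _ => one_pos) hσ none 0
    have h2 := massSeq_pos (b := fun _ => 1) (fun _ _ => one_pos) hσ none 0
    simp only [lamSeq] at h1
    rwa [h1]
  rw [kernelInf, kernel_eq hσ, h, h θ, h θ']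
  have h3 := Real.mul_self_sqrt hpos.le
  have h4 := Real.sqrt_pos.2 hpos
  have : massFun volume σ₀ 0 * ((√(massFun volume σ₀ 0))⁻¹ * (√(massFun volume σ₀ 0))⁻¹) = 1 := by
    field_simp
    rw [sq, h3]
  rw [mul_assoc, this]
  simp [hg]

lemma hg_comp_left (c θ' : ℝ) (n : ℕ) (x : ℝ) :
    HasDerivAt (fun x => hg n (c * (x - θ'))) (hg (n + 1) (c * (x - θ')) * c) x := by
  have h1 : HasDerivAt (fun x => c * (x - θ')) c x := by
    simpa using ((hasDerivAt_id' x).sub_const θ').const_mul c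
  exact (hg_hasDerivAt n _).comp x h1

lemma hg_comp_right (c θ : ℝ) (n : ℕ) (y : ℝ) :
    HasDerivAt (fun y => hg n (c * (θ - y))) (hg (n + 1) (c * (θ - y)) * -c) y := by
  have h1 : HasDerivAt (fun y => c * (θ - y)) (-c) y := by
    simpa using ((hasDerivAt_id' y).const_sub θ).const_mul c
  exact (hg_hasDerivAt n _).comp y h1

lemma metricCoeff_kernelInf (hσ : 0 < σ₀) (θ : ℝ) :
    metricCoeff (kernelInf σ₀) θ = (√2 * σ₀)⁻¹ ^ 2 := by
  simp only [metricCoeff, kernelInf_eq hσ, (hg_comp_right _ _ _ _).deriv]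
  rw [((hg_comp_left _ _ _ _).mul_const _).deriv]
  simp [hg_two]
  ring

lemma sqrt_metricCoeff_kernelInf (hσ : 0 < σ₀) (θ : ℝ) :
    √(metricCoeff (kernelInf σ₀) θ) = (√2 * σ₀)⁻¹ := by
  rw [metricCoeff_kernelInf hσ, Real.sqrt_sq (by positivity)]

/-- The metric is the constant `(√2 * σ₀)⁻¹ ^ 2`, so normalized covariant derivatives are ordinary
ones in the rescaled coordinate. Each derivative in the second variable contributes a sign. -/
lemma kernelDeriv_kernelInf (hσ : 0 < σ₀) (i j : ℕ) (θ θ' : ℝ) :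
    kernelDeriv (kernelInf σ₀) i j θ θ' = (-1) ^ j * hg (i + j) ((√2 * σ₀)⁻¹ * (θ - θ')) := by
  have hc : 0 < (√2 * σ₀)⁻¹ := by positivity
  rw [kernelDeriv_eq fun x => by rw [metricCoeff_kernelInf hσ]; positivity]
  have h1 : ∀ j x, normDeriv (metricCoeff (kernelInf σ₀)) j (kernelInf σ₀ x) =
      fun y => (-1) ^ j * hg j ((√2 * σ₀)⁻¹ * (x - y)) := by
    intro j x
    induction j with
    | zero => funext y; simp [normDeriv, kernelInf_eq hσ]
    | succ j ih =>
      funext y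
      simp only [normDeriv, ih, sqrt_metricCoeff_kernelInf hσ,
        ((hg_comp_right _ _ _ _).const_mul _).deriv]
      field_simp
      ring
  simp only [h1]
  clear h1
  induction i generalizing θ with
  | zero => simp [normDeriv]
  | succ i ih =>
    simp only [normDeriv, funext ih, sqrt_metricCoeff_kernelInf hσ,
      ((hg_comp_left _ _ _ _).const_mul _).deriv]
    rw [show i + 1 + j = i + j + 1 by ring]
    field_simp

lemma rdist_kernelInf (hσ : 0 < σ₀) (θ θ' : ℝ) :
    rdist (kernelInf σ₀) θ θ' = (√2 * σ₀)⁻¹ * |θ - θ'| := by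
  simp only [rdist, sqrt_metricCoeff_kernelInf hσ, intervalIntegral.integral_const, smul_eq_mul,
    abs_mul, abs_of_pos (show 0 < (√2 * σ₀)⁻¹ by positivity)]
  ring

/-! ### Convergence of the normalized covariant derivatives -/

lemma metricCoeff_lamSeq_pos (hσ : 0 < σ₀) (hbpos : ∀ T, 2 ≤ T → 0 < b T) (i : Option ℕ)
    (θ : ℝ) : 0 < metricCoeff (kernel (lamSeq b i) σ₀) θ := by
  cases i with
  | none => exact (metricCoeff_kernelInf hσ θ).symm ▸ (by positivity)
  | some n => exact metricCoeff_kernelGrid_pos (hbpos _ (by omega)) (by omega) hσ θ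

lemma deriv_left_eq_dirDeriv {F : Option ℕ → ℝ × ℝ → ℝ} {i : Option ℕ}
    (hF : Differentiable ℝ (F i)) (x y : ℝ) :
    deriv (fun t => F i (t, y)) x = dirDeriv (1, 0) F i (x, y) := by
  have h := (hF (x, y)).hasFDerivAt.comp_hasDerivAt x
    ((hasDerivAt_id' x).prodMk (hasDerivAt_const x y))
  exact h.deriv

lemma deriv_right_eq_dirDeriv {F : Option ℕ → ℝ × ℝ → ℝ} {i : Option ℕ}
    (hF : Differentiable ℝ (F i)) (x y : ℝ) :
    deriv (fun t => F i (x, t)) y = dirDeriv (0, 1) F i (x, y) := by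
  have h := (hF (x, y)).hasFDerivAt.comp_hasDerivAt y
    ((hasDerivAt_const y x).prodMk (hasDerivAt_id' y))
  exact h.deriv

/-- Hypotheses of the limit regime. -/
structure GridLimit (b : ℕ → ℝ) (ε σ₀ : ℝ) : Prop where
  scale_pos : 0 < σ₀
  margin_pos : 0 < ε
  pos : ∀ T, 2 ≤ T → 0 < b T
  tendsto_atTop : Tendsto b atTop atTop
  step : Tendsto (fun T => gridStep (b T) T) atTop (𝓝 0)

lemma GridLimit.smoothConv (h : GridLimit b ε σ₀) (n : ℕ) :
    SmoothConv (squareSeq b ε) n (kernelSeq b σ₀) :=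
  kernelSeq_smoothConv h.scale_pos h.margin_pos h.pos h.tendsto_atTop h.step n

lemma GridLimit.mixed (h : GridLimit b ε σ₀) (i j n : ℕ) :
    SmoothConv (squareSeq b ε) n
      ((dirDeriv (1, 0))^[i] ((dirDeriv (0, 1))^[j] (kernelSeq b σ₀))) := by
  have h1 : ∀ n, SmoothConv (squareSeq b ε) n ((dirDeriv (0, 1))^[j]
      (kernelSeq b σ₀)) := by
    induction j with
    | zero => exact h.smoothConv
    | succ j ih =>
      intro n
      rw [Function.iterate_succ_apply']
      exact (ih (n + 1)).2.2 _
  induction i generalizing n with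
  | zero => exact h1 n
  | succ i ih =>
    rw [Function.iterate_succ_apply']
    exact (ih (n + 1)).2.2 _

lemma GridLimit.metricCoeff_eq (h : GridLimit b ε σ₀) (i : Option ℕ) (θ : ℝ) :
    metricCoeff (kernel (lamSeq b i) σ₀) θ =
      dirDeriv (1, 0) (dirDeriv (0, 1) (kernelSeq b σ₀)) i (θ, θ) := by
  have h1 : ∀ x, deriv (fun y => kernelSeq b σ₀ i (x, y)) θ =
      dirDeriv (0, 1) (kernelSeq b σ₀) i (x, θ) := fun x =>
    deriv_right_eq_dirDeriv ((h.smoothConv 1).2.1 i) x θ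
  have h2 := deriv_left_eq_dirDeriv (F := dirDeriv (0, 1) (kernelSeq b σ₀))
    ((h.mixed 0 1 1).2.1 i) θ θ
  rw [← h2]
  exact congrArg (fun f => deriv f θ) (funext h1)

lemma GridLimit.metric_fst (h : GridLimit b ε σ₀) (n : ℕ) :
    SmoothConv (squareSeq b ε) n
      (fun i p => metricCoeff (kernel (lamSeq b i) σ₀) p.1) := by
  simp only [h.metricCoeff_eq]
  exact (h.mixed 1 1 n).comp ((ContinuousLinearMap.fst ℝ ℝ ℝ).prod
    (ContinuousLinearMap.fst ℝ ℝ ℝ)) fun n p hp _ => ⟨hp, hp⟩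

lemma GridLimit.metric_snd (h : GridLimit b ε σ₀) (n : ℕ) :
    SmoothConv (squareSeq b ε) n
      (fun i p => metricCoeff (kernel (lamSeq b i) σ₀) p.2) := by
  simp only [h.metricCoeff_eq]
  exact (h.mixed 1 1 n).comp ((ContinuousLinearMap.snd ℝ ℝ ℝ).prod
    (ContinuousLinearMap.snd ℝ ℝ ℝ)) fun n p _ hp => ⟨hp, hp⟩

/-- One normalized derivative is a directional derivative times the inverse square root of the
metric, and both stay in the convergent class. The order `n` is universally quantified in the
induction because each step consumes one derivative. -/
lemma GridLimit.kernelDeriv_smoothConv (h : GridLimit b ε σ₀) (i j n : ℕ) :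
    SmoothConv (squareSeq b ε) n
      (fun k p => kernelDeriv (kernel (lamSeq b k) σ₀) i j p.1 p.2) := by
  have hpos := metricCoeff_lamSeq_pos h.scale_pos h.pos
  have hlim : ∀ x, (√2 * σ₀)⁻¹ ^ 2 ≤ metricCoeff (kernel (lamSeq b none) σ₀) x := fun x =>
    (metricCoeff_kernelInf h.scale_pos x).ge
  have hc : 0 < (√2 * σ₀)⁻¹ ^ 2 := by have := h.scale_pos; positivity
  simp only [kernelDeriv_eq (hpos _)]
  have h1 : ∀ n, SmoothConv (squareSeq b ε) n (fun k p =>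
      normDeriv (metricCoeff (kernel (lamSeq b k) σ₀)) j (kernel (lamSeq b k) σ₀ p.1) p.2) := by
    induction j with
    | zero => exact h.smoothConv
    | succ j ih =>
      intro n
      have := ((ih (n + 1)).2.2 (0, 1)).mul
        ((h.metric_snd n).inv_sqrt (fun i p => hpos i _) hc fun p => hlim _)
      convert this using 1
      funext k p
      rw [← div_eq_mul_inv, ← deriv_right_eq_dirDeriv ((ih 1).2.1 k) p.1 p.2]
      rfl
  induction i generalizing n with
  | zero => exact h1 n
  | succ i ih =>
    have := ((ih (n + 1)).2.2 (1, 0)).mul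
      ((h.metric_fst n).inv_sqrt (fun i p => hpos i _) hc fun p => hlim _)
    convert this using 1
    funext k p
    rw [← div_eq_mul_inv, ← deriv_left_eq_dirDeriv ((ih 1).2.1 k) p.1 p.2]
    rfl

end SpikeDeconv

namespace SpikeDeconv

open scoped RealInnerProductSpace

/-! ### The limit regime -/

variable {b : ℕ → ℝ} {ε σ₀ : ℝ}

lemma eventually_of_add_two {p : ℕ → Prop} (h : ∀ᶠ n in atTop, p (n + 2)) :
    ∀ᶠ T in atTop, p T := by
  rw [← map_add_atTop_eq_nat 2]
  exact h

lemma GridLimit.kernelDeriv_sub_le (h : GridLimit b ε σ₀) (m : ℕ) {η : ℝ} (hη : 0 < η) :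
    ∀ᶠ T in atTop, ∀ i < m, ∀ j < m, ∀ θ ∈ paramSet (b T) ε, ∀ θ' ∈ paramSet (b T) ε,
      |kernelDeriv (kernelGrid (b T) T σ₀) i j θ θ' - kernelDeriv (kernelInf σ₀) i j θ θ'| ≤ η := by
  apply eventually_of_add_two
  have h1 : ∀ᶠ n in atTop, ∀ i ∈ Set.Iio m, ∀ j ∈ Set.Iio m, ∀ p : ℝ × ℝ,
      p.1 ∈ squareSeq b ε n → p.2 ∈ squareSeq b ε n →
      |kernelDeriv (kernelGrid (b (n + 2)) (n + 2) σ₀) i j p.1 p.2 -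
        kernelDeriv (kernelInf σ₀) i j p.1 p.2| ≤ η := by
    simp only [Filter.eventually_all_finite (Set.finite_Iio m)]
    exact fun i _ j _ => (h.kernelDeriv_smoothConv i j 0).unifConv.conv η hη
  filter_upwards [h1] with n hn i hi j hj θ hθ θ' hθ'
  exact hn i hi j hj (θ, θ') hθ hθ'

lemma proximity_le {K K' : ℝ → ℝ → ℝ} {Θ : Set ℝ} {η : ℝ} (hη : 0 ≤ η)
    (h : ∀ i < 4, ∀ j < 4, ∀ θ ∈ Θ, ∀ θ' ∈ Θ,
      |kernelDeriv K i j θ θ' - kernelDeriv K' i j θ θ'| ≤ η) :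
    proximity K K' Θ ≤ η := by
  refine max_le (ciSup_le fun i => ciSup_le fun j => Real.sSup_le ?_ hη) (Real.sSup_le ?_ hη)
  · rintro x ⟨θ, hθ, θ', hθ', rfl⟩
    exact h i (by omega) j (by omega) θ hθ θ' hθ'
  · rintro x ⟨θ, hθ, rfl⟩
    exact h 3 (by omega) 3 (by omega) θ hθ θ hθ

/-- The metric is within half of its constant limit. The factor two obtained here yields both `ρ_T ≤
2` and the comparison of distances. -/
lemma GridLimit.sqrt_metric (h : GridLimit b ε σ₀) :
    ∀ᶠ T in atTop, ∀ θ ∈ paramSet (b T) ε,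
      (√2 * σ₀)⁻¹ ≤ 2 * √(metricCoeff (kernelGrid (b T) T σ₀) θ) ∧
      √(metricCoeff (kernelGrid (b T) T σ₀) θ) ≤ 2 * (√2 * σ₀)⁻¹ := by
  apply eventually_of_add_two
  have hσ := h.scale_pos
  set c := (√2 * σ₀)⁻¹ with hc
  have hc0 : 0 < c := by positivity
  filter_upwards [(h.metric_fst 0).unifConv.conv (c ^ 2 / 2) (by positivity)] with n hn θ hθ
  have h1 := hn (θ, θ) hθ hθ
  simp only [lamSeq] at h1
  rw [metricCoeff_kernelInf hσ, ← hc, abs_le] at h1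
  have h2 : 0 ≤ metricCoeff (kernelGrid (b (n + 2)) (n + 2) σ₀) θ := by nlinarith [sq_nonneg c]
  constructor
  · have : c / 2 ≤ √(metricCoeff (kernelGrid (b (n + 2)) (n + 2) σ₀) θ) :=
      (Real.le_sqrt' (by positivity)).2 (by nlinarith)
    linarith
  · exact Real.sqrt_le_iff.2 ⟨by positivity, by nlinarith⟩

lemma GridLimit.rhoConst_le (h : GridLimit b ε σ₀) :
    ∀ᶠ T in atTop, rhoConst (kernelGrid (b T) T σ₀) (kernelInf σ₀) (paramSet (b T) ε) ≤ 2 := by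
  have hσ := h.scale_pos
  have hc0 : 0 < (√2 * σ₀)⁻¹ := by positivity
  filter_upwards [h.sqrt_metric] with T hT
  refine max_le (Real.sSup_le ?_ zero_le_two) (Real.sSup_le ?_ zero_le_two)
  · rintro x ⟨θ, hθ, rfl⟩
    dsimp only
    rw [Real.sqrt_div' _ (by rw [metricCoeff_kernelInf hσ]; positivity),
      sqrt_metricCoeff_kernelInf hσ, div_le_iff₀ hc0]
    exact (hT θ hθ).2
  · rintro x ⟨θ, hθ, rfl⟩
    dsimp only
    rw [Real.sqrt_div (by rw [metricCoeff_kernelInf hσ]; positivity),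
      sqrt_metricCoeff_kernelInf hσ, div_le_iff₀ (by linarith [(hT θ hθ).1])]
    exact (hT θ hθ).1

lemma GridLimit.continuous_metric (h : GridLimit b ε σ₀) {T : ℕ} (hT : 2 ≤ T) :
    Continuous (metricCoeff (kernelGrid (b T) T σ₀)) := by
  obtain ⟨n, rfl⟩ := Nat.exists_eq_add_of_le' hT
  exact ((h.metric_fst 1).2.1 (some n)).continuous.comp (continuous_id.prodMk continuous_id)

lemma GridLimit.rdist_bounds (h : GridLimit b ε σ₀) :
    ∀ᶠ T in atTop, ∀ θ ∈ paramSet (b T) ε, ∀ θ' ∈ paramSet (b T) ε,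
      (√2 * σ₀)⁻¹ * |θ - θ'| ≤ 2 * rdist (kernelGrid (b T) T σ₀) θ θ' ∧
      rdist (kernelGrid (b T) T σ₀) θ θ' ≤ 2 * ((√2 * σ₀)⁻¹ * |θ - θ'|) := by
  filter_upwards [h.sqrt_metric, eventually_ge_atTop 2] with T hT hT2 θ hθ θ' hθ'
  have hσ := h.scale_pos
  set c := (√2 * σ₀)⁻¹ with hc
  have hc0 : 0 < c := by positivity
  set f := fun t => √(metricCoeff (kernelGrid (b T) T σ₀) t) with hf
  have hfc : Continuous f := (h.continuous_metric hT2).sqrt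
  have hsub : Set.uIcc θ' θ ⊆ paramSet (b T) ε :=
    (Set.ordConnected_Icc).uIcc_subset hθ' hθ
  constructor
  · have key : ∀ x y, x ≤ y → Set.Icc x y ⊆ paramSet (b T) ε →
        c * (y - x) ≤ 2 * |∫ t in x..y, f t| := by
      intro x y hxy hs
      have h1 : ∫ t in x..y, c / 2 ≤ ∫ t in x..y, f t :=
        intervalIntegral.integral_mono_on hxy (by simp) (hfc.intervalIntegrable _ _)
          fun t ht => by linarith [(hT t (hs ht)).1]
      rw [intervalIntegral.integral_const, smul_eq_mul] at h1
      linarith [le_abs_self (∫ t in x..y, f t)]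
    rcases le_total θ' θ with hle | hle
    · rw [Set.uIcc_of_le hle] at hsub
      rw [abs_of_nonneg (sub_nonneg.2 hle)]
      exact key _ _ hle hsub
    · rw [Set.uIcc_of_ge hle] at hsub
      rw [abs_sub_comm, abs_of_nonneg (sub_nonneg.2 hle), rdist, intervalIntegral.integral_symm,
        abs_neg]
      exact key _ _ hle hsub
  · have h1 := intervalIntegral.norm_integral_le_of_norm_le_const (a := θ') (b := θ) (f := f)
      (C := 2 * c) fun t ht => by
        rw [Real.norm_eq_abs, abs_of_nonneg (Real.sqrt_nonneg _)]
        exact (hT t (hsub (Set.uIoc_subset_uIcc ht))).2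
    rw [Real.norm_eq_abs] at h1
    calc _ ≤ 2 * c * |θ - θ'| := h1
      _ = _ := by ring

/-- The derivatives of the curve of the features, in the coordinate for which the limit metric is
the Euclidean one. -/
noncomputable def featCurve (b : ℝ) (T : ℕ) (σ₀ : ℝ) (i : ℕ) (x : ℝ) : EuclideanSpace ℝ (Fin T) :=
  (√2 * σ₀) ^ i • iteratedDeriv i (featVec b T σ₀) (√2 * σ₀ * x)

lemma featCurve_hasDerivAt {b : ℝ} {T : ℕ} (hb : 0 < b) (hT : 0 < T) (hσ : 0 < σ₀) (i : ℕ)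
    (x : ℝ) : HasDerivAt (featCurve b T σ₀ i) (featCurve b T σ₀ (i + 1) x) x := by
  have h1 := ((contDiff_featVec hb hT hσ (n := (i + 1 : ℕ))).differentiable_iteratedDeriv i
    (by exact_mod_cast i.lt_succ_self) (√2 * σ₀ * x)).hasDerivAt
  rw [← iteratedDeriv_succ] at h1
  have h2 : HasDerivAt (fun x => √2 * σ₀ * x) (√2 * σ₀) x := by
    simpa using (hasDerivAt_id' x).const_mul (√2 * σ₀)
  refine ((h1.scomp x h2).const_smul ((√2 * σ₀) ^ i)).congr_deriv ?_
  rw [smul_smul, ← pow_succ, featCurve]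

/-! ### Derivatives of the kernels as scalar products of derivatives of curves. -/

lemma dirDeriv_inner_left {E : Type*} [NormedAddCommGroup E] [InnerProductSpace ℝ E]
    {u v u' : ℝ → E} (hu : ∀ x, HasDerivAt u (u' x) x) (hv : Differentiable ℝ v) (p : ℝ × ℝ) :
    fderiv ℝ (fun p : ℝ × ℝ => ⟪u p.1, v p.2⟫) p (1, 0) = ⟪u' p.1, v p.2⟫ := by
  have hd : Differentiable ℝ (fun p : ℝ × ℝ => ⟪u p.1, v p.2⟫) := by
    have hu' : Differentiable ℝ u := fun x => (hu x).differentiableAt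
    exact (hu'.comp differentiable_fst).inner ℝ (hv.comp differentiable_snd)
  have h := deriv_left_eq_dirDeriv (F := fun _ p => ⟪u p.1, v p.2⟫) (i := none) hd p.1 p.2
  simp only [dirDeriv] at h
  rw [← h]
  simpa using ((hu p.1).inner ℝ (hasDerivAt_const p.1 (v p.2))).deriv

lemma dirDeriv_inner_right {E : Type*} [NormedAddCommGroup E] [InnerProductSpace ℝ E]
    {u v v' : ℝ → E} (hu : Differentiable ℝ u) (hv : ∀ x, HasDerivAt v (v' x) x) (p : ℝ × ℝ) :
    fderiv ℝ (fun p : ℝ × ℝ => ⟪u p.1, v p.2⟫) p (0, 1) = ⟪u p.1, v' p.2⟫ := by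
  have hd : Differentiable ℝ (fun p : ℝ × ℝ => ⟪u p.1, v p.2⟫) := by
    have hv' : Differentiable ℝ v := fun x => (hv x).differentiableAt
    exact (hu.comp differentiable_fst).inner ℝ (hv'.comp differentiable_snd)
  have h := deriv_right_eq_dirDeriv (F := fun _ p => ⟪u p.1, v p.2⟫) (i := none) hd p.1 p.2
  simp only [dirDeriv] at h
  rw [← h]
  simpa using ((hasDerivAt_const p.2 (u p.1)).inner ℝ (hv p.2)).deriv

lemma mixed_some_eq (hbpos : ∀ T, 2 ≤ T → 0 < b T) (hσ : 0 < σ₀) (i j n : ℕ) :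
    (dirDeriv (1, 0))^[i] ((dirDeriv (0, 1))^[j] (kernelSeq b σ₀)) (some n) = fun p =>
      ⟪iteratedDeriv i (featVec (b (n + 2)) (n + 2) σ₀) p.1,
        iteratedDeriv j (featVec (b (n + 2)) (n + 2) σ₀) p.2⟫ := by
  have hb := hbpos (n + 2) (by omega)
  have hd : ∀ i, Differentiable ℝ (iteratedDeriv i (featVec (b (n + 2)) (n + 2) σ₀)) := fun i =>
    (contDiff_featVec hb (by omega) hσ (n := (i + 1 : ℕ))).differentiable_iteratedDeriv i
    (by exact_mod_cast i.lt_succ_self)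
  have hd' : ∀ i x, HasDerivAt (iteratedDeriv i (featVec (b (n + 2)) (n + 2) σ₀))
      (iteratedDeriv (i + 1) (featVec (b (n + 2)) (n + 2) σ₀) x) x := fun i x => by
    rw [iteratedDeriv_succ]; exact (hd i x).hasDerivAt
  have h1 : (dirDeriv (0, 1))^[j] (kernelSeq b σ₀) (some n) = fun p =>
      ⟪featVec (b (n + 2)) (n + 2) σ₀ p.1,
        iteratedDeriv j (featVec (b (n + 2)) (n + 2) σ₀) p.2⟫ := by
    induction j with
    | zero =>
      funext p
      simp only [Function.iterate_zero, id, iteratedDeriv_zero]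
      exact (inner_featVec (gridStep_pos hb (by omega)).le _ _ _).symm
    | succ j ih =>
      rw [Function.iterate_succ_apply']
      funext p
      rw [dirDeriv, ih, dirDeriv_inner_right (by simpa using hd 0) (hd' j)]
  induction i with
  | zero => simpa using h1
  | succ i ih =>
    rw [Function.iterate_succ_apply']
    funext p
    rw [dirDeriv, ih, dirDeriv_inner_left (hd' i) (hd j)]

lemma mixed_none_eq (hσ : 0 < σ₀) (i j : ℕ) :
    (dirDeriv (1, 0))^[i] ((dirDeriv (0, 1))^[j] (kernelSeq b σ₀)) none = fun p =>
      (√2 * σ₀)⁻¹ ^ i * (-(√2 * σ₀)⁻¹) ^ j * hg (i + j) ((√2 * σ₀)⁻¹ * (p.1 - p.2)) := by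
  set c := (√2 * σ₀)⁻¹ with hc
  have hd : ∀ (a : ℝ) (k : ℕ) (v p : ℝ × ℝ),
      fderiv ℝ (fun p : ℝ × ℝ => a * hg k (c * (p.1 - p.2))) p v =
        a * (hg (k + 1) (c * (p.1 - p.2)) * (c * (v.1 - v.2))) := by
    intro a k v p
    have h1 : HasFDerivAt (fun p : ℝ × ℝ => c * (p.1 - p.2))
        (c • (ContinuousLinearMap.fst ℝ ℝ ℝ - ContinuousLinearMap.snd ℝ ℝ ℝ)) p :=
      (hasFDerivAt_fst.sub hasFDerivAt_snd).const_mul c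
    have := (((hg_hasDerivAt k (c * (p.1 - p.2))).comp_hasFDerivAt p h1).const_mul a).fderiv
    simp only [Function.comp_def] at this
    rw [this]
    simp
  have h1 : (dirDeriv (0, 1))^[j] (kernelSeq b σ₀) none = fun p =>
      (-c) ^ j * hg j (c * (p.1 - p.2)) := by
    induction j with
    | zero =>
      funext p
      simp only [Function.iterate_zero, id, pow_zero, one_mul]
      exact kernelInf_eq hσ p.1 p.2
    | succ j ih =>
      rw [Function.iterate_succ_apply']
      funext p
      rw [dirDeriv, ih, hd]
      ring
  induction i with
  | zero => simpa using h1
  | succ i ih =>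
    rw [Function.iterate_succ_apply']
    funext p
    rw [dirDeriv, ih, hd, show i + 1 + j = i + j + 1 by ring]
    ring

/-- Ordinary derivatives in the rescaled coordinate replace the covariant ones of the grid metric,
so the certificates can be built in the flat geometry of the limit. -/
lemma GridLimit.inner_featCurve_sub_le (h : GridLimit b ε σ₀) (m : ℕ) {η : ℝ} (hη : 0 < η) :
    ∀ᶠ T in atTop, ∀ i < m, ∀ j < m, ∀ x y, √2 * σ₀ * x ∈ paramSet (b T) ε →
      √2 * σ₀ * y ∈ paramSet (b T) ε →
      |⟪featCurve (b T) T σ₀ i x, featCurve (b T) T σ₀ j y⟫ - (-1) ^ j * hg (i + j) (x - y)|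
        ≤ η := by
  apply eventually_of_add_two
  have hσ := h.scale_pos
  have hd0 : 0 < √2 * σ₀ := by positivity
  have h1 : ∀ᶠ n in atTop, ∀ i ∈ Set.Iio m, ∀ j ∈ Set.Iio m, ∀ p : ℝ × ℝ,
      p.1 ∈ squareSeq b ε n → p.2 ∈ squareSeq b ε n →
      |(dirDeriv (1, 0))^[i] ((dirDeriv (0, 1))^[j] (kernelSeq b σ₀)) (some n) p -
        (dirDeriv (1, 0))^[i] ((dirDeriv (0, 1))^[j] (kernelSeq b σ₀)) none p|
        -- The tolerance anticipates the factor `(√2 * σ₀) ^ (i + j)` produced by the change of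
        -- coordinate.
        ≤ η / (√2 * σ₀) ^ (i + j) := by
    simp only [Filter.eventually_all_finite (Set.finite_Iio m)]
    exact fun i _ j _ => (h.mixed i j 0).unifConv.conv _ (by positivity)
  filter_upwards [h1] with n hn i hi j hj x y hx hy
  have h2 := hn i hi j hj (√2 * σ₀ * x, √2 * σ₀ * y) hx hy
  rw [mixed_some_eq h.pos hσ, mixed_none_eq hσ, le_div_iff₀ (by positivity),
    ← abs_of_pos (show 0 < (√2 * σ₀) ^ (i + j) by positivity), ← abs_mul] at h2
  have e : ⟪featCurve (b (n + 2)) (n + 2) σ₀ i x, featCurve (b (n + 2)) (n + 2) σ₀ j y⟫ -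
      (-1) ^ j * hg (i + j) (x - y) =
      (⟪iteratedDeriv i (featVec (b (n + 2)) (n + 2) σ₀) (√2 * σ₀ * x),
        iteratedDeriv j (featVec (b (n + 2)) (n + 2) σ₀) (√2 * σ₀ * y)⟫ -
      (√2 * σ₀)⁻¹ ^ i * (-(√2 * σ₀)⁻¹) ^ j * hg (i + j)
        ((√2 * σ₀)⁻¹ * (√2 * σ₀ * x - √2 * σ₀ * y))) * (√2 * σ₀) ^ (i + j) := by
    simp only [featCurve, real_inner_smul_left, real_inner_smul_right]
    rw [← mul_sub, ← mul_assoc (√2 * σ₀)⁻¹, inv_mul_cancel₀ hd0.ne', one_mul, sub_mul,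
      neg_eq_neg_one_mul, mul_pow, pow_add]
    have h3 : (√2 * σ₀)⁻¹ ^ i * (√2 * σ₀) ^ i = 1 := by rw [← mul_pow, inv_mul_cancel₀ hd0.ne',
      one_pow]
    have h4 : (√2 * σ₀)⁻¹ ^ j * (√2 * σ₀) ^ j = 1 := by rw [← mul_pow, inv_mul_cancel₀ hd0.ne',
      one_pow]
    have h5 : ((√2 * σ₀)⁻¹ ^ i * (√2 * σ₀) ^ i) * ((√2 * σ₀)⁻¹ ^ j * (√2 * σ₀) ^ j) = 1 := by
      rw [h3, h4, one_mul]
    linear_combination ((-1) ^ j * hg (i + j) (x - y)) * h5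
  rw [e]
  exact h2

end SpikeDeconv

namespace SpikeDeconv

open scoped RealInnerProductSpace

/-! ### Constants of the limit kernel -/

variable {σ₀ : ℝ}

/-- Bounding `exp (x² / 2)` below by its quadratic Taylor polynomial turns estimates on the profile
into polynomial inequalities. -/
lemma mul_exp_neg_le {A C x : ℝ} (hC : 0 ≤ C) (h : A ≤ C * (1 + x ^ 2 / 2 + x ^ 4 / 8)) :
    A * Real.exp (-x ^ 2 / 2) ≤ C := by
  have h1 := Real.quadratic_le_exp_of_nonneg (x := x ^ 2 / 2) (by positivity)
  rw [neg_div, Real.exp_neg, ← div_eq_mul_inv, div_le_iff₀ (Real.exp_pos _)]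
  refine h.trans (mul_le_mul_of_nonneg_left ?_ hC)
  linarith [show (x ^ 2 / 2) ^ 2 / 2 = x ^ 4 / 8 by ring]

lemma abs_hg_one_le (x : ℝ) : |hg 1 x| ≤ 1 := by
  rw [hg_one, abs_le', ← neg_mul]
  constructor <;> apply mul_exp_neg_le zero_le_one <;>
    nlinarith [sq_nonneg (x - 1), sq_nonneg (x + 1), sq_nonneg (x ^ 2)]

lemma abs_hg_two_le (x : ℝ) : |hg 2 x| ≤ 1 := by
  rw [hg_two, abs_le', ← neg_mul]
  constructor <;> apply mul_exp_neg_le zero_le_one <;>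
    nlinarith [sq_nonneg (x ^ 2 - 2), sq_nonneg (x ^ 2), sq_nonneg x]

lemma abs_hg_three_le (x : ℝ) : |hg 3 x| ≤ 2 := by
  have h1 : 3 * x - x ^ 3 ≤ 2 * (1 + x ^ 2 / 2 + x ^ 4 / 8) := by
    nlinarith [sq_nonneg (x ^ 2 / 2 + x), sq_nonneg (x ^ 2 / 2 + x - 1), sq_nonneg (x - 1),
      sq_nonneg (x + 1), mul_nonneg (sq_nonneg (x - 1)) (sq_nonneg (x + 2)), sq_nonneg x]
  have h2 : -(3 * x - x ^ 3) ≤ 2 * (1 + x ^ 2 / 2 + x ^ 4 / 8) := by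
    nlinarith [sq_nonneg (x ^ 2 / 2 - x), sq_nonneg (x ^ 2 / 2 - x - 1), sq_nonneg (x - 1),
      sq_nonneg (x + 1), mul_nonneg (sq_nonneg (x + 1)) (sq_nonneg (x - 2)), sq_nonneg x]
  rw [hg_three, abs_le', ← neg_mul]
  exact ⟨mul_exp_neg_le zero_le_two h1, mul_exp_neg_le zero_le_two h2⟩

lemma hg_zero_pos (x : ℝ) : 0 < hg 0 x := by rw [hg_zero]; exact Real.exp_pos _

lemma hg_zero_le_one (x : ℝ) : hg 0 x ≤ 1 := by
  rw [hg_zero]; exact Real.exp_le_one_iff.2 (by nlinarith [sq_nonneg x])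

lemma one_sub_le_hg_zero (x : ℝ) : 1 - x ^ 2 / 2 ≤ hg 0 x := by
  rw [hg_zero]
  linarith [Real.add_one_le_exp (-x ^ 2 / 2)]

lemma abs_kernelDeriv_kernelInf (hσ : 0 < σ₀) (i j : ℕ) (θ θ' : ℝ) :
    |kernelDeriv (kernelInf σ₀) i j θ θ'| = |hg (i + j) ((√2 * σ₀)⁻¹ * (θ - θ'))| := by
  rw [kernelDeriv_kernelInf hσ, abs_mul, abs_pow, abs_neg, abs_one, one_pow, one_mul]

lemma inv_mul_scale_sub (hσ : 0 < σ₀) (x : ℝ) : (√2 * σ₀)⁻¹ * (√2 * σ₀ * x - 0) = x := by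
  have : 0 < √2 * σ₀ := by positivity
  field_simp
  ring

lemma abs_hg_le_supDeriv (hσ : 0 < σ₀) (i j : ℕ) (x : ℝ) :
    |hg (i + j) x| ≤ supDeriv (kernelInf σ₀) Set.univ i j := by
  obtain ⟨C, hC⟩ := exists_abs_hg_le_const (i + j)
  refine le_csSup ⟨C, ?_⟩ ⟨√2 * σ₀ * x, trivial, 0, trivial, ?_⟩
  · rintro _ ⟨θ, -, θ', -, rfl⟩
    rw [abs_kernelDeriv_kernelInf hσ]
    exact hC _
  · rw [abs_kernelDeriv_kernelInf hσ, inv_mul_scale_sub hσ]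

lemma supDeriv_le (hσ : 0 < σ₀) {i j : ℕ} {C : ℝ} (hC : ∀ x, |hg (i + j) x| ≤ C) :
    supDeriv (kernelInf σ₀) Set.univ i j ≤ C := by
  refine Real.sSup_le ?_ ((abs_nonneg _).trans (hC 0))
  rintro _ ⟨θ, -, θ', -, rfl⟩
  rw [abs_kernelDeriv_kernelInf hσ]
  exact hC _

lemma hg_zero_le_one_sub_epsFun (hσ : 0 < σ₀) {ρ x : ℝ} (hx : ρ ≤ |x|) :
    hg 0 x ≤ 1 - epsFun (kernelInf σ₀) Set.univ ρ := by
  have hd : 0 < √2 * σ₀ := by positivity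
  rw [epsFun, sub_sub_cancel]
  refine le_csSup ⟨1, ?_⟩ ⟨√2 * σ₀ * x, trivial, 0, trivial, ?_, ?_⟩
  · rintro _ ⟨θ, -, θ', -, -, rfl⟩
    rw [kernelInf_eq hσ, abs_of_pos (hg_zero_pos _)]
    exact hg_zero_le_one _
  · rw [rdist_kernelInf hσ, zero_sub, abs_neg, abs_mul, abs_of_pos hd, ← mul_assoc,
      inv_mul_cancel₀ hd.ne', one_mul]
    exact hx
  · rw [kernelInf_eq hσ, inv_mul_scale_sub hσ, abs_of_pos (hg_zero_pos _)]

lemma le_epsFun (hσ : 0 < σ₀) {ρ e : ℝ} (h : ∀ x, ρ ≤ |x| → hg 0 x ≤ 1 - e) (he : e ≤ 1) :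
    e ≤ epsFun (kernelInf σ₀) Set.univ ρ := by
  rw [epsFun, le_sub_comm]
  refine Real.sSup_le ?_ (sub_nonneg.2 he)
  rintro _ ⟨θ, -, θ', -, h1, rfl⟩
  rw [kernelInf_eq hσ, abs_of_pos (hg_zero_pos _)]
  refine h _ ?_
  rwa [rdist_kernelInf hσ, abs_sub_comm, ← abs_of_pos (show 0 < (√2 * σ₀)⁻¹ by positivity),
    ← abs_mul] at h1

lemma hg_two_le_neg_nuFun (hσ : 0 < σ₀) {ρ x : ℝ} (hx : |x| ≤ ρ) :
    hg 2 x ≤ -nuFun (kernelInf σ₀) Set.univ ρ := by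
  have hd : 0 < √2 * σ₀ := by positivity
  rw [nuFun, neg_neg]
  refine le_csSup ⟨1, ?_⟩ ⟨√2 * σ₀ * x, trivial, 0, trivial, ?_, ?_⟩
  · rintro _ ⟨θ, -, θ', -, -, rfl⟩
    have h1 := abs_kernelDeriv_kernelInf hσ 0 2 θ θ'
    exact (le_abs_self _).trans (h1.le.trans (abs_hg_two_le _))
  · rw [rdist_kernelInf hσ, zero_sub, abs_neg, abs_mul, abs_of_pos hd, ← mul_assoc,
      inv_mul_cancel₀ hd.ne', one_mul]
    exact hx
  · rw [kernelDeriv_kernelInf hσ, inv_mul_scale_sub hσ]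
    simp

lemma le_nuFun (hσ : 0 < σ₀) {ρ e : ℝ} (hρ : 0 ≤ ρ) (h : ∀ x, |x| ≤ ρ → hg 2 x ≤ -e) :
    e ≤ nuFun (kernelInf σ₀) Set.univ ρ := by
  rw [nuFun, le_neg]
  refine csSup_le ⟨_, 0, trivial, 0, trivial, ?_, rfl⟩ ?_
  · simpa [rdist_kernelInf hσ] using hρ
  · rintro _ ⟨θ, -, θ', -, h1, rfl⟩
    rw [kernelDeriv_kernelInf hσ, neg_one_sq, one_mul, zero_add]
    refine h _ ?_
    rwa [rdist_kernelInf hσ, abs_sub_comm, ← abs_of_pos (show 0 < (√2 * σ₀)⁻¹ by positivity),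
      ← abs_mul] at h1

/-- Quantitative properties of the limit kernel at the radius `r`, in terms of the Gaussian
profile. -/
structure ProfileBounds (r H e ν L₁ L₂ L₃ : ℝ) : Prop where
  r_nonneg : 0 ≤ r
  r_le : r ≤ 1 / 2
  H_ge : 1 / 1000 ≤ H
  eps : H * (10 * (5 + 2 * L₁)) ≤ 8 * e
  nu : H * (9 * (2 * L₂ + 2 * L₃ + 4)) ≤ 8 * ν
  far : ∀ x, r / 2 ≤ |x| → hg 0 x ≤ 1 - e
  near : ∀ x, |x| ≤ 2 * r → hg 2 x ≤ -ν
  one_le : ∀ x, |hg 1 x| ≤ L₁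
  two_le : ∀ x, |hg 2 x| ≤ L₂
  three_le : ∀ x, |hg 3 x| ≤ L₃
  L₁_le : L₁ ≤ 1

/-- The maximizer `r` is not computed. Evaluating `H₂` at one explicit radius bounds the maximum
below by a universal constant, and the two nontrivial terms of the minimum defining `H₂` give `eps`
and `nu`. -/
lemma profileBounds (hσ : 0 < σ₀) {r : ℝ} (hr : r ∈ Set.Icc (0 : ℝ) (1 / 2))
    (hmax : IsMaxOn (fun r' => H₂ (kernelInf σ₀) Set.univ r' 2) (Set.Icc (0 : ℝ) (1 / 2)) r) :
    ProfileBounds r (H₂ (kernelInf σ₀) Set.univ r 2) (epsFun (kernelInf σ₀) Set.univ (r / 2))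
      (nuFun (kernelInf σ₀) Set.univ (2 * r)) (supDeriv (kernelInf σ₀) Set.univ 1 0)
      (supDeriv (kernelInf σ₀) Set.univ 2 0) (supDeriv (kernelInf σ₀) Set.univ 2 1) := by
  set L₁ := supDeriv (kernelInf σ₀) Set.univ 1 0 with hL1
  set L₂ := supDeriv (kernelInf σ₀) Set.univ 2 0 with hL2
  set L₃ := supDeriv (kernelInf σ₀) Set.univ 2 1 with hL3
  have b1 : L₁ ≤ 1 := supDeriv_le hσ abs_hg_one_le
  have b2 : L₂ ≤ 1 := supDeriv_le hσ abs_hg_two_le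
  have b3 : L₃ ≤ 2 := supDeriv_le hσ abs_hg_three_le
  have c1 : ∀ x, |hg 1 x| ≤ L₁ := abs_hg_le_supDeriv hσ 1 0
  have c2 : ∀ x, |hg 2 x| ≤ L₂ := abs_hg_le_supDeriv hσ 2 0
  have c3 : ∀ x, |hg 3 x| ≤ L₃ := abs_hg_le_supDeriv hσ 2 1
  have p1 : 0 ≤ L₁ := (abs_nonneg _).trans (c1 0)
  have p2 : 0 ≤ L₂ := (abs_nonneg _).trans (c2 0)
  have p3 : 0 ≤ L₃ := (abs_nonneg _).trans (c3 0)
  -- The test radius is `2/5`. For `|x| ≥ 1/5` one has `exp (x² / 2) ≥ 51/50`, whence `1 - 50/51`.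
  have he : 1 / 51 ≤ epsFun (kernelInf σ₀) Set.univ (2 / 5 / 2) := by
    refine le_epsFun hσ (fun x hx => ?_) (by norm_num)
    have hx2 : 1 / 25 ≤ x ^ 2 := by rw [← sq_abs]; nlinarith
    rw [hg_zero, ← one_mul (Real.exp _)]
    refine mul_exp_neg_le (by norm_num) ?_
    nlinarith [sq_nonneg (x ^ 2)]
  have hn : 1 / 5 ≤ nuFun (kernelInf σ₀) Set.univ (2 * (2 / 5)) := by
    refine le_nuFun hσ (by norm_num) fun x hx => ?_
    have hx2 : x ^ 2 ≤ 16 / 25 := by rw [← sq_abs]; nlinarith [abs_nonneg x]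
    have := one_sub_le_hg_zero x
    rw [hg_zero] at this
    rw [hg_two]
    nlinarith [sq_nonneg x]
  have hge : 1 / 1000 ≤ H₂ (kernelInf σ₀) Set.univ (2 / 5) 2 := by
    rw [H₂, ← hL1, ← hL2, ← hL3]
    refine le_min (le_min (by norm_num) ?_) ?_
    · rw [le_div_iff₀ (by linarith)]; linarith
    · rw [le_div_iff₀ (by linarith)]; linarith
  refine ⟨hr.1, hr.2, hge.trans (hmax (show (2 / 5 : ℝ) ∈ _ by constructor <;> norm_num)), ?_, ?_,
    fun x hx => hg_zero_le_one_sub_epsFun hσ hx, fun x hx => hg_two_le_neg_nuFun hσ hx,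
    c1, c2, c3, b1⟩
  · rw [← le_div_iff₀ (by linarith), H₂]
    exact (min_le_left _ _).trans (min_le_right _ _)
  · rw [← le_div_iff₀ (by linarith), H₂]
    exact min_le_right _ _

/-! ### Numerical consequences of the bounds on the profile. -/

namespace ProfileBounds

variable {r H e ν L₁ L₂ L₃ : ℝ}

lemma L₁_nonneg (h : ProfileBounds r H e ν L₁ L₂ L₃) : 0 ≤ L₁ := (abs_nonneg _).trans (h.one_le 0)
lemma L₂_nonneg (h : ProfileBounds r H e ν L₁ L₂ L₃) : 0 ≤ L₂ := (abs_nonneg _).trans (h.two_le 0)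
lemma L₃_nonneg (h : ProfileBounds r H e ν L₁ L₂ L₃) : 0 ≤ L₃ :=
  (abs_nonneg _).trans (h.three_le 0)

/-- The profile at `r / 2` is at least `1 - r² / 8`, and `r ≤ 1/2`. Through `eps` this makes `H` at
most `1/200`, the smallness used in inverting the interpolation system. -/
lemma e_le (h : ProfileBounds r H e ν L₁ L₂ L₃) : e ≤ 1 / 32 := by
  have h1 := h.far (r / 2) (le_abs_self _)
  have h2 := one_sub_le_hg_zero (r / 2)
  nlinarith [h.r_nonneg, h.r_le]

lemma e_ge (h : ProfileBounds r H e ν L₁ L₂ L₃) : 1 / 160 ≤ e := by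
  nlinarith [h.eps, h.H_ge, h.L₁_nonneg]

lemma H_le (h : ProfileBounds r H e ν L₁ L₂ L₃) : H ≤ 1 / 200 := by
  nlinarith [h.eps, h.e_le, h.H_ge, mul_nonneg (by linarith [h.H_ge] : 0 ≤ H) h.L₁_nonneg]

lemma nu_ge (h : ProfileBounds r H e ν L₁ L₂ L₃) : 9 / 2000 ≤ ν := by
  nlinarith [h.nu, h.H_ge, h.L₂_nonneg, h.L₃_nonneg]

lemma nu_le (h : ProfileBounds r H e ν L₁ L₂ L₃) : ν ≤ 1 := by
  have := h.near 0 (by simpa using h.r_nonneg)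
  rw [hg_two] at this
  norm_num at this
  linarith

/-- The second derivative of the profile is negative at `2 * r`, which must therefore precede its
zero at `1`. Near points are thus at distance less than one, where `Incoherent.nearest` applies. -/
lemma two_r_lt (h : ProfileBounds r H e ν L₁ L₂ L₃) : 2 * r < 1 := by
  have h1 := h.near (2 * r) (by rw [abs_of_nonneg (by linarith [h.r_nonneg])])
  rw [hg_two] at h1
  by_contra hcon
  have h2 := mul_nonneg (show 0 ≤ (2 * r) ^ 2 - 1 by nlinarith)
    (Real.exp_pos (-(2 * r) ^ 2 / 2)).le
  linarith [h.nu_ge]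

lemma H₁_pos (hσ : 0 < σ₀) (h : ProfileBounds r H (epsFun (kernelInf σ₀) Set.univ (r / 2))
      (nuFun (kernelInf σ₀) Set.univ (2 * r)) L₁ L₂ L₃) :
    0 < H₁ (kernelInf σ₀) Set.univ r 2 := by
  have h2 : 0 < supDeriv (kernelInf σ₀) Set.univ 2 0 := by
    refine lt_of_lt_of_le ?_ (abs_hg_le_supDeriv hσ 2 0 0)
    rw [hg_two]; norm_num
  have h3 : 0 < supDeriv (kernelInf σ₀) Set.univ 2 1 := by
    refine lt_of_lt_of_le ?_ (abs_hg_le_supDeriv hσ 2 1 1)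
    rw [hg_three]; norm_num; positivity
  have h4 := h.e_ge
  have h5 := h.nu_ge
  rw [H₁]
  refine lt_min (lt_min (lt_min (lt_min (by norm_num) h2) h3) ?_) ?_ <;> linarith

end ProfileBounds

/-! ### Separated parameters -/

/-- The points `x` are far apart, and the family obtained by moving one of them has a small
coherence. -/
structure Incoherent {ι : Type*} [Fintype ι] [DecidableEq ι] (x : ι → ℝ) (u : ℝ) : Prop where
  sep : ∀ k l, k ≠ l → 4 < |x k - x l|
  sum_le : ∀ z l, (∀ k, |z - x l| ≤ |z - x k|) → ∀ n ≤ 3,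
    ∑ k ∈ Finset.univ.erase l, |hg n (z - x k)| ≤ u

/-- For `δ < 1` the points `0, 1, …, s - 1` in rescaled units would be admissible, yet two
neighbours already have coherence at least `1/2`. -/
lemma one_le_of_mem_deltaFun (hσ : 0 < σ₀) {u : ℝ} (hu : u ≤ 1 / 4) {s : ℕ} (hs : 2 ≤ s) {δ : ℝ}
    (h : ∀ i ≤ 1, ∀ j ≤ 2, ∀ ϑ ∈ separated (kernelInf σ₀) Set.univ s δ, ∀ l : Fin s,
      ∑ k ∈ Finset.univ.erase l, |kernelDeriv (kernelInf σ₀) i j (ϑ l) (ϑ k)| ≤ u) : 1 ≤ δ := by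
  by_contra! hδ
  have hd : 0 < √2 * σ₀ := by positivity
  have hcc : ∀ y, (√2 * σ₀)⁻¹ * (√2 * σ₀ * y) = y := fun y => by
    rw [← mul_assoc, inv_mul_cancel₀ hd.ne', one_mul]
  have h1 := h 0 (by norm_num) 0 (by norm_num) (fun k : Fin s => √2 * σ₀ * (k : ℝ))
    ⟨fun _ => trivial, fun k l hkl => ?_⟩ ⟨0, by omega⟩
  · have h2 := Finset.single_le_sum (f := fun k : Fin s => |kernelDeriv (kernelInf σ₀) 0 0
        (√2 * σ₀ * ((⟨0, by omega⟩ : Fin s) : ℝ)) (√2 * σ₀ * (k : ℝ))|)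
      (s := Finset.univ.erase ⟨0, by omega⟩) (fun k _ => abs_nonneg _)
      (a := ⟨1, by omega⟩) (by simp)
    have h3 := h2.trans h1
    rw [abs_kernelDeriv_kernelInf hσ, ← mul_sub, hcc, abs_of_pos (hg_zero_pos _)] at h3
    have h4 := one_sub_le_hg_zero (((0 : ℕ) : ℝ) - ((1 : ℕ) : ℝ))
    norm_num at h3 h4
    linarith
  · rw [rdist_kernelInf hσ, ← mul_sub, abs_mul, abs_of_pos hd, hcc]
    have : (1 : ℤ) ≤ |((l : ℕ) : ℤ) - ((k : ℕ) : ℤ)| := by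
      apply Int.one_le_abs
      rw [sub_ne_zero]
      exact fun he => hkl (Fin.ext (by exact_mod_cast he.symm))
    have h2 : (1 : ℝ) ≤ |((l : ℕ) : ℝ) - ((k : ℕ) : ℝ)| := by exact_mod_cast this
    exact hδ.trans_le h2

lemma incoherent_of_separated (hσ : 0 < σ₀) {u : ℝ} (hu0 : 0 ≤ u) (hu : u ≤ 1 / 4) {ι : Type*}
    [Fintype ι] [DecidableEq ι] {s : ℕ} (hcard : Fintype.card ι = s) (θ : ι → ℝ)
    (hsep : ∀ k l, k ≠ l →
      ENNReal.ofReal (√2 * σ₀) * max 1 (4 * deltaFun (kernelInf σ₀) Set.univ u s)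
        < ENNReal.ofReal |θ k - θ l|) :
    Incoherent (fun k => (√2 * σ₀)⁻¹ * θ k) u := by
  have hd : 0 < √2 * σ₀ := by positivity
  set c := (√2 * σ₀)⁻¹ with hc
  have hc0 : 0 < c := by positivity
  rcases subsingleton_or_nontrivial ι with hι | hι
  · refine ⟨fun k l hkl => absurd (Subsingleton.elim k l) hkl, fun z l _ n _ => ?_⟩
    rw [show Finset.univ.erase l = ∅ from
      Finset.eq_empty_of_forall_notMem fun k hk => (Finset.mem_erase.1 hk).1
        (Subsingleton.elim k l), Finset.sum_empty]
    exact hu0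
  have hs : 2 ≤ s := hcard ▸ Fintype.one_lt_card
  -- The smallest rescaled gap `m` is attained. The separation hypothesis applied to that pair gives
  -- an admissible `δ` with `4 * δ < m`, and `δ ≥ 1` then gives gaps larger than `4`.
  set D : Finset (ι × ι) := Finset.univ.filter fun p => p.1 ≠ p.2 with hD
  obtain ⟨k₀, l₀, h0⟩ := exists_pair_ne ι
  obtain ⟨p, hp, hmin⟩ := D.exists_min_image (fun p => c * |θ p.1 - θ p.2|)
    ⟨(k₀, l₀), by simpa [hD] using h0⟩
  set m := c * |θ p.1 - θ p.2| with hm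
  have hm' : ∀ k l, k ≠ l → m ≤ c * |θ k - θ l| := fun k l hkl =>
    hmin (k, l) (by simpa [hD] using hkl)
  have h1 := hsep p.1 p.2 (by simpa [hD] using hp)
  have h2 : |θ p.1 - θ p.2| = √2 * σ₀ * m := by
    rw [hm, hc, ← mul_assoc, mul_inv_cancel₀ hd.ne', one_mul]
  rw [h2, ENNReal.ofReal_mul hd.le, ENNReal.mul_lt_mul_iff_right (by simpa using hd)
    ENNReal.ofReal_ne_top] at h1
  have hm0 : 0 ≤ m := by positivity
  have h3 : deltaFun (kernelInf σ₀) Set.univ u s < ENNReal.ofReal (m / 4) := by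
    have h4 := (le_max_right _ _).trans_lt h1
    rw [show m = 4 * (m / 4) by ring, ENNReal.ofReal_mul (by norm_num)] at h4
    rwa [show ENNReal.ofReal 4 = 4 by norm_num, ENNReal.mul_lt_mul_iff_right (by norm_num)
      (by norm_num)] at h4
  simp only [deltaFun, iInf_lt_iff] at h3
  obtain ⟨δ, ⟨hδ0, hδ⟩, h4⟩ := h3
  rw [ENNReal.ofReal_lt_ofReal_iff_of_nonneg hδ0.le] at h4
  have hδ1 := one_le_of_mem_deltaFun hσ hu hs hδ
  have habs : ∀ k l, |c * θ k - c * θ l| = c * |θ k - θ l| := fun k l => by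
    rw [← mul_sub, abs_mul, abs_of_pos hc0]
  refine ⟨fun k l hkl => ?_, fun z l hz n hn => ?_⟩
  · rw [habs]
    linarith [hm' k l hkl]
  set e := (Fintype.equivFinOfCardEq hcard) with he
  -- Replace the nearest point `x l` by `z`. The other points are at least `m / 2 > 2 * δ` from `z`,
  -- so the new family is still `δ`-separated and the definition of `deltaFun` bounds its coherence.
  set y : ι → ℝ := Function.update θ l (√2 * σ₀ * z) with hy
  have hyl : c * y l = z := by
    rw [hy, Function.update_self, hc, ← mul_assoc, inv_mul_cancel₀ hd.ne', one_mul]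
  have hyk : ∀ k, k ≠ l → y k = θ k := fun k hk => Function.update_of_ne hk _ _
  have hzk : ∀ k, k ≠ l → δ < |z - c * θ k| := fun k hk => by
    have h5 := hz k
    have h6 := hm' k l hk
    rw [← habs] at h6
    have h7 := abs_sub_le (c * θ k) z (c * θ l)
    rw [abs_sub_comm (c * θ k) z] at h7
    linarith
  have hsepy : (fun k => y (e.symm k)) ∈ separated (kernelInf σ₀) Set.univ s δ := by
    refine ⟨fun _ => trivial, fun k k' hkk => ?_⟩
    have hne : e.symm k ≠ e.symm k' := fun h => hkk (e.symm.injective h)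
    rw [rdist_kernelInf hσ, ← hc]
    dsimp only
    by_cases h5 : e.symm k = l
    · rw [h5, hyk _ (fun h => hne (h5.trans h.symm)), ← abs_of_pos hc0, ← abs_mul,
        mul_sub, hyl, abs_sub_comm]
      exact hzk _ fun h => hne (h5.trans h.symm)
    · by_cases h6 : e.symm k' = l
      · rw [h6, hyk _ h5, ← abs_of_pos hc0, ← abs_mul, mul_sub, hyl]
        exact hzk _ h5
      · rw [hyk _ h5, hyk _ h6]
        linarith [hm' _ _ hne.symm]
  -- The kernel derivative of order `(i, j)` has modulus `|hg (i + j)|`, so the six admissible pairs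
  -- cover the orders `0` to `3`.
  have key : ∀ i ≤ 1, ∀ j ≤ 2, ∑ k ∈ Finset.univ.erase l, |hg (i + j) (z - c * θ k)| ≤ u := by
    intro i hi j hj
    have h5 := hδ i hi j hj _ hsepy (e l)
    have h6 : ∑ k ∈ Finset.univ.erase (e l), |kernelDeriv (kernelInf σ₀) i j
        (y (e.symm (e l))) (y (e.symm k))| =
        ∑ k ∈ Finset.univ.erase l, |hg (i + j) (z - c * θ k)| := by
      refine (Finset.sum_equiv e (fun k => ?_) fun k hk => ?_).symm
      · simp
      · rw [abs_kernelDeriv_kernelInf hσ, ← hc, mul_sub, e.symm_apply_apply,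
          e.symm_apply_apply, hyl, hyk _ (Finset.mem_erase.1 hk).1]
    rwa [h6] at h5
  interval_cases n
  · exact key 0 (by norm_num) 0 (by norm_num)
  · exact key 0 (by norm_num) 1 (by norm_num)
  · exact key 0 (by norm_num) 2 (by norm_num)
  · exact key 1 (by norm_num) 2 (by norm_num)

end SpikeDeconv

namespace SpikeDeconv

open scoped RealInnerProductSpace

/-! ### Interpolating certificates -/

/-- Solvability and stability of a linear system whose matrix is close to the identity. -/
lemma exists_solution_of_near_one {m : Type*} [Fintype m] [DecidableEq m] (A : m → m → ℝ)
    {q τ : ℝ} (hq0 : 0 ≤ q) (hq : q < 1) (hA : ∀ i, ∑ j, |A i j - if j = i then 1 else 0| ≤ q)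
    (t : m → ℝ) (hτ : 0 ≤ τ) (ht : ∀ i, |t i| ≤ τ) :
    ∃ c : m → ℝ, (∀ i, ∑ j, A i j * c j = t i) ∧ ∀ i, |c i - t i| ≤ q * τ / (1 - q) := by
  have key : ∀ c : m → ℝ, ∀ i, |c i - ∑ j, A i j * c j| ≤ q * ‖c‖ := by
    intro c i
    have h1 : c i - ∑ j, A i j * c j = -∑ j, (A i j - if j = i then 1 else 0) * c j := by
      simp [sub_mul, Finset.sum_sub_distrib]
    rw [h1, abs_neg]
    calc _ ≤ ∑ j, |A i j - if j = i then 1 else 0| * ‖c‖ := by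
          refine (Finset.abs_sum_le_sum_abs _ _).trans (Finset.sum_le_sum fun j _ => ?_)
          rw [abs_mul]
          exact mul_le_mul_of_nonneg_left (norm_le_pi_norm c j) (abs_nonneg _)
      _ ≤ q * ‖c‖ := by
          rw [← Finset.sum_mul]
          exact mul_le_mul_of_nonneg_right (hA i) (norm_nonneg _)
  let L : (m → ℝ) →ₗ[ℝ] (m → ℝ) := Matrix.toLin' (Matrix.of A)
  have hL : ∀ c i, L c i = ∑ j, A i j * c j := fun c i => by
    simp [L, Matrix.mulVec, dotProduct]
  -- A kernel vector satisfies `‖c‖ ≤ q * ‖c‖` with `q < 1`; in finite dimension injectivity gives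
  -- solvability.
  have hinj : Function.Injective L := by
    rw [injective_iff_map_eq_zero]
    intro c hc
    have h1 : ‖c‖ ≤ q * ‖c‖ := by
      refine (pi_norm_le_iff_of_nonneg (by positivity)).2 fun i => ?_
      have := key c i
      rw [← hL, hc] at this
      simpa using this
    have h2 : ‖c‖ ≤ 0 := by nlinarith [norm_nonneg c]
    exact norm_le_zero_iff.1 h2
  obtain ⟨c, hc⟩ := LinearMap.injective_iff_surjective.1 hinj t
  have hc' : ∀ i, ∑ j, A i j * c j = t i := fun i => by rw [← hL, hc]
  refine ⟨c, hc', fun i => ?_⟩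
  have h1 : ‖c‖ ≤ τ + q * ‖c‖ := by
    refine (pi_norm_le_iff_of_nonneg (by positivity)).2 fun i => ?_
    have h2 := key c i
    rw [hc'] at h2
    rw [Real.norm_eq_abs]
    have h3 := abs_add_le (c i - t i) (t i)
    rw [sub_add_cancel] at h3
    linarith [ht i]
  have h2 := key c i
  rw [hc'] at h2
  refine h2.trans ?_
  rw [mul_div_assoc]
  refine mul_le_mul_of_nonneg_left ?_ hq0
  rw [le_div_iff₀ (by linarith)]
  linarith

/-- One-sided Taylor bound of order two. -/
lemma taylor_upper {f f' f'' : ℝ → ℝ} (hf : ∀ x, HasDerivAt f (f' x) x)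
    (hf' : ∀ x, HasDerivAt f' (f'' x) x) {a z C : ℝ}
    (h : ∀ t ∈ Set.uIcc a z, f'' t ≤ C) : f z ≤ f a + f' a * (z - a) + C / 2 * (z - a) ^ 2 := by
  have hline : ∀ t, HasDerivAt (fun t => a + t * (z - a)) (z - a) t := fun t => by
    simpa using ((hasDerivAt_id' t).mul_const (z - a)).const_add a
  -- The Taylor defect along the segment. Its derivative vanishes at `0` and is nonincreasing, so
  -- the defect is nonincreasing as well; working on `[0, 1]` avoids separating `z ≥ a` from `z ≤
  -- a`.
  set k : ℝ → ℝ := fun t => f (a + t * (z - a)) - f' a * (z - a) * t - C / 2 * (z - a) ^ 2 * t ^ 2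
    with hk
  set k' : ℝ → ℝ := fun t => f' (a + t * (z - a)) * (z - a) - f' a * (z - a) -
    C * (z - a) ^ 2 * t with hk'
  have h1 : ∀ t, HasDerivAt k (k' t) t := fun t => by
    have := (((hf _).comp t (hline t)).sub ((hasDerivAt_id' t).const_mul (f' a * (z - a)))).sub
      ((hasDerivAt_pow 2 t).const_mul (C / 2 * (z - a) ^ 2))
    refine this.congr_deriv ?_
    simp only [hk']
    norm_num
    ring
  have h2 : ∀ t, HasDerivAt k' ((f'' (a + t * (z - a)) - C) * (z - a) ^ 2) t := fun t => by
    have := ((((hf' _).comp t (hline t)).mul_const (z - a)).sub_const (f' a * (z - a))).sub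
      ((hasDerivAt_id' t).const_mul (C * (z - a) ^ 2))
    refine this.congr_deriv ?_
    ring
  have hmem : ∀ t ∈ Set.Icc (0 : ℝ) 1, a + t * (z - a) ∈ Set.uIcc a z := by
    intro t ht
    rcases le_total a z with haz | haz
    · rw [Set.uIcc_of_le haz]
      constructor <;> nlinarith [ht.1, ht.2]
    · rw [Set.uIcc_of_ge haz]
      constructor <;> nlinarith [ht.1, ht.2]
  have h3 : AntitoneOn k' (Set.Icc 0 1) := by
    refine antitoneOn_of_deriv_nonpos (convex_Icc 0 1)
      (fun t _ => (h2 t).continuousAt.continuousWithinAt)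
      (fun t _ => (h2 t).differentiableAt.differentiableWithinAt) fun t ht => ?_
    rw [(h2 t).deriv]
    exact mul_nonpos_of_nonpos_of_nonneg
      (sub_nonpos.2 (h _ (hmem t (interior_subset ht)))) (sq_nonneg _)
  have h4 : AntitoneOn k (Set.Icc 0 1) := by
    refine antitoneOn_of_deriv_nonpos (convex_Icc 0 1)
      (fun t _ => (h1 t).continuousAt.continuousWithinAt)
      (fun t _ => (h1 t).differentiableAt.differentiableWithinAt) fun t ht => ?_
    rw [(h1 t).deriv]
    have h5 := h3 (Set.left_mem_Icc.2 zero_le_one) (interior_subset ht) (interior_subset ht).1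
    have h6 : k' 0 = 0 := by simp [hk']
    rwa [h6] at h5
  have h5 := h4 (Set.left_mem_Icc.2 zero_le_one) (Set.right_mem_Icc.2 zero_le_one) zero_le_one
  simp only [hk] at h5
  norm_num at h5
  linarith

lemma taylor_abs {f f' f'' : ℝ → ℝ} (hf : ∀ x, HasDerivAt f (f' x) x)
    (hf' : ∀ x, HasDerivAt f' (f'' x) x) {a z C : ℝ}
    (h : ∀ t ∈ Set.uIcc a z, |f'' t| ≤ C) :
    |f z - f a - f' a * (z - a)| ≤ C / 2 * (z - a) ^ 2 := by
  have h1 := taylor_upper hf hf' (fun t ht => (abs_le.1 (h t ht)).2)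
  have h2 := taylor_upper (fun x => (hf x).neg) (fun x => (hf' x).neg) (a := a) (z := z) (C := C)
    (fun t ht => by linarith [(abs_le.1 (h t ht)).1])
  simp only [Pi.neg_apply] at h2
  rw [abs_le]
  constructor <;> linarith

variable {E : Type*} [NormedAddCommGroup E] [InnerProductSpace ℝ E]

/-- A curve whose Gram kernel is close on `S` to the Gaussian kernel, up to the order two. -/
structure NearGaussian (φ : ℕ → ℝ → E) (S : Set ℝ) (η : ℝ) : Prop where
  hasDerivAt : ∀ i x, HasDerivAt (φ i) (φ (i + 1) x) x
  ordConnected : S.OrdConnected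
  inner_sub_le : ∀ i ≤ 2, ∀ j ≤ 2, ∀ x ∈ S, ∀ y ∈ S,
    |⟪φ i x, φ j y⟫ - (-1) ^ j * hg (i + j) (x - y)| ≤ η

variable {φ : ℕ → ℝ → E} {S : Set ℝ} {η u U : ℝ} {ι : Type*} [Fintype ι] [DecidableEq ι]
  {x : ι → ℝ}

lemma NearGaussian.hasDerivAt_inner (h : NearGaussian φ S η) (q : E) (i : ℕ) (z : ℝ) :
    HasDerivAt (fun z => ⟪φ i z, q⟫) ⟪φ (i + 1) z, q⟫ z := by
  simpa using (h.hasDerivAt i z).inner ℝ (hasDerivAt_const z q)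

/-- Only the nearest point contributes to leading order: coherence of the limit kernel accounts for
`u`, and each approximation error costs `η`. -/
lemma NearGaussian.sum_le (h : NearGaussian φ S η) (hx : ∀ k, x k ∈ S) (hi : Incoherent x u)
    {z : ℝ} (hz : z ∈ S) {l : ι} (hl : ∀ k, |z - x l| ≤ |z - x k|) {i j : ℕ} (hi2 : i ≤ 2)
    (hj : j ≤ 1) :
    ∑ k, |⟪φ i z, φ j (x k)⟫ - if k = l then (-1) ^ j * hg (i + j) (z - x l) else 0| ≤
      u + Fintype.card ι * η := by
  have h1 : ∀ k, |⟪φ i z, φ j (x k)⟫ - if k = l then (-1) ^ j * hg (i + j) (z - x l) else 0| ≤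
      (if k = l then 0 else |hg (i + j) (z - x k)|) + η := by
    intro k
    have h2 := h.inner_sub_le i hi2 j (by omega) z hz (x k) (hx k)
    split_ifs with hk
    · subst hk
      simpa using h2
    · have h3 := abs_add_le (⟪φ i z, φ j (x k)⟫ - (-1) ^ j * hg (i + j) (z - x k))
        ((-1) ^ j * hg (i + j) (z - x k))
      rw [sub_add_cancel, abs_mul ((-1) ^ j), abs_pow, abs_neg, abs_one, one_pow, one_mul] at h3
      rw [sub_zero]
      linarith
  refine (Finset.sum_le_sum fun k _ => h1 k).trans ?_
  rw [Finset.sum_add_distrib, Finset.sum_const, Finset.card_univ, nsmul_eq_mul]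
  refine add_le_add ?_ le_rfl
  have h3 := hi.sum_le z l hl (i + j) (by omega)
  rw [← Finset.add_sum_erase _ _ (Finset.mem_univ l), if_pos rfl, zero_add]
  refine le_trans (Finset.sum_le_sum fun k hk => ?_) h3
  rw [if_neg (Finset.mem_erase.1 hk).1]

/-- Existence of interpolating functions in the span of the features and of their derivatives, with
an expansion around the nearest interpolation point. -/
lemma NearGaussian.exists_interpolation (h : NearGaussian φ S η) (hx : ∀ k, x k ∈ S)
    (hi : Incoherent x u) (hU : u + Fintype.card ι * η ≤ U) (hU0 : 0 ≤ U) (hU1 : U ≤ 1 / 4)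
    (v w : ι → ℝ) (hv : ∀ k, |v k| ≤ 1) (hw : ∀ k, |w k| ≤ 1) :
    ∃ (p : E) (a b : ι → ℝ), (∀ k, |a k - v k| ≤ 2 * U / (1 - 2 * U)) ∧
      (∀ k, |b k - w k| ≤ 2 * U / (1 - 2 * U)) ∧ (∀ l, ⟪φ 0 (x l), p⟫ = v l) ∧
      (∀ l, ⟪φ 1 (x l), p⟫ = w l) ∧ ‖p‖ ≤ 2 * √(Fintype.card ι) ∧
      ∀ z ∈ S, ∀ l, (∀ k, |z - x l| ≤ |z - x k|) → ∀ i ≤ 2,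
        |⟪φ i z, p⟫ - (a l * hg i (z - x l) - b l * hg (i + 1) (z - x l))| ≤
          2 * U / (1 - 2 * U) := by
  have hself : ∀ l k, |x l - x l| ≤ |x l - x k| := fun l k => by simp
  -- The unknowns are the coefficients of the features (left summand) and of their derivatives
  -- (right summand). The diagonal limits are `hg 0 0 = 1` and `-hg 2 0 = 1`, the cross ones `hg 1 0
  -- = 0`; each row has two blocks of error at most `U`, whence `q = 2 * U`.
  obtain ⟨c, hc, hct⟩ := exists_solution_of_near_one (m := ι ⊕ ι) (fun i j =>
    ⟪φ (Sum.elim (fun _ => 0) (fun _ => 1) i) (x (Sum.elim id id i)),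
      φ (Sum.elim (fun _ => 0) (fun _ => 1) j) (x (Sum.elim id id j))⟫) (q := 2 * U) (τ := 1)
    (by linarith) (by linarith) (fun i => by
      rcases i with l | l
      · have h1 := h.sum_le hx hi (hx l) (hself l) (i := 0) (j := 0) (by norm_num) (by norm_num)
        have h2 := h.sum_le hx hi (hx l) (hself l) (i := 0) (j := 1) (by norm_num) (by norm_num)
        rw [Fintype.sum_sum_type]
        simp only [Sum.elim_inl, Sum.elim_inr, id, Sum.inl.injEq, reduceCtorEq, if_false]
        simp [hg_zero, hg_one] at h1 h2 ⊢
        linarith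
      · have h1 := h.sum_le hx hi (hx l) (hself l) (i := 1) (j := 0) (by norm_num) (by norm_num)
        have h2 := h.sum_le hx hi (hx l) (hself l) (i := 1) (j := 1) (by norm_num) (by norm_num)
        rw [Fintype.sum_sum_type]
        simp only [Sum.elim_inl, Sum.elim_inr, id, Sum.inr.injEq, reduceCtorEq, if_false]
        simp [hg_two, hg_one] at h1 h2 ⊢
        linarith) (Sum.elim v w) zero_le_one (fun i => by
      rcases i with l | l
      · exact hv l
      · exact hw l)
  rw [mul_one] at hct
  set e := 2 * U / (1 - 2 * U) with he
  have he0 : 0 ≤ e := div_nonneg (by linarith) (by linarith)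
  have he1 : e ≤ 1 := by rw [he, div_le_one (by linarith)]; linarith
  -- The remote contributions, two sums of size `U` with coefficients at most `1 + e`, add up to the
  -- same `e` that bounds the coefficient error.
  have he2 : 2 * U * (1 + e) = e := by
    have : 1 - 2 * U ≠ 0 := by linarith
    rw [he]; field_simp; ring
  set a : ι → ℝ := fun k => c (Sum.inl k) with ha
  set b : ι → ℝ := fun k => c (Sum.inr k) with hb
  have hav : ∀ k, |a k - v k| ≤ e := fun k => hct (Sum.inl k)
  have hbw : ∀ k, |b k - w k| ≤ e := fun k => hct (Sum.inr k)
  have ha1 : ∀ k, |a k| ≤ 1 + e := fun k => by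
    have := abs_add_le (a k - v k) (v k)
    rw [sub_add_cancel] at this
    linarith [hav k, hv k]
  have hb1 : ∀ k, |b k| ≤ 1 + e := fun k => by
    have := abs_add_le (b k - w k) (w k)
    rw [sub_add_cancel] at this
    linarith [hbw k, hw k]
  set p : E := ∑ k, (a k • φ 0 (x k) + b k • φ 1 (x k)) with hp
  have hinner : ∀ y : E, ⟪y, p⟫ = ∑ k, a k * ⟪y, φ 0 (x k)⟫ + ∑ k, b k * ⟪y, φ 1 (x k)⟫ := by
    intro y
    rw [hp, inner_sum, ← Finset.sum_add_distrib]
    exact Finset.sum_congr rfl fun k _ => by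
      rw [inner_add_right, real_inner_smul_right, real_inner_smul_right]
  have h0 : ∀ l, ⟪φ 0 (x l), p⟫ = v l := fun l => by
    have := hc (Sum.inl l)
    rw [Fintype.sum_sum_type] at this
    simp only [Sum.elim_inl, Sum.elim_inr, id] at this
    rw [hinner, ← this]
    simp only [ha, hb, mul_comm]
  have h1 : ∀ l, ⟪φ 1 (x l), p⟫ = w l := fun l => by
    have := hc (Sum.inr l)
    rw [Fintype.sum_sum_type] at this
    simp only [Sum.elim_inl, Sum.elim_inr, id] at this
    rw [hinner, ← this]
    simp only [ha, hb, mul_comm]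
  refine ⟨p, a, b, hav, hbw, h0, h1, ?_, fun z hz l hl i hi2 => ?_⟩
  · have h2 : ‖p‖ ^ 2 ≤ 4 * Fintype.card ι := by
      rw [← real_inner_self_eq_norm_sq, hinner, ← Finset.sum_add_distrib]
      have h3 : ∀ k, a k * ⟪p, φ 0 (x k)⟫ + b k * ⟪p, φ 1 (x k)⟫ ≤ 4 := fun k => by
        rw [real_inner_comm, h0, real_inner_comm, h1]
        have h4 := le_abs_self (a k * v k)
        have h5 := le_abs_self (b k * w k)
        rw [abs_mul] at h4 h5
        have h6 : |a k| * |v k| ≤ 2 * 1 :=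
          mul_le_mul (by linarith [ha1 k]) (hv k) (abs_nonneg _) (by norm_num)
        have h7 : |b k| * |w k| ≤ 2 * 1 :=
          mul_le_mul (by linarith [hb1 k]) (hw k) (abs_nonneg _) (by norm_num)
        linarith
      refine (Finset.sum_le_sum fun k _ => h3 k).trans ?_
      simp [mul_comm]
    refine abs_le_of_sq_le_sq' ?_ (by positivity) |>.2
    rw [mul_pow, Real.sq_sqrt (by positivity)]
    linarith
  · have h2 := h.sum_le hx hi hz hl (i := i) (j := 0) hi2 (by norm_num)
    have h3 := h.sum_le hx hi hz hl (i := i) (j := 1) hi2 (by norm_num)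
    have h4 : ⟪φ i z, p⟫ - (a l * hg i (z - x l) - b l * hg (i + 1) (z - x l)) =
        ∑ k, a k * (⟪φ i z, φ 0 (x k)⟫ -
          if k = l then (-1) ^ 0 * hg (i + 0) (z - x l) else 0) +
        ∑ k, b k * (⟪φ i z, φ 1 (x k)⟫ -
          if k = l then (-1) ^ 1 * hg (i + 1) (z - x l) else 0) := by
      rw [hinner]
      simp only [mul_sub, Finset.sum_sub_distrib, mul_ite, mul_zero, Finset.sum_ite_eq',
        Finset.mem_univ, if_true]
      simp
      ring
    have h5 : ∀ (a : ι → ℝ) (f : ι → ℝ), (∀ k, |a k| ≤ 1 + e) →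
        ∑ k, |f k| ≤ u + Fintype.card ι * η → |∑ k, a k * f k| ≤ (1 + e) * U := by
      intro a f ha hf
      refine (Finset.abs_sum_le_sum_abs _ _).trans ?_
      calc _ ≤ ∑ k, (1 + e) * |f k| := Finset.sum_le_sum fun k _ => by
            rw [abs_mul]; exact mul_le_mul_of_nonneg_right (ha k) (abs_nonneg _)
        _ ≤ (1 + e) * U := by
            rw [← Finset.mul_sum]
            exact mul_le_mul_of_nonneg_left (hf.trans hU) (by linarith)
    rw [h4]
    refine (abs_add_le _ _).trans ?_
    linarith [h5 a _ ha1 h2, h5 b _ hb1 h3]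

/-! ### The sign certificate and the affine certificate. -/

section Certificates

variable {r H e ν L₁ L₂ L₃ : ℝ}

/-- Gaps exceed `4`, so every other point is at distance more than `3`. -/
lemma Incoherent.nearest (hi : Incoherent x u) {z : ℝ} {l : ι} (hz : |z - x l| < 1) (k : ι) :
    |z - x l| ≤ |z - x k| := by
  by_cases hk : k = l
  · rw [hk]
  · have h1 := hi.sep k l hk
    have h2 := abs_sub_le (x k) z (x l)
    rw [abs_sub_comm (x k) z] at h2
    linarith

lemma NearGaussian.mem_of_uIcc (h : NearGaussian φ S η) {z y t : ℝ} (hy : y ∈ S) (hz : z ∈ S)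
    (ht : t ∈ Set.uIcc y z) : t ∈ S := h.ordConnected.uIcc_subset hy hz ht

lemma abs_sub_le_of_mem_uIcc {y z t : ℝ} (ht : t ∈ Set.uIcc y z) : |t - y| ≤ |z - y| := by
  rcases le_total y z with hyz | hyz
  · rw [Set.uIcc_of_le hyz] at ht
    rw [abs_of_nonneg (by linarith [ht.1]), abs_of_nonneg (by linarith)]
    linarith [ht.2]
  · rw [Set.uIcc_of_ge hyz] at ht
    rw [abs_of_nonpos (by linarith [ht.2]), abs_of_nonpos (by linarith)]
    linarith [ht.1]

/-- Interpolation of signs by a function whose modulus is less than one elsewhere. -/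
lemma NearGaussian.exists_sign_certificate [Nonempty ι] (h : NearGaussian φ S η)
    (hx : ∀ k, x k ∈ S) (hi : Incoherent x u) (hU0 : 0 ≤ u + Fintype.card ι * η)
    (hP : ProfileBounds r H e ν L₁ L₂ L₃) (hU : u + Fintype.card ι * η ≤ H)
    (v : ι → ℝ) (hv : ∀ k, |v k| = 1) :
    ∃ p : E, ‖p‖ ≤ 2 * √(Fintype.card ι) ∧ (∀ l, ⟪φ 0 (x l), p⟫ = v l) ∧
      (∀ z ∈ S, ∀ l, |z - x l| ≤ 2 * r → |⟪φ 0 z, p⟫| ≤ 1 - 1 / 4000 * (z - x l) ^ 2) ∧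
      (∀ z ∈ S, (∀ k, r / 2 ≤ |z - x k|) → |⟪φ 0 z, p⟫| ≤ 1 - 1 / 4000) := by
  have hH := hP.H_le
  have hH0 : 0 ≤ H := hU0.trans hU
  obtain ⟨p, a, b, ha, hb, hp0, hp1, hpn, hp⟩ := h.exists_interpolation hx hi hU hH0
    (by linarith) v (fun _ => 0) (fun k => (hv k).le) (fun k => by simp)
  set δ := 2 * H / (1 - 2 * H) with hδ
  have hδ0 : 0 ≤ δ := div_nonneg (by linarith) (by linarith)
  have hδ1 : δ * (1 - 2 * H) = 2 * H := by rw [hδ, div_mul_cancel₀]; linarith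
  have hδ2 : δ ≤ 1 / 50 := by nlinarith
  have hvv : ∀ k, v k * v k = 1 := fun k => by rw [← abs_mul_abs_self, hv]; norm_num
  have hava : ∀ k, |a k * v k - 1| ≤ δ := fun k => by
    rw [← hvv k, ← sub_mul, abs_mul, hv, mul_one]; exact ha k
  have hbv : ∀ k, |b k| ≤ δ := fun k => by simpa using hb k
  have hL1 := hP.L₁_nonneg
  have hL2 := hP.L₂_nonneg
  have hL3 := hP.L₃_nonneg
  have hmul : ∀ s t δ L : ℝ, |s| ≤ δ → |t| ≤ L → |s * t| ≤ δ * L := fun s t δ L hs ht => by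
    rw [abs_mul]; exact mul_le_mul hs ht (abs_nonneg _) ((abs_nonneg _).trans hs)
  refine ⟨p, hpn, hp0, fun z hz l hzl => ?_, fun z hz hfar => ?_⟩
  · have hr := hP.two_r_lt
    -- The profile contributes `-ν`, and the definition of `H` limits the perturbation `δ * (L₂ + L₃
    -- + 1)` to `8 * ν / 9`.
    have h1 : ∀ t ∈ Set.uIcc (x l) z, v l * ⟪φ 2 t, p⟫ ≤ -ν / 9 := by
      intro t ht
      have htz := abs_sub_le_of_mem_uIcc ht
      have h2 := hp t (h.mem_of_uIcc (hx l) hz ht) l (hi.nearest (by linarith)) 2 le_rfl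
      have h3 := hP.near (t - x l) (by linarith)
      have h4 := hmul (v l) _ 1 δ (hv l).le h2
      have h5 := hmul (a l * v l - 1) (hg 2 (t - x l)) δ L₂ (hava l) (hP.two_le _)
      have h6 := hmul (v l) (b l * hg 3 (t - x l)) 1 (δ * L₃) (hv l).le
        (hmul _ _ _ _ (hbv l) (hP.three_le _))
      have h7 := (abs_le.1 h4).2
      have h8 := (abs_le.1 h5).2
      have h9 := (abs_le.1 h6).1
      have key : v l * ⟪φ 2 t, p⟫ ≤ -ν + δ * (L₂ + L₃ + 1) := by
        have : v l * ⟪φ 2 t, p⟫ = hg 2 (t - x l) + (a l * v l - 1) * hg 2 (t - x l) +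
          v l * (⟪φ 2 t, p⟫ - (a l * hg 2 (t - x l) - b l * hg (2 + 1) (t - x l))) -
          v l * (b l * hg 3 (t - x l)) := by ring
        linarith
      have hnu := hP.nu
      have hnul := hP.nu_le
      have h10 : H * (2 * L₂ + 2 * L₃ + 4) ≤ 1 := by linarith
      have h11 : δ * (L₂ + L₃ + 1) ≤ H * (2 * L₂ + 2 * L₃ + 4) := by
        have h13 : 0 < 1 - 2 * H := by linarith
        have h12 : δ * (L₂ + L₃ + 1) * (1 - 2 * H) ≤
            H * (2 * L₂ + 2 * L₃ + 4) * (1 - 2 * H) := by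
          nlinarith [mul_le_mul_of_nonneg_left h10 hH0]
        exact le_of_mul_le_mul_right h12 h13
      linarith
    have h2 := taylor_upper (f := fun t => v l * ⟪φ 0 t, p⟫) (f' := fun t => v l * ⟪φ 1 t, p⟫)
      (f'' := fun t => v l * ⟪φ 2 t, p⟫)
      (fun t => (h.hasDerivAt_inner p 0 t).const_mul _)
      (fun t => (h.hasDerivAt_inner p 1 t).const_mul _) h1
    simp only [hp0, hp1, hvv, mul_zero, zero_mul, add_zero] at h2
    -- Concavity bounds `v l * ⟪φ 0 z, p⟫` from above only; its nonnegativity is what turns this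
    -- into a bound on the modulus.
    have h3 : 0 ≤ v l * ⟪φ 0 z, p⟫ := by
      have h2 := hp z hz l (hi.nearest (by linarith)) 0 (by norm_num)
      have h4 := hmul (v l) _ 1 δ (hv l).le h2
      have h5 := hmul (a l * v l - 1) (hg 0 (z - x l)) δ 1 (hava l) (by
        rw [abs_of_pos (hg_zero_pos _)]; exact hg_zero_le_one _)
      have h6 := hmul (v l) (b l * hg 1 (z - x l)) 1 (δ * L₁) (hv l).le
        (hmul _ _ _ _ (hbv l) (hP.one_le _))
      have h7 := (abs_le.1 h4).1
      have h8 := (abs_le.1 h5).1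
      have h9 := (abs_le.1 h6).2
      have h10 := one_sub_le_hg_zero (z - x l)
      have h11 : (z - x l) ^ 2 ≤ 1 := by
        rw [← sq_abs]; nlinarith [abs_nonneg (z - x l)]
      have h12 : v l * ⟪φ 0 z, p⟫ = hg 0 (z - x l) + (a l * v l - 1) * hg 0 (z - x l) +
          v l * (⟪φ 0 z, p⟫ - (a l * hg 0 (z - x l) - b l * hg (0 + 1) (z - x l))) -
          v l * (b l * hg 1 (z - x l)) := by
        rw [zero_add]; ring
      nlinarith [hP.L₁_le]
    have h4 : |⟪φ 0 z, p⟫| = v l * ⟪φ 0 z, p⟫ := by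
      rw [← abs_of_nonneg h3, abs_mul, hv, one_mul]
    rw [h4]
    -- The constant `1 / 4000` is `ν / 18` at the lower bound `9 / 2000` of `ν`.
    nlinarith [hP.nu_ge, sq_nonneg (z - x l)]
  · obtain ⟨l, -, hl⟩ := Finset.exists_min_image Finset.univ (fun k => |z - x k|)
      Finset.univ_nonempty
    have h2 := hp z hz l (fun k => hl k (Finset.mem_univ k)) 0 (by norm_num)
    have h3 := hP.far (z - x l) (hfar l)
    have h4 := hmul (a l) (hg 0 (z - x l)) (1 + δ) (1 - e) (by
        have := abs_add_le (a l - v l) (v l)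
        rw [sub_add_cancel, hv] at this
        linarith [ha l]) (by rwa [abs_of_pos (hg_zero_pos _)])
    have h5 := hmul _ _ _ _ (hbv l) (hP.one_le (z - x l))
    have h6 : |⟪φ 0 z, p⟫| ≤ δ + ((1 + δ) * (1 - e) + δ * L₁) := by
      have h7 := abs_add_le (⟪φ 0 z, p⟫ - (a l * hg 0 (z - x l) - b l * hg (0 + 1) (z - x l)))
        (a l * hg 0 (z - x l) - b l * hg (0 + 1) (z - x l))
      rw [sub_add_cancel] at h7
      have h8 := abs_sub (a l * hg 0 (z - x l)) (b l * hg (0 + 1) (z - x l))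
      rw [zero_add] at *
      linarith
    have heps := hP.eps
    have hee := hP.e_ge
    have hel := hP.e_le
    -- With `eps` the perturbation is at most `4 * e / 5`, so at least `e / 5` of the gap remains.
    have h7 : δ * (L₁ + 2) ≤ H * (5 + 2 * L₁) := by
      have h13 : 0 < 1 - 2 * H := by linarith
      have h12 : δ * (L₁ + 2) * (1 - 2 * H) ≤ H * (5 + 2 * L₁) * (1 - 2 * H) := by
        have h14 : H * (5 + 2 * L₁) ≤ 1 / 2 := by linarith
        nlinarith [mul_le_mul_of_nonneg_left h14 hH0]
      exact le_of_mul_le_mul_right h12 h13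
    nlinarith [mul_nonneg hδ0 (by linarith : 0 ≤ e)]

/-- Interpolation of values and of derivatives, with a bound on the error of the affine
approximation. -/
lemma NearGaussian.exists_affine_certificate [Nonempty ι] (h : NearGaussian φ S η)
    (hx : ∀ k, x k ∈ S) (hi : Incoherent x u) (hU0 : 0 ≤ u + Fintype.card ι * η)
    (hU : u + Fintype.card ι * η ≤ 1 / 200)
    (v w : ι → ℝ) (hv : ∀ k, |v k| ≤ 1) (hw : ∀ k, |w k| ≤ 1) :
    ∃ p : E, ‖p‖ ≤ 2 * √(Fintype.card ι) ∧ (∀ l, ⟪φ 0 (x l), p⟫ = v l) ∧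
      (∀ l, ⟪φ 1 (x l), p⟫ = w l) ∧
      (∀ z ∈ S, ∀ l, |z - x l| < 1 →
        |⟪φ 0 z, p⟫ - v l - w l * (z - x l)| ≤ 3 * (z - x l) ^ 2) ∧
      (∀ z ∈ S, |⟪φ 0 z, p⟫| ≤ 3) := by
  obtain ⟨p, a, b, ha, hb, hp0, hp1, hpn, hp⟩ := h.exists_interpolation hx hi le_rfl hU0
    (by linarith) v w hv hw
  set U := u + Fintype.card ι * η
  set δ := 2 * U / (1 - 2 * U) with hδ
  have hδ1 : δ * (1 - 2 * U) = 2 * U := by rw [hδ, div_mul_cancel₀]; linarith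
  have hδ2 : δ ≤ 1 / 50 := by nlinarith
  have hδ0 : 0 ≤ δ := div_nonneg (by linarith) (by linarith)
  have ha1 : ∀ k, |a k| ≤ 51 / 50 := fun k => by
    have := abs_add_le (a k - v k) (v k)
    rw [sub_add_cancel] at this
    linarith [ha k, hv k]
  have hb1 : ∀ k, |b k| ≤ 51 / 50 := fun k => by
    have := abs_add_le (b k - w k) (w k)
    rw [sub_add_cancel] at this
    linarith [hb k, hw k]
  have hmul : ∀ s t δ L : ℝ, |s| ≤ δ → |t| ≤ L → |s * t| ≤ δ * L := fun s t δ L hs ht => by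
    rw [abs_mul]; exact mul_le_mul hs ht (abs_nonneg _) ((abs_nonneg _).trans hs)
  have key : ∀ z ∈ S, ∀ l, (∀ k, |z - x l| ≤ |z - x k|) → ∀ i ≤ 2, ∀ A B,
      |hg i (z - x l)| ≤ A → |hg (i + 1) (z - x l)| ≤ B →
      |⟪φ i z, p⟫| ≤ 1 / 50 + (51 / 50 * A + 51 / 50 * B) := by
    intro z hz l hl i hi2 A B hA hB
    have h2 := hp z hz l hl i hi2
    have h7 := abs_add_le (⟪φ i z, p⟫ - (a l * hg i (z - x l) - b l * hg (i + 1) (z - x l)))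
      (a l * hg i (z - x l) - b l * hg (i + 1) (z - x l))
    rw [sub_add_cancel] at h7
    have h8 := abs_sub (a l * hg i (z - x l)) (b l * hg (i + 1) (z - x l))
    linarith [hmul _ _ _ _ (ha1 l) hA, hmul _ _ _ _ (hb1 l) hB]
  refine ⟨p, hpn, hp0, hp1, fun z hz l hzl => ?_, fun z hz => ?_⟩
  · have h1 := taylor_abs (f := fun t => ⟪φ 0 t, p⟫) (f' := fun t => ⟪φ 1 t, p⟫)
      (f'' := fun t => ⟪φ 2 t, p⟫) (h.hasDerivAt_inner p 0) (h.hasDerivAt_inner p 1)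
      -- Any `C` above `1/50 + 51/50 * 3` would do; `6` makes the quadratic constant equal to the
      -- far bound `3`.
      (a := x l) (z := z) (C := 6) fun t ht => by
        have := key t (h.mem_of_uIcc (hx l) hz ht) l
          (hi.nearest ((abs_sub_le_of_mem_uIcc ht).trans_lt hzl)) 2 le_rfl 1 2
          (abs_hg_two_le _) (abs_hg_three_le _)
        linarith
    simp only [hp0, hp1] at h1
    linarith
  · obtain ⟨l, -, hl⟩ := Finset.exists_min_image Finset.univ (fun k => |z - x k|)
      Finset.univ_nonempty
    have := key z hz l (fun k => hl k (Finset.mem_univ k)) 0 (by norm_num) 1 1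
      (by rw [abs_of_pos (hg_zero_pos _)]; exact hg_zero_le_one _) (abs_hg_one_le _)
    linarith

end Certificates

end SpikeDeconv

namespace SpikeDeconv

open scoped RealInnerProductSpace

/-! ### The deterministic error bounds -/

lemma exists_sign (a : ℝ) : ∃ v : ℝ, |v| = 1 ∧ v * a = |a| := by
  rcases le_total 0 a with h | h
  · exact ⟨1, by simp, by rw [one_mul, abs_of_nonneg h]⟩
  · exact ⟨-1, by simp, by rw [abs_of_nonpos h]; ring⟩

variable {E : Type*} [NormedAddCommGroup E] [InnerProductSpace ℝ E]
  {φ : ℕ → ℝ → E} {S : Set ℝ} {η u r H e ν L₁ L₂ L₃ : ℝ} {ι J : Type*}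
  [Fintype ι] [DecidableEq ι] [Fintype J] [DecidableEq J] {x : ι → ℝ}

omit [DecidableEq ι] in
lemma sum_eq_sum_near_add_far {N : ι → Finset J} (hd : ∀ k l, k ≠ l → Disjoint (N k) (N l))
    (f : J → ℝ) : ∑ j, f j = ∑ k, ∑ j ∈ N k, f j + ∑ j ∈ (Finset.univ.biUnion N)ᶜ, f j := by
  rw [← Finset.sum_add_sum_compl (Finset.univ.biUnion N), Finset.sum_biUnion]
  exact fun k _ l _ hkl => hd k l hkl

omit [DecidableEq ι] in
/-- Expansion of the scalar product of a difference of mixtures with a fixed vector around the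
points `x`. -/
lemma abs_inner_mixture_sub_le (φ₀ : ℝ → E) {N : ι → Finset J}
    (hd : ∀ k l, k ≠ l → Disjoint (N k) (N l)) (β z : J → ℝ) (βs : ι → ℝ) (q : E) (A B : ι → ℝ)
    {C : ℝ} (hA : ∀ k, ⟪φ₀ (x k), q⟫ = A k)
    (hnear : ∀ k, ∀ j ∈ N k, |⟪φ₀ (z j), q⟫ - A k - B k * (z j - x k)| ≤ C * (z j - x k) ^ 2)
    (hfar : ∀ j, |⟪φ₀ (z j), q⟫| ≤ C) :
    |⟪∑ j, β j • φ₀ (z j) - ∑ k, βs k • φ₀ (x k), q⟫ -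
      (∑ k, A k * (∑ j ∈ N k, β j - βs k) + ∑ k, B k * ∑ j ∈ N k, β j * (z j - x k))| ≤
      C * (∑ k, ∑ j ∈ N k, |β j| * (z j - x k) ^ 2 + ∑ j ∈ (Finset.univ.biUnion N)ᶜ, |β j|) := by
  have h1 : ⟪∑ j, β j • φ₀ (z j) - ∑ k, βs k • φ₀ (x k), q⟫ =
      ∑ k, ∑ j ∈ N k, β j * ⟪φ₀ (z j), q⟫ +
      ∑ j ∈ (Finset.univ.biUnion N)ᶜ, β j * ⟪φ₀ (z j), q⟫ - ∑ k, βs k * A k := by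
    rw [inner_sub_left, sum_inner, sum_inner]
    simp only [real_inner_smul_left, hA]
    rw [sum_eq_sum_near_add_far hd]
  have h2 : ⟪∑ j, β j • φ₀ (z j) - ∑ k, βs k • φ₀ (x k), q⟫ -
      (∑ k, A k * (∑ j ∈ N k, β j - βs k) + ∑ k, B k * ∑ j ∈ N k, β j * (z j - x k)) =
      ∑ k, ∑ j ∈ N k, β j * (⟪φ₀ (z j), q⟫ - A k - B k * (z j - x k)) +
      ∑ j ∈ (Finset.univ.biUnion N)ᶜ, β j * ⟪φ₀ (z j), q⟫ := by
    have h3 : ∀ k, ∑ j ∈ N k, β j * (⟪φ₀ (z j), q⟫ - A k - B k * (z j - x k)) =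
        ∑ j ∈ N k, β j * ⟪φ₀ (z j), q⟫ - A k * (∑ j ∈ N k, β j - βs k) -
          B k * ∑ j ∈ N k, β j * (z j - x k) - βs k * A k := by
      intro k
      rw [mul_sub, Finset.mul_sum, Finset.mul_sum, sub_right_comm, sub_sub_eq_add_sub,
        sub_right_comm]
      have : ∑ j ∈ N k, β j * (⟪φ₀ (z j), q⟫ - A k - B k * (z j - x k)) =
          ∑ j ∈ N k, β j * ⟪φ₀ (z j), q⟫ - ∑ j ∈ N k, A k * β j -
          ∑ j ∈ N k, B k * (β j * (z j - x k)) := by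
        rw [← Finset.sum_sub_distrib, ← Finset.sum_sub_distrib]
        exact Finset.sum_congr rfl fun j _ => by ring
      rw [this]
      ring
    simp only [h3, Finset.sum_sub_distrib]
    rw [h1]
    ring
  rw [h2, mul_add, Finset.mul_sum, Finset.mul_sum]
  refine (abs_add_le _ _).trans (add_le_add ?_ ?_)
  · refine (Finset.abs_sum_le_sum_abs _ _).trans (Finset.sum_le_sum fun k _ => ?_)
    rw [Finset.mul_sum]
    refine (Finset.abs_sum_le_sum_abs _ _).trans (Finset.sum_le_sum fun j hj => ?_)
    rw [abs_mul, mul_left_comm]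
    exact mul_le_mul_of_nonneg_left (hnear k j hj) (abs_nonneg _)
  · refine (Finset.abs_sum_le_sum_abs _ _).trans (Finset.sum_le_sum fun j _ => ?_)
    rw [abs_mul, mul_comm]
    exact mul_le_mul_of_nonneg_right (hfar j) (abs_nonneg _)

/-- Error bounds for approximate minimizers of the penalized criterion, when the noise is small
compared to the penalty. -/
lemma NearGaussian.error_bounds [Nonempty ι] (h : NearGaussian φ S η)
    (hx : ∀ k, x k ∈ S) (hi : Incoherent x u) (hU0 : 0 ≤ u + Fintype.card ι * η)
    (hP : ProfileBounds r H e ν L₁ L₂ L₃) (hU : u + Fintype.card ι * η ≤ H)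
    (β z : J → ℝ) (hz : ∀ j, z j ∈ S) (βs : ι → ℝ) (N : ι → Finset J)
    (hN : ∀ k, ∀ j ∈ N k, |z j - x k| ≤ 2 * r)
    (hF : ∀ j, β j ≠ 0 → (∀ k, j ∉ N k) → ∀ k, r / 2 ≤ |z j - x k|)
    {κ : ℝ} (hκ : 0 < κ) (w : E) (hw : ∀ i ≤ 2, ∀ y ∈ S, |⟪φ i y, w⟫| ≤ κ / 32000) (R : E)
    (hR : R = ∑ j, β j • φ 0 (z j) - ∑ k, βs k • φ 0 (x k))
    (hopt : 1 / 2 * ‖R‖ ^ 2 + κ * (∑ j, |β j| - ∑ k, |βs k|) ≤ ⟪R, w⟫) :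
    ‖R‖ ≤ 6 * √(Fintype.card ι) * κ ∧
    |(∑ j, |β j| - ∑ k, |βs k|)| ≤ 1000000 * κ * Fintype.card ι ∧
    ∑ k, |(|βs k| - ∑ j ∈ N k, |β j|)| ≤ 1000000 * κ * Fintype.card ι ∧
    ∑ k, |βs k - ∑ j ∈ N k, β j| ≤ 1000000 * κ * Fintype.card ι ∧
    ∑ j ∈ (Finset.univ.biUnion N)ᶜ, |β j| ≤ 1000000 * κ * Fintype.card ι := by
  have hr := hP.two_r_lt
  -- Near points are within `2 * r < 1` of their location while the gaps exceed `4`.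
  have hd : ∀ k l, k ≠ l → Disjoint (N k) (N l) := by
    intro k l hkl
    rw [Finset.disjoint_left]
    intro j hk hl
    have h1 := hi.sep k l hkl
    have h2 := abs_sub_le (x k) (z j) (x l)
    rw [abs_sub_comm (x k) (z j)] at h2
    linarith [hN k j hk, hN l j hl]
  set s : ℝ := (Fintype.card ι : ℝ) with hs
  set I₀ := ∑ k, |∑ j ∈ N k, β j - βs k| with hI0
  set I₁ := ∑ k, |∑ j ∈ N k, β j * (z j - x k)| with hI1
  set I₂ := ∑ k, ∑ j ∈ N k, |β j| * (z j - x k) ^ 2 with hI2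
  set I₃ := ∑ j ∈ (Finset.univ.biUnion N)ᶜ, |β j| with hI3
  set D := ∑ j, |β j| - ∑ k, |βs k| with hD
  have p0 : 0 ≤ I₀ := Finset.sum_nonneg fun k _ => abs_nonneg _
  have p1 : 0 ≤ I₁ := Finset.sum_nonneg fun k _ => abs_nonneg _
  have p2 : 0 ≤ I₂ := Finset.sum_nonneg fun k _ => Finset.sum_nonneg fun j _ => by positivity
  have p3 : 0 ≤ I₃ := Finset.sum_nonneg fun k _ => abs_nonneg _
  have pR := norm_nonneg R
  have ps : 0 ≤ √s := Real.sqrt_nonneg _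
  have hss : √s * √s = s := Real.mul_self_sqrt (by positivity)
  have hinner : ∀ p : E, ‖p‖ ≤ 2 * √s → |⟪R, p⟫| ≤ 2 * √s * ‖R‖ := fun p hp => by
    refine (abs_real_inner_le_norm R p).trans ?_
    rw [mul_comm]
    exact mul_le_mul_of_nonneg_right hp pR
  -- the sign certificate
  have hc1 : 1 / 4000 * (I₂ + I₃) ≤ D + 2 * √s * ‖R‖ := by
    choose v hv hvs using fun k => exists_sign (βs k)
    obtain ⟨p, hpn, hpx, hpnear, hpfar⟩ := h.exists_sign_certificate hx hi hU0 hP hU v hv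
    have h1 : ⟪R, p⟫ = ∑ k, ∑ j ∈ N k, β j * ⟪φ 0 (z j), p⟫ +
        ∑ j ∈ (Finset.univ.biUnion N)ᶜ, β j * ⟪φ 0 (z j), p⟫ - ∑ k, |βs k| := by
      rw [hR, inner_sub_left, sum_inner, sum_inner]
      simp only [real_inner_smul_left, hpx]
      rw [sum_eq_sum_near_add_far hd]
      simp only [← hvs, mul_comm]
    have h2 : ∑ k, ∑ j ∈ N k, β j * ⟪φ 0 (z j), p⟫ ≤
        ∑ k, ∑ j ∈ N k, |β j| - 1 / 4000 * I₂ := by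
      rw [hI2, Finset.mul_sum, ← Finset.sum_sub_distrib]
      refine Finset.sum_le_sum fun k _ => ?_
      rw [Finset.mul_sum, ← Finset.sum_sub_distrib]
      refine Finset.sum_le_sum fun j hj => ?_
      have h3 := mul_le_mul_of_nonneg_left (hpnear _ (hz j) k (hN k j hj)) (abs_nonneg (β j))
      rw [← abs_mul] at h3
      linarith [le_abs_self (β j * ⟪φ 0 (z j), p⟫)]
    have h3 : ∑ j ∈ (Finset.univ.biUnion N)ᶜ, β j * ⟪φ 0 (z j), p⟫ ≤ I₃ - 1 / 4000 * I₃ := by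
      rw [hI3, Finset.mul_sum, ← Finset.sum_sub_distrib]
      refine Finset.sum_le_sum fun j hj => ?_
      by_cases hβ : β j = 0
      · simp [hβ]
      · have hj' : ∀ k, j ∉ N k := fun k hk => (Finset.mem_compl.1 hj)
          (Finset.mem_biUnion.2 ⟨k, Finset.mem_univ k, hk⟩)
        have h3 := mul_le_mul_of_nonneg_left (hpfar _ (hz j) (hF j hβ hj')) (abs_nonneg (β j))
        rw [← abs_mul] at h3
        linarith [le_abs_self (β j * ⟪φ 0 (z j), p⟫)]
    have h4 := sum_eq_sum_near_add_far hd fun j => |β j|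
    have h5 := (abs_le.1 (hinner p hpn)).1
    linarith
  -- the affine certificate
  have hc2 : I₀ + I₁ ≤ 2 * √s * ‖R‖ + 3 * (I₂ + I₃) := by
    choose v hv hvs using fun k => exists_sign (∑ j ∈ N k, β j - βs k)
    choose v' hv' hvs' using fun k => exists_sign (∑ j ∈ N k, β j * (z j - x k))
    obtain ⟨p, hpn, hpx, -, hpnear, hpfar⟩ := h.exists_affine_certificate hx hi hU0
      (hU.trans hP.H_le) v v' (fun k => (hv k).le) (fun k => (hv' k).le)
    have h1 := abs_inner_mixture_sub_le (φ 0) hd β z βs p v v' hpx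
      (fun k j hj => hpnear _ (hz j) k ((hN k j hj).trans_lt hr)) (fun j => hpfar _ (hz j))
    rw [← hR] at h1
    simp only [hvs, hvs'] at h1
    have h2 := (abs_le.1 (hinner p hpn)).2
    linarith [(abs_le.1 h1).1]
  -- the noise
  have hc3 : ⟪R, w⟫ ≤ κ / 32000 * (I₀ + I₁ + (I₂ + I₃)) := by
    have h1 := abs_inner_mixture_sub_le (φ 0) hd β z βs w (fun k => ⟪φ 0 (x k), w⟫)
      (fun k => ⟪φ 1 (x k), w⟫) (C := κ / 32000) (fun k => rfl) (fun k j hj => by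
        have := taylor_abs (f := fun t => ⟪φ 0 t, w⟫) (f' := fun t => ⟪φ 1 t, w⟫)
          (f'' := fun t => ⟪φ 2 t, w⟫) (h.hasDerivAt_inner w 0) (h.hasDerivAt_inner w 1)
          (a := x k) (z := z j) fun t ht =>
            hw 2 le_rfl t (h.mem_of_uIcc (hx k) (hz j) ht)
        refine this.trans (mul_le_mul_of_nonneg_right (by linarith) (sq_nonneg _)))
      (fun j => hw 0 (by norm_num) _ (hz j))
    rw [← hR] at h1
    have h2 : ∀ i ≤ 2, ∀ f : ι → ℝ, ∑ k, ⟪φ i (x k), w⟫ * f k ≤ κ / 32000 * ∑ k, |f k| := by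
      intro i hi2 f
      rw [Finset.mul_sum]
      refine Finset.sum_le_sum fun k _ => (le_abs_self _).trans ?_
      rw [abs_mul]
      exact mul_le_mul_of_nonneg_right (hw i hi2 _ (hx k)) (abs_nonneg _)
    linarith [(abs_le.1 h1).2, h2 0 (by norm_num) fun k => ∑ j ∈ N k, β j - βs k,
      h2 1 (by norm_num) fun k => ∑ j ∈ N k, β j * (z j - x k)]
  set n := √s * ‖R‖ with hn
  have pn : 0 ≤ n := mul_nonneg ps pR
  have q1 : ⟪R, w⟫ ≤ κ / 32000 * (2 * n + 4 * (I₂ + I₃)) :=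
    hc3.trans (mul_le_mul_of_nonneg_left (by linarith) (by positivity))
  have q2 : κ * (1 / 4000 * (I₂ + I₃)) ≤ κ * (D + 2 * n) :=
    mul_le_mul_of_nonneg_left (by linarith) hκ.le
  -- The noise level `κ / 32000` is chosen so that the noise takes `4/32000 = 1/8000`, half of the
  -- gain `1/4000` of the sign certificate.
  have q3 : 1 / 2 * ‖R‖ ^ 2 + κ * (I₂ + I₃) / 8000 ≤ 3 * (κ * n) := by
    linarith [mul_nonneg hκ.le pn]
  have hRle : ‖R‖ ≤ 6 * √s * κ := by
    by_contra! hcon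
    have hpos : 0 < ‖R‖ := lt_of_le_of_lt (by positivity) hcon
    have h1 : 6 * √s * κ * ‖R‖ < ‖R‖ * ‖R‖ := mul_lt_mul_of_pos_right hcon hpos
    have h2 : 0 ≤ κ * (I₂ + I₃) := by positivity
    have h3 : κ * n = √s * κ * ‖R‖ := by rw [hn]; ring
    nlinarith
  have hnle : n ≤ 6 * κ * s := by
    calc n ≤ √s * (6 * √s * κ) := mul_le_mul_of_nonneg_left hRle ps
      _ = 6 * κ * (√s * √s) := by ring
      _ = 6 * κ * s := by rw [hss]
  have hI : I₂ + I₃ ≤ 144000 * κ * s := by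
    have h1 : κ * (I₂ + I₃) ≤ κ * (24000 * n) := by nlinarith [sq_nonneg ‖R‖]
    have h2 := le_of_mul_le_mul_left h1 hκ
    linarith
  have pκs : 0 ≤ κ * s := by positivity
  have hI01 : I₀ + I₁ ≤ 432012 * (κ * s) := by linarith
  have hDup : D ≤ 20 * (κ * s) := by
    have h1 : κ * D ≤ κ * (1 / 32000 * (2 * n + 4 * (I₂ + I₃))) := by
      nlinarith [sq_nonneg ‖R‖]
    have h2 := le_of_mul_le_mul_left h1 hκ
    linarith
  have hI0s : ∑ k, |βs k - ∑ j ∈ N k, β j| = I₀ :=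
    Finset.sum_congr rfl fun k _ => abs_sub_comm _ _
  refine ⟨hRle, abs_le.2 ⟨by linarith, by linarith⟩, ?_, by linarith, by linarith⟩
  -- The difference `∑ |β j| - |βs k|` is at least `-|∑ β j - βs k|`, hence this form free of moduli
  -- on the first term. Its sum telescopes to `D - I₃` plus `2 * I₀`, which is the largest of the
  -- bounds and sets the constant `1000000`.
  have h1 : ∀ k, |(|βs k| - ∑ j ∈ N k, |β j|)| ≤
      (∑ j ∈ N k, |β j| - |βs k|) + 2 * |∑ j ∈ N k, β j - βs k| := by
    intro k
    have h2 := Finset.abs_sum_le_sum_abs β (N k)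
    have h3 := abs_sub_abs_le_abs_sub (βs k) (∑ j ∈ N k, β j)
    rw [abs_sub_comm (βs k) (∑ j ∈ N k, β j)] at h3
    have h4 := abs_nonneg (∑ j ∈ N k, β j - βs k)
    rw [abs_le]
    constructor <;> linarith
  refine (Finset.sum_le_sum fun k _ => h1 k).trans ?_
  rw [Finset.sum_add_distrib, Finset.sum_sub_distrib, ← Finset.mul_sum]
  have h4 := sum_eq_sum_near_add_far hd fun j => |β j|
  linarith

end SpikeDeconv

namespace SpikeDeconv

open scoped RealInnerProductSpace

/-! ### Suprema of the noise -/

/-- The vector of the noise in the Euclidean space of the grid. -/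
noncomputable def noiseVec (Δ : ℝ) {T : ℕ} (g : Fin T → ℝ) : EuclideanSpace ℝ (Fin T) :=
  WithLp.toLp 2 fun j => √Δ * g j

lemma inner_noiseVec (Δ : ℝ) {T : ℕ} (a : EuclideanSpace ℝ (Fin T)) (g : Fin T → ℝ) :
    ⟪a, noiseVec Δ g⟫ = ∑ j, √Δ * a j * g j := by
  rw [PiLp.inner_apply]
  exact Finset.sum_congr rfl fun j _ => by simp [noiseVec]; ring

variable {Ω : Type*} [MeasurableSpace Ω] {P : Measure Ω} [IsProbabilityMeasure P] {T : ℕ}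
  {σ₁ Δ : ℝ} {G : Ω → Fin T → ℝ}

omit [IsProbabilityMeasure P] in
-- Cauchy–Schwarz gives `(∑ |c j|)² ≤ T * ∑ c j²`, so covariances of size `σ₁² / T` contribute no
-- more than the diagonal. This is the source of `σ = √2 * σ₁`.
lemma IsNoise.second_moment_le (hG : IsNoise P σ₁ G) (hT : 0 < T) (c : Fin T → ℝ) :
    ∫ ω, (∑ j, c j * G ω j) ^ 2 ∂P ≤ 2 * σ₁ ^ 2 * ∑ j, c j ^ 2 := by
  have hmem : ∀ j, MemLp (fun ω => G ω j) 2 P := fun j => (hG.gaussian.eval j).memLp_two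
  have hint : ∀ i j, Integrable (fun ω => G ω i * G ω j) P := fun i j =>
    (hmem i).integrable_mul (hmem j)
  have hT' : (0 : ℝ) < T := by exact_mod_cast hT
  have h1 : ∫ ω, (∑ j, c j * G ω j) ^ 2 ∂P = ∑ i, ∑ j, c i * c j * ∫ ω, G ω i * G ω j ∂P := by
    have : ∀ ω, (∑ j, c j * G ω j) ^ 2 = ∑ i, ∑ j, c i * c j * (G ω i * G ω j) := fun ω => by
      rw [sq, Finset.sum_mul_sum]
      exact Finset.sum_congr rfl fun i _ => Finset.sum_congr rfl fun j _ => by ring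
    simp only [this]
    rw [integral_finsetSum _ fun i _ => integrable_finsetSum _ fun j _ =>
      (hint i j).const_mul _]
    refine Finset.sum_congr rfl fun i _ => ?_
    rw [integral_finsetSum _ fun j _ => (hint i j).const_mul _]
    exact Finset.sum_congr rfl fun j _ => integral_const_mul _ _
  have h2 : ∀ i j, c i * c j * ∫ ω, G ω i * G ω j ∂P ≤
      (if i = j then σ₁ ^ 2 * c i ^ 2 else 0) + σ₁ ^ 2 / T * (|c i| * |c j|) := by
    intro i j
    split_ifs with hij
    · subst hij
      have : ∫ ω, G ω i * G ω i ∂P = σ₁ ^ 2 := by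
        rw [← hG.variance i]; simp only [sq]
      rw [this]
      have : 0 ≤ σ₁ ^ 2 / T * (|c i| * |c i|) := by positivity
      nlinarith
    · rw [zero_add]
      refine (le_abs_self _).trans ?_
      rw [abs_mul, abs_mul, mul_comm (σ₁ ^ 2 / T)]
      exact mul_le_mul_of_nonneg_left (hG.covariance i j hij) (by positivity)
  have h3 : (∑ j, |c j|) ^ 2 ≤ T * ∑ j, c j ^ 2 := by
    have := sq_sum_le_card_mul_sum_sq (s := Finset.univ) (f := fun j => |c j|)
    simpa using this
  calc _ ≤ ∑ i, ∑ j, ((if i = j then σ₁ ^ 2 * c i ^ 2 else 0) +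
        σ₁ ^ 2 / T * (|c i| * |c j|)) := by
        rw [h1]
        exact Finset.sum_le_sum fun i _ => Finset.sum_le_sum fun j _ => h2 i j
    _ = σ₁ ^ 2 * ∑ j, c j ^ 2 + σ₁ ^ 2 / T * (∑ j, |c j|) ^ 2 := by
        simp only [Finset.sum_add_distrib, ← Finset.mul_sum]
        rw [sq (∑ j, |c j|), Finset.sum_mul_sum]
        simp [Finset.mul_sum]
    _ ≤ σ₁ ^ 2 * ∑ j, c j ^ 2 + σ₁ ^ 2 / T * (T * ∑ j, c j ^ 2) := by gcongr
    _ = _ := by field_simp; ring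

omit [IsProbabilityMeasure P] in
lemma IsNoise.lintegral_exp_abs_le (hG : IsNoise P σ₁ G) (hT : 0 < T) (hΔ : 0 ≤ Δ)
    {a : EuclideanSpace ℝ (Fin T)} {V : ℝ} (hV : ‖a‖ ^ 2 ≤ V) (t : ℝ) :
    ∫⁻ g, ENNReal.ofReal (Real.exp (t * |⟪a, noiseVec Δ g⟫|)) ∂(P.map G) ≤
      ENNReal.ofReal (2 * Real.exp (t ^ 2 * (Δ * σ₁ ^ 2 * V))) := by
  have hmeas : Continuous fun g : Fin T → ℝ => ⟪a, noiseVec Δ g⟫ := by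
    simp only [inner_noiseVec]; fun_prop
  set X : Ω → ℝ := fun ω => ∑ j, (√Δ * a j) * G ω j with hX
  have hlaw : HasGaussianLaw X P := by
    have h1 := hG.gaussian.map_fun (∑ j, (√Δ * a j) •
      ContinuousLinearMap.proj (R := ℝ) (φ := fun _ => ℝ) j)
    have h2 : X = fun ω =>
        (∑ j, (√Δ * a j) • ContinuousLinearMap.proj (R := ℝ) (φ := fun _ => ℝ) j) (G ω) := by
      funext ω
      simp [hX]
    rw [h2]
    exact h1
  have hmean : ∫ ω, X ω ∂P = 0 := by
    simp only [hX]
    rw [integral_finsetSum _ fun j _ => ((hG.gaussian.eval j).integrable).const_mul _]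
    simp [integral_const_mul, hG.centered]
  have hvar : Var[X; P] ≤ 2 * (Δ * σ₁ ^ 2 * V) := by
    rw [variance_of_integral_eq_zero hlaw.aemeasurable hmean]
    refine (hG.second_moment_le hT fun j => √Δ * a j).trans ?_
    simp only [mul_pow, Real.sq_sqrt hΔ, ← Finset.mul_sum]
    have : ∑ j, a j ^ 2 = ‖a‖ ^ 2 := by
      rw [EuclideanSpace.norm_sq_eq]; simp
    rw [this]
    have h0 : 0 ≤ Δ * σ₁ ^ 2 := by positivity
    linarith [mul_le_mul_of_nonneg_left hV h0]
  have hexp : ∀ t : ℝ, ∫⁻ ω, ENNReal.ofReal (Real.exp (t * X ω)) ∂P ≤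
      ENNReal.ofReal (Real.exp (t ^ 2 * (Δ * σ₁ ^ 2 * V))) := by
    intro t
    have h1 := mgf_gaussianReal hlaw.map_eq_gaussianReal t
    -- The moment generating function is `0` by convention when the exponential is not integrable,
    -- whereas the Gaussian formula is positive.
    have h2 : Integrable (fun ω => Real.exp (t * X ω)) P := by
      by_contra hcon
      rw [mgf_undef hcon] at h1
      exact absurd h1 (Real.exp_pos _).ne
    rw [← ofReal_integral_eq_lintegral_ofReal h2 (Eventually.of_forall fun _ => (Real.exp_pos _).le)]
    refine ENNReal.ofReal_le_ofReal ?_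
    have h3 : ∫ ω, Real.exp (t * X ω) ∂P = mgf X P t := rfl
    rw [h3, h1, hmean, Real.coe_toNNReal _ (variance_nonneg _ _)]
    refine Real.exp_le_exp.2 ?_
    nlinarith [sq_nonneg t]
  have hmeas' : Continuous fun g : Fin T → ℝ => Real.exp (t * |⟪a, noiseVec Δ g⟫|) := by
    fun_prop
  rw [lintegral_map' hmeas'.measurable.ennreal_ofReal.aemeasurable hG.gaussian.aemeasurable]
  calc _ ≤ ∫⁻ ω, (ENNReal.ofReal (Real.exp (t * X ω)) + ENNReal.ofReal (Real.exp (-t * X ω))) ∂P := by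
        refine lintegral_mono fun ω => ?_
        rw [← ENNReal.ofReal_add (Real.exp_pos _).le (Real.exp_pos _).le, inner_noiseVec]
        refine ENNReal.ofReal_le_ofReal ?_
        change Real.exp (t * |X ω|) ≤ _
        rcases abs_choice (X ω) with h | h <;> rw [h]
        · linarith [Real.exp_pos (-t * X ω)]
        · rw [mul_neg, neg_mul]
          linarith [Real.exp_pos (t * X ω)]
    _ = ∫⁻ ω, ENNReal.ofReal (Real.exp (t * X ω)) ∂P +
        ∫⁻ ω, ENNReal.ofReal (Real.exp (-t * X ω)) ∂P := by
        have := hlaw.aemeasurable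
        rw [lintegral_add_left' (by fun_prop)]
    _ ≤ ENNReal.ofReal (Real.exp (t ^ 2 * (Δ * σ₁ ^ 2 * V))) +
        ENNReal.ofReal (Real.exp (t ^ 2 * (Δ * σ₁ ^ 2 * V))) := by
        refine add_le_add (hexp t) ?_
        have := hexp (-t)
        rwa [neg_sq] at this
    _ = _ := by
        rw [← ENNReal.ofReal_add (Real.exp_pos _).le (Real.exp_pos _).le, two_mul]

/-- Jensen's inequality on a unit interval, obtained by integrating the tangent line of the
exponential at `l * t`. -/
lemma exp_le_integral_exp {f : ℝ → ℝ} (hf : Continuous f) {c l t : ℝ} (hl : 0 ≤ l)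
    (h : t < ∫ x in c..(c + 1), f x) :
    Real.exp (l * t) ≤ ∫ x in c..(c + 1), Real.exp (l * f x) := by
  have h1 : ∫ x in c..(c + 1), Real.exp (l * t) * (1 + l * (f x - t)) ≤
      ∫ x in c..(c + 1), Real.exp (l * f x) := by
    refine intervalIntegral.integral_mono_on (by linarith)
      (Continuous.intervalIntegrable (by fun_prop) _ _)
      (Continuous.intervalIntegrable (by fun_prop) _ _) fun x _ => ?_
    have h2 := Real.add_one_le_exp (l * (f x - t))
    calc _ ≤ Real.exp (l * t) * Real.exp (l * (f x - t)) :=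
          mul_le_mul_of_nonneg_left (by linarith) (Real.exp_pos _).le
      _ = _ := by rw [← Real.exp_add]; congr 1; ring
  have hfi : IntervalIntegrable f volume c (c + 1) := hf.intervalIntegrable _ _
  rw [intervalIntegral.integral_const_mul, intervalIntegral.integral_add (by simp)
    ((hfi.sub (by simp)).const_mul _), intervalIntegral.integral_const_mul,
    intervalIntegral.integral_sub hfi (by simp)] at h1
  simp only [intervalIntegral.integral_const, add_sub_cancel_left, one_smul] at h1
  refine le_trans ?_ h1
  nlinarith [Real.exp_pos (l * t), mul_nonneg hl (sub_nonneg.2 h.le),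
    mul_nonneg (Real.exp_pos (l * t)).le (mul_nonneg hl (sub_nonneg.2 h.le))]

lemma IsNoise.measure_integral_gt_le (hG : IsNoise P σ₁ G) (hT : 0 < T) (hΔ : 0 < Δ)
    (hσ : 0 < σ₁) {ψ : ℝ → EuclideanSpace ℝ (Fin T)} (hψ : Continuous ψ) {c V t : ℝ} (hV0 : 0 < V)
    (hV : ∀ x ∈ Set.Icc c (c + 1), ‖ψ x‖ ^ 2 ≤ V) (ht : 0 ≤ t) :
    P.map G {g | t < ∫ x in c..(c + 1), |⟪ψ x, noiseVec Δ g⟫|} ≤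
      ENNReal.ofReal (2 * Real.exp (-t ^ 2 / (4 * (Δ * σ₁ ^ 2 * V)))) := by
  have : IsProbabilityMeasure (P.map G) :=
    Measure.isProbabilityMeasure_map hG.gaussian.aemeasurable
  set v := Δ * σ₁ ^ 2 * V with hv
  have hv0 : 0 < v := by positivity
  -- The minimizer of the Chernoff exponent `l² * v - l * t`, whose minimum is `-t² / (4 * v)`.
  set l := t / (2 * v) with hl
  have hl0 : 0 ≤ l := by positivity
  have hcont : Continuous fun p : (Fin T → ℝ) × ℝ => ⟪ψ p.2, noiseVec Δ p.1⟫ := by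
    simp only [inner_noiseVec]
    have : ∀ j, Continuous fun x => ψ x j := fun j => (EuclideanSpace.proj (𝕜 := ℝ) j).continuous.comp hψ
    fun_prop
  have hmeas : Measurable fun p : (Fin T → ℝ) × ℝ =>
      ENNReal.ofReal (Real.exp (l * |⟪ψ p.2, noiseVec Δ p.1⟫|)) := by
    have : Continuous fun p : (Fin T → ℝ) × ℝ => Real.exp (l * |⟪ψ p.2, noiseVec Δ p.1⟫|) := by
      fun_prop
    exact this.measurable.ennreal_ofReal
  set F : (Fin T → ℝ) → ℝ≥0∞ := fun g => ∫⁻ x in Set.Icc c (c + 1),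
    ENNReal.ofReal (Real.exp (l * |⟪ψ x, noiseVec Δ g⟫|)) with hF
  have hFm : Measurable F := hmeas.lintegral_prod_right'
  have hsub : {g | t < ∫ x in c..(c + 1), |⟪ψ x, noiseVec Δ g⟫|} ⊆
      {g | ENNReal.ofReal (Real.exp (l * t)) ≤ F g} := by
    intro g hg
    have hc : Continuous fun x => |⟪ψ x, noiseVec Δ g⟫| :=
      (hcont.comp (continuous_const.prodMk continuous_id)).abs
    have h1 := exp_le_integral_exp hc hl0 hg
    rw [intervalIntegral.integral_of_le (by linarith), ← integral_Icc_eq_integral_Ioc] at h1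
    have h2 := ENNReal.ofReal_le_ofReal h1
    rwa [ofReal_integral_eq_lintegral_ofReal
      ((Continuous.continuousOn (by fun_prop)).integrableOn_Icc)
      (Eventually.of_forall fun _ => (Real.exp_pos _).le)] at h2
  have hFle : ∫⁻ g, F g ∂(P.map G) ≤ ENNReal.ofReal (2 * Real.exp (l ^ 2 * v)) := by
    rw [hF, lintegral_lintegral_swap hmeas.aemeasurable]
    calc _ ≤ ∫⁻ x in Set.Icc c (c + 1), ENNReal.ofReal (2 * Real.exp (l ^ 2 * v)) :=
          setLIntegral_mono' measurableSet_Icc fun x hx =>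
            hG.lintegral_exp_abs_le hT hΔ.le (hV x hx) l
      _ = _ := by simp
  have h1 := (mul_meas_ge_le_lintegral hFm (ENNReal.ofReal (Real.exp (l * t)))
    (μ := P.map G)).trans hFle
  have hpos : 0 < Real.exp (l * t) := Real.exp_pos _
  refine (measure_mono hsub).trans ?_
  rw [mul_comm, ← ENNReal.le_div_iff_mul_le (Or.inl (by simpa using hpos))
    (Or.inl ENNReal.ofReal_ne_top), ← ENNReal.ofReal_div_of_pos hpos] at h1
  refine h1.trans (ENNReal.ofReal_le_ofReal ?_)
  rw [mul_div_assoc, ← Real.exp_sub]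
  refine mul_le_mul_of_nonneg_left (Real.exp_le_exp.2 (le_of_eq ?_)) zero_le_two
  rw [hl]
  field_simp
  ring

/-- Average `|f x| ≤ |f y| + ∫ |f'|` over `y`. The supremum of the noise process is thus reduced to
integrals, at the price of one more derivative. -/
lemma abs_le_integral_add {f f' : ℝ → ℝ} (hf : ∀ x, HasDerivAt f (f' x) x) (hc : Continuous f')
    {c x : ℝ} (hx : x ∈ Set.Icc c (c + 1)) :
    |f x| ≤ (∫ y in c..(c + 1), |f y|) + ∫ y in c..(c + 1), |f' y| := by
  have hfc : Continuous f := continuous_iff_continuousAt.2 fun x => (hf x).continuousAt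
  have key : ∀ y ∈ Set.Icc c (c + 1), |f x| ≤ |f y| + ∫ y in c..(c + 1), |f' y| := by
    intro y hy
    have h1 : ∫ s in y..x, f' s = f x - f y :=
      intervalIntegral.integral_eq_sub_of_hasDerivAt (fun s _ => hf s) (hc.intervalIntegrable _ _)
    have h2 : |f x - f y| ≤ ∫ y in c..(c + 1), |f' y| := by
      rw [← h1]
      refine (intervalIntegral.norm_integral_le_abs_integral_norm (f := f')).trans ?_
      rcases le_total y x with hyx | hyx
      · rw [abs_of_nonneg (intervalIntegral.integral_nonneg hyx fun s _ => norm_nonneg _)]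
        exact intervalIntegral.integral_mono_interval hy.1 hyx hx.2
          (Eventually.of_forall fun s => abs_nonneg _) (hc.abs.intervalIntegrable _ _)
      · rw [intervalIntegral.integral_symm, abs_neg,
          abs_of_nonneg (intervalIntegral.integral_nonneg hyx fun s _ => norm_nonneg _)]
        exact intervalIntegral.integral_mono_interval hx.1 hyx hy.2
          (Eventually.of_forall fun s => abs_nonneg _) (hc.abs.intervalIntegrable _ _)
    have h3 := abs_add_le (f x - f y) (f y)
    rw [sub_add_cancel] at h3
    linarith
  have h1 := intervalIntegral.integral_mono_on (μ := volume) (a := c) (b := c + 1) (by linarith)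
    (f := fun _ => |f x|) (g := fun y => |f y| + ∫ y in c..(c + 1), |f' y|) (by simp)
    (Continuous.intervalIntegrable (by fun_prop) _ _) key
  rw [intervalIntegral.integral_add (hfc.abs.intervalIntegrable _ _) (by simp)] at h1
  simpa using h1

/-- With large probability, the noise and its first two derivatives are small on a finite union of
unit intervals. -/
lemma IsNoise.exists_event (hG : IsNoise P σ₁ G) (hT : 0 < T) (hΔ : 0 < Δ) (hσ : 0 < σ₁)
    {ψ : ℕ → ℝ → EuclideanSpace ℝ (Fin T)} (hψ : ∀ i x, HasDerivAt (ψ i) (ψ (i + 1) x) x)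
    {V t : ℝ} (hV0 : 0 < V) (ht : 0 ≤ t) (X : Finset ℤ)
    (hV : ∀ j ∈ X, ∀ x ∈ Set.Icc (j : ℝ) (j + 1), ∀ i < 4, ‖ψ i x‖ ^ 2 ≤ V) :
    ∃ A : Set Ω, MeasurableSet A ∧
      1 - 8 * X.card * Real.exp (-t ^ 2 / (4 * (Δ * σ₁ ^ 2 * V))) ≤ P.real A ∧
      ∀ ω ∈ A, ∀ j ∈ X, ∀ x ∈ Set.Icc (j : ℝ) (j + 1), ∀ i ≤ 2,
        |⟪ψ i x, noiseVec Δ (G ω)⟫| ≤ 2 * t := by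
  have hψc : ∀ i, Continuous (ψ i) := fun i =>
    continuous_iff_continuousAt.2 fun x => (hψ i x).continuousAt
  set bad : ℤ → ℕ → Set (Fin T → ℝ) := fun j i =>
    {g | t < ∫ x in (j : ℝ)..(j + 1), |⟪ψ i x, noiseVec Δ g⟫|} with hbad
  -- Orders `0` to `3` are needed because orders up to `2` are each bounded with the next
  -- derivative. Four orders and a factor `2` per tail give the `8`.
  set B : Set (Fin T → ℝ) := ⋃ j ∈ X, ⋃ i ∈ Finset.range 4, bad j i with hB
  set E := Real.exp (-t ^ 2 / (4 * (Δ * σ₁ ^ 2 * V))) with hE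
  have hE0 : 0 < E := Real.exp_pos _
  have hPB : P (G ⁻¹' B) ≤ ENNReal.ofReal (8 * X.card * E) := by
    refine (Measure.le_map_apply hG.gaussian.aemeasurable B).trans ?_
    calc P.map G B ≤ ∑ j ∈ X, ∑ i ∈ Finset.range 4, P.map G (bad j i) :=
          (measure_biUnion_finset_le _ _).trans
            (Finset.sum_le_sum fun j _ => measure_biUnion_finset_le _ _)
      _ ≤ ∑ j ∈ X, ∑ i ∈ Finset.range 4, ENNReal.ofReal (2 * E) := by
          refine Finset.sum_le_sum fun j hj => Finset.sum_le_sum fun i hi => ?_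
          exact hG.measure_integral_gt_le hT hΔ hσ (hψc i) hV0
            (fun x hx => hV j hj x hx i (Finset.mem_range.1 hi)) ht
      _ = _ := by
          simp only [Finset.sum_const, Finset.card_range, nsmul_eq_mul]
          rw [← ENNReal.ofReal_natCast, ← ENNReal.ofReal_natCast,
            ← ENNReal.ofReal_mul (by positivity), ← ENNReal.ofReal_mul (by positivity)]
          congr 1
          push_cast
          ring
  -- Passing to a measurable hull of the bad event avoids proving that it is measurable.
  refine ⟨(toMeasurable P (G ⁻¹' B))ᶜ, (measurableSet_toMeasurable _ _).compl, ?_, ?_⟩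
  · rw [probReal_compl_eq_one_sub (measurableSet_toMeasurable _ _)]
    have h1 : P.real (toMeasurable P (G ⁻¹' B)) ≤ 8 * X.card * E := by
      rw [Measure.real, measure_toMeasurable]
      exact ENNReal.toReal_le_of_le_ofReal (by positivity) hPB
    linarith
  · intro ω hω j hj x hx i hi
    have h1 : G ω ∉ B := fun h => hω (subset_toMeasurable P _ h)
    have h2 : ∀ i < 4, ∫ x in (j : ℝ)..(j + 1), |⟪ψ i x, noiseVec Δ (G ω)⟫| ≤ t := by
      intro i hi
      by_contra! hcon
      exact h1 (Set.mem_biUnion hj (Set.mem_biUnion (Finset.mem_coe.2 (Finset.mem_range.2 hi)) hcon))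
    have h3 := abs_le_integral_add (f := fun x => ⟪ψ i x, noiseVec Δ (G ω)⟫)
      (f' := fun x => ⟪ψ (i + 1) x, noiseVec Δ (G ω)⟫)
      (fun x => by simpa using (hψ i x).inner ℝ (hasDerivAt_const x (noiseVec Δ (G ω))))
      ((hψc (i + 1)).inner continuous_const) hx
    linarith [h2 i (by omega), h2 (i + 1) (by omega)]

end SpikeDeconv

namespace SpikeDeconv

open scoped RealInnerProductSpace

/-! ### The estimators in the Euclidean space of the grid -/

lemma gridVec_mixture (b : ℝ) (T : ℕ) (σ₀ : ℝ) {K : ℕ} (β ϑ : Fin K → ℝ) :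
    gridVec b T (mixture (gridMeasure b T) σ₀ β ϑ) = ∑ k, β k • featVec b T σ₀ (ϑ k) := by
  ext j
  simp only [gridVec, mixture, featVec, WithLp.ofLp_sum, WithLp.ofLp_smul, Finset.sum_apply,
    Pi.smul_apply, smul_eq_mul, Finset.mul_sum]
  exact Finset.sum_congr rfl fun k _ => by ring

lemma gridVec_sub (b : ℝ) (T : ℕ) (f g : ℝ → ℝ) :
    gridVec b T (fun t => f t - g t) = gridVec b T f - gridVec b T g := by
  ext j
  simp [gridVec, mul_sub]

lemma gridVec_add (b : ℝ) (T : ℕ) (f g : ℝ → ℝ) :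
    gridVec b T (fun t => f t + g t) = gridVec b T f + gridVec b T g := by
  ext j
  simp [gridVec, mul_add]

lemma gridVec_gridFun {b : ℝ} {T : ℕ} (hΔ : 0 < gridStep b T) (g : Fin T → ℝ) :
    gridVec b T (gridFun b T g) = noiseVec (gridStep b T) g := by
  have hinj : ∀ i j : Fin T, gridPoint b T i = gridPoint b T j ↔ i = j := by
    intro i j
    refine ⟨fun h => ?_, fun h => by rw [h]⟩
    simp only [gridPoint] at h
    have h1 := mul_right_cancel₀ hΔ.ne' (add_left_cancel h)
    exact Fin.ext (by exact_mod_cast add_right_cancel h1)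
  ext j
  simp only [gridVec, gridFun, noiseVec]
  congr 1
  simp [Set.indicator_apply, hinj]

lemma l2norm_eq_norm_gridVec {b : ℝ} {T : ℕ} (hΔ : 0 ≤ gridStep b T) (f : ℝ → ℝ) :
    l2norm (gridMeasure b T) f = ‖gridVec b T f‖ := by
  rw [l2norm, ← inner_gridVec hΔ, real_inner_self_eq_norm_sq, Real.sqrt_sq (norm_nonneg _)]

lemma sqrt_mul_gridNorm {b : ℝ} {T : ℕ} (hΔ : 0 ≤ gridStep b T) (f : ℝ → ℝ) :
    √(gridStep b T) * gridNorm b T f = ‖gridVec b T f‖ := by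
  rw [EuclideanSpace.norm_eq, gridNorm, ← Real.sqrt_mul hΔ, Finset.mul_sum]
  congr 1
  refine Finset.sum_congr rfl fun j _ => ?_
  simp only [gridVec, Real.norm_eq_abs, sq_abs, mul_pow, Real.sq_sqrt hΔ]

lemma featCurve_zero {b : ℝ} {T : ℕ} {σ₀ : ℝ} (hσ : 0 < σ₀) (θ : ℝ) :
    featCurve b T σ₀ 0 ((√2 * σ₀)⁻¹ * θ) = featVec b T σ₀ θ := by
  have : √2 * σ₀ ≠ 0 := by positivity
  rw [featCurve, pow_zero, one_smul, iteratedDeriv_zero, mul_inv_cancel_left₀ this]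

lemma mem_supp {K : ℕ} {β : Fin K → ℝ} {k : Fin K} : k ∈ supp β ↔ β k ≠ 0 := by
  simp [supp]

lemma sum_supp_eq {M : Type*} [AddCommMonoid M] {K : ℕ} (β : Fin K → ℝ) (f : Fin K → M)
    (hf : ∀ k, β k = 0 → f k = 0) : ∑ k : {k // k ∈ supp β}, f k = ∑ k, f k := by
  rw [Finset.sum_coe_sort (supp β) f]
  exact Finset.sum_subset (Finset.subset_univ _) fun k _ hk =>
    hf k (not_not.1 fun h => hk (mem_supp.2 h))

/-- The basic inequality satisfied by the estimators. -/
lemma IsEstimator.basic_inequality {b : ℝ} {T : ℕ} {σ₀ κ : ℝ} (hΔ : 0 < gridStep b T) {Θ : Set ℝ}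
    {K : ℕ} {g : Fin T → ℝ} {βs ϑs βh ϑh : Fin K → ℝ} (hs : (supp βs).Nonempty)
    (hϑ : ∀ k ∈ supp βs, ϑs k ∈ Θ)
    (h : IsEstimator (gridMeasure b T) σ₀ κ Θ
      (fun t => mixture (gridMeasure b T) σ₀ βs ϑs t + gridFun b T g t) βh ϑh)
    {R : EuclideanSpace ℝ (Fin T)}
    (hR : R = ∑ k, βh k • featVec b T σ₀ (ϑh k) - ∑ k, βs k • featVec b T σ₀ (ϑs k)) :
    1 / 2 * ‖R‖ ^ 2 + κ * (∑ k, |βh k| - ∑ k, |βs k|) ≤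
      ⟪R, noiseVec (gridStep b T) g⟫ := by
  classical
  obtain ⟨k₀, hk₀⟩ := hs
  -- Locations with zero coefficient need not lie in `Θ`. Moving them to an active one makes the
  -- competitor admissible without changing its mixture.
  set ϑ' : Fin K → ℝ := fun k => if k ∈ supp βs then ϑs k else ϑs k₀ with hϑ'
  have h1 := h.2 βs ϑ' fun k => by
    simp only [hϑ']
    split_ifs with hk
    · exact hϑ k hk
    · exact hϑ k₀ hk₀
  have hsum : ∑ k, βs k • featVec b T σ₀ (ϑ' k) = ∑ k, βs k • featVec b T σ₀ (ϑs k) := by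
    refine Finset.sum_congr rfl fun k _ => ?_
    by_cases hk : k ∈ supp βs
    · simp only [hϑ', if_pos hk]
    · rw [not_not.1 fun h => hk (mem_supp.2 h), zero_smul, zero_smul]
  set w := noiseVec (gridStep b T) g with hw
  simp only [objective, l2norm_eq_norm_gridVec hΔ.le, gridVec_sub, gridVec_add,
    gridVec_mixture, gridVec_gridFun hΔ, hsum] at h1
  have e1 : ∑ k, βs k • featVec b T σ₀ (ϑs k) + w - ∑ k, βh k • featVec b T σ₀ (ϑh k) =
      w - R := by rw [hR]; abel
  have e2 : ∑ k, βs k • featVec b T σ₀ (ϑs k) + w - ∑ k, βs k • featVec b T σ₀ (ϑs k) = w := by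
    abel
  rw [← hw, e1, e2, norm_sub_sq_real, real_inner_comm] at h1
  linarith

/-- The set of parameters in the coordinate for which the limit metric is Euclidean. -/
def scaledSet (b ε σ₀ : ℝ) : Set ℝ := {x | √2 * σ₀ * x ∈ paramSet b ε}

lemma ordConnected_scaledSet {b ε σ₀ : ℝ} (hσ : 0 < σ₀) : (scaledSet b ε σ₀).OrdConnected := by
  have hd : 0 < √2 * σ₀ := by positivity
  refine ⟨fun x hx y hy z hz => ?_⟩
  exact ⟨hx.1.trans (mul_le_mul_of_nonneg_left hz.1 hd.le),
    (mul_le_mul_of_nonneg_left hz.2 hd.le).trans hy.2⟩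

lemma inv_mul_mem_scaledSet {b ε σ₀ θ : ℝ} (hσ : 0 < σ₀) (h : θ ∈ paramSet b ε) :
    (√2 * σ₀)⁻¹ * θ ∈ scaledSet b ε σ₀ := by
  have : √2 * σ₀ ≠ 0 := by positivity
  rwa [scaledSet, Set.mem_ofPred_eq, mul_inv_cancel_left₀ this]

/-- Error bounds for the estimators on the event where the noise is small. -/
lemma IsEstimator.error_bounds {b : ℝ} {T : ℕ} {ε σ₀ κ η u r H e ν L₁ L₂ L₃ : ℝ}
    (hΔ : 0 < gridStep b T) (hσ : 0 < σ₀)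
    (hφ : NearGaussian (featCurve b T σ₀) (scaledSet b ε σ₀) η)
    (hdist : ∀ θ ∈ paramSet b ε, ∀ θ' ∈ paramSet b ε,
      (√2 * σ₀)⁻¹ * |θ - θ'| ≤ 2 * rdist (kernelGrid b T σ₀) θ θ' ∧
      rdist (kernelGrid b T σ₀) θ θ' ≤ 2 * ((√2 * σ₀)⁻¹ * |θ - θ'|))
    (hP : ProfileBounds r H e ν L₁ L₂ L₃) {s : ℕ} (hs : 1 ≤ s) (hU0 : 0 ≤ u + s * η)
    (hU : u + s * η ≤ H) (hκ : 0 < κ) {K : ℕ} {g : Fin T → ℝ} {βs ϑs βh ϑh : Fin K → ℝ}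
    (hcard : (supp βs).card = s) (hϑ : ∀ k ∈ supp βs, ϑs k ∈ paramSet b ε)
    (hinc : Incoherent (fun k : {k // k ∈ supp βs} => (√2 * σ₀)⁻¹ * ϑs k) u)
    (hw : ∀ i ≤ 2, ∀ y ∈ scaledSet b ε σ₀,
      |⟪featCurve b T σ₀ i y, noiseVec (gridStep b T) g⟫| ≤ κ / 32000)
    (h : IsEstimator (gridMeasure b T) σ₀ κ (paramSet b ε)
      (fun t => mixture (gridMeasure b T) σ₀ βs ϑs t + gridFun b T g t) βh ϑh) :
    √(gridStep b T) * gridNorm b T (fun t => mixture (gridMeasure b T) σ₀ βh ϑh t -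
        mixture (gridMeasure b T) σ₀ βs ϑs t) ≤ 6 * √s * κ ∧
    abs (∑ k, |βh k| - ∑ k, |βs k|) ≤ 1000000 * κ * s ∧
    ∑ k ∈ supp βs, abs (|βs k| - ∑ l ∈ near (kernelGrid b T σ₀) r βh ϑh (ϑs k), |βh l|)
      ≤ 1000000 * κ * s ∧
    ∑ k ∈ supp βs, abs (βs k - ∑ l ∈ near (kernelGrid b T σ₀) r βh ϑh (ϑs k), βh l)
      ≤ 1000000 * κ * s ∧
    ∑ l ∈ (nearAll (kernelGrid b T σ₀) r βh ϑh βs ϑs)ᶜ, |βh l| ≤ 1000000 * κ * s := by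
  have hne : (supp βs).Nonempty := Finset.card_pos.1 (by omega)
  have hne' : Nonempty {k // k ∈ supp βs} := hne.to_subtype
  have hcard' : Fintype.card {k // k ∈ supp βs} = s := by rw [Fintype.card_coe, hcard]
  have hc0 : 0 < (√2 * σ₀)⁻¹ := by positivity
  set c := (√2 * σ₀)⁻¹ with hc
  have habs : ∀ θ θ', |c * θ - c * θ'| = c * |θ - θ'| := fun θ θ' => by
    rw [← mul_sub, abs_mul, abs_of_pos hc0]
  set N : {k // k ∈ supp βs} → Finset (Fin K) := fun k =>
    near (kernelGrid b T σ₀) r βh ϑh (ϑs k) with hN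
  have hmem : ∀ k j, j ∈ N k ↔ βh j ≠ 0 ∧ rdist (kernelGrid b T σ₀) (ϑh j) (ϑs k) ≤ r :=
    fun k j => by simp [hN, near, mem_supp]
  set R := ∑ k, βh k • featVec b T σ₀ (ϑh k) - ∑ k, βs k • featVec b T σ₀ (ϑs k) with hR
  have hbasic := h.basic_inequality hΔ hne hϑ hR
  have hsum : ∑ k : {k // k ∈ supp βs}, |βs k| = ∑ k, |βs k| :=
    sum_supp_eq βs (fun k => |βs k|) fun k hk => by simp [hk]
  have key := hφ.error_bounds (x := fun k : {k // k ∈ supp βs} => c * ϑs k)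
    (fun k => inv_mul_mem_scaledSet hσ (hϑ k k.2)) hinc (by rwa [hcard']) hP (by rwa [hcard'])
    βh (fun j => c * ϑh j) (fun j => inv_mul_mem_scaledSet hσ (h.1 j)) (fun k => βs k) N
    (fun k j hj => by
      rw [habs]
      linarith [(hdist _ (h.1 j) _ (hϑ k k.2)).1, ((hmem k j).1 hj).2])
    (fun j hj hnear k => by
      have h1 : r < rdist (kernelGrid b T σ₀) (ϑh j) (ϑs k) := by
        by_contra! hcon
        exact hnear k ((hmem k j).2 ⟨hj, hcon⟩)
      rw [habs]
      linarith [(hdist _ (h.1 j) _ (hϑ k k.2)).2])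
    hκ (noiseVec (gridStep b T) g) hw R (by
      simp only [hc, featCurve_zero hσ]
      rw [hR, sum_supp_eq βs (fun k => βs k • featVec b T σ₀ (ϑs k)) fun k hk => by simp [hk]])
    (by rw [hsum]; exact hbasic)
  rw [hcard', hsum] at key
  obtain ⟨k1, k2, k3, k4, k5⟩ := key
  refine ⟨?_, k2, ?_, ?_, ?_⟩
  · rw [sqrt_mul_gridNorm hΔ.le, gridVec_sub, gridVec_mixture, gridVec_mixture]
    exact k1
  · rw [← Finset.sum_coe_sort]
    exact k3
  · rw [← Finset.sum_coe_sort]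
    exact k4
  · have : nearAll (kernelGrid b T σ₀) r βh ϑh βs ϑs = Finset.univ.biUnion N := by
      ext j
      simp [nearAll, hN]
    rw [this]
    exact k5

/-! ### The probability of the event -/

/-- A bound on the squared norms of the first derivatives of the curve of the features. -/
noncomputable def normBound : ℝ := ∑ i ∈ Finset.range 4, |hg (i + i) 0| + 1

lemma normBound_pos : 0 < normBound :=
  add_pos_of_nonneg_of_pos (Finset.sum_nonneg fun _ _ => abs_nonneg _) one_pos

lemma norm_sq_le_normBound {E : Type*} [NormedAddCommGroup E] [InnerProductSpace ℝ E] {a : E}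
    {i : ℕ} (hi : i < 4) (h : |⟪a, a⟫ - (-1) ^ i * hg (i + i) 0| ≤ 1) : ‖a‖ ^ 2 ≤ normBound := by
  rw [real_inner_self_eq_norm_sq] at h
  have h1 := le_abs_self ((-1) ^ i * hg (i + i) 0)
  rw [abs_mul, abs_pow, abs_neg, abs_one, one_pow, one_mul] at h1
  have h2 := Finset.single_le_sum (f := fun i => |hg (i + i) 0|) (fun i _ => abs_nonneg _)
    (Finset.mem_range.2 hi)
  rw [normBound]
  linarith [(abs_le.1 h).2]

/-- The integers whose unit cells cover the scaled set of parameters. -/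
noncomputable def cells (B : ℝ) : Finset ℤ := Finset.Icc ⌊-B⌋ ⌊B⌋

lemma card_cells_le {B : ℝ} (hB : 0 ≤ B) : ((cells B).card : ℝ) ≤ 2 * B + 2 := by
  have h0 : ⌊-B⌋ ≤ ⌊B⌋ := Int.floor_le_floor (by linarith)
  rw [cells, Int.card_Icc]
  have h1 : (((⌊B⌋ + 1 - ⌊-B⌋).toNat : ℤ) : ℝ) = (⌊B⌋ : ℝ) + 1 - ⌊-B⌋ := by
    rw [Int.toNat_of_nonneg (by linarith)]; push_cast; ring
  have h2 : (((⌊B⌋ + 1 - ⌊-B⌋).toNat : ℕ) : ℝ) = (((⌊B⌋ + 1 - ⌊-B⌋).toNat : ℤ) : ℝ) := by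
    push_cast; rfl
  rw [h2, h1]
  linarith [Int.floor_le B, Int.lt_floor_add_one (-B)]

lemma exists_cell {B y : ℝ} (hy : |y| ≤ B) :
    ∃ j ∈ cells B, y ∈ Set.Icc (j : ℝ) (j + 1) := by
  have h := abs_le.1 hy
  exact ⟨⌊y⌋, Finset.mem_Icc.2 ⟨Int.floor_le_floor h.1, Int.floor_le_floor h.2⟩,
    Int.floor_le y, (Int.lt_floor_add_one y).le⟩

lemma abs_le_of_mem_cell {B y : ℝ} {j : ℤ} (hj : j ∈ cells B)
    (hy : y ∈ Set.Icc (j : ℝ) (j + 1)) : |y| ≤ B + 1 := by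
  have h := Finset.mem_Icc.1 hj
  have h1 : (j : ℝ) ≤ B := (Int.cast_le.2 h.2).trans (Int.floor_le B)
  have h2 : -B - 1 ≤ (j : ℝ) := by
    have := Int.lt_floor_add_one (-B)
    have h3 : ((⌊-B⌋ : ℤ) : ℝ) ≤ j := Int.cast_le.2 h.1
    linarith
  exact abs_le.2 ⟨by linarith [hy.1], by linarith [hy.2]⟩

/-- The factor `128000 = 2 * 64000` makes the exponent at least `2 * log τ`. -/
lemma exp_neg_le_inv_sq {σ₁ Δ τ κ V : ℝ} (hσ : 0 < σ₁) (hΔ : 0 < Δ) (hV : 0 < V) (hτ : 1 < τ)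
    (hκ : 128000 * √V * (√2 * σ₁) * √(Δ * Real.log τ) ≤ κ) :
    Real.exp (-(κ / 64000) ^ 2 / (4 * (Δ * σ₁ ^ 2 * V))) ≤ 1 / τ ^ 2 := by
  have hlog : 0 < Real.log τ := Real.log_pos hτ
  have h1 : 8 * V * σ₁ ^ 2 * (Δ * Real.log τ) ≤ (κ / 64000) ^ 2 := by
    have h2 : (128000 * √V * (√2 * σ₁) * √(Δ * Real.log τ)) ^ 2 ≤ κ ^ 2 :=
      pow_le_pow_left₀ (by positivity) hκ 2
    simp only [mul_pow, Real.sq_sqrt hV.le, Real.sq_sqrt (show (0 : ℝ) ≤ 2 by norm_num),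
      Real.sq_sqrt (mul_pos hΔ hlog).le] at h2
    rw [div_pow]
    linarith
  have h2 : 2 * Real.log τ ≤ (κ / 64000) ^ 2 / (4 * (Δ * σ₁ ^ 2 * V)) := by
    rw [le_div_iff₀ (by positivity)]
    linarith
  have h3 : 1 / τ ^ 2 = Real.exp (-(2 * Real.log τ)) := by
    rw [Real.exp_neg, one_div, two_mul, Real.exp_add, Real.exp_log (by linarith), sq]
  rw [h3, Real.exp_le_exp, neg_div]
  linarith

/-- The bound in `1 / τ²` is stronger than needed, since `√(log τ) ≤ τ`. -/
lemma prob_bound_le {b σ₀ τ N p : ℝ} (hσ : 0 < σ₀) (hτ : 1 < τ)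
    (hN : N ≤ 4 * ((√2 * σ₀)⁻¹ * b)) (hb : 1 ≤ (√2 * σ₀)⁻¹ * b) (hp0 : 0 ≤ p)
    (hp : p ≤ 1 / τ ^ 2) :
    1 - 16 * max (√2 * b / (σ₀ * τ * √(Real.log τ))) (1 / τ) ≤ 1 - 8 * N * p := by
  have hlog : 0 < Real.log τ := Real.log_pos hτ
  have hs : 0 < √(Real.log τ) := Real.sqrt_pos.2 hlog
  have hst : √(Real.log τ) ≤ τ := by
    rw [Real.sqrt_le_iff]
    exact ⟨by linarith, by nlinarith [Real.log_le_sub_one_of_pos (show 0 < τ by linarith)]⟩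
  have h2 : √2 * √2 = (2 : ℝ) := Real.mul_self_sqrt (by norm_num)
  set B := (√2 * σ₀)⁻¹ * b with hB
  have hbB : √2 * b = 2 * σ₀ * B := by
    have : √2 ≠ 0 := by positivity
    rw [hB, mul_inv]
    field_simp
    rw [sq, h2]
    ring
  have h3 : 8 * N * p ≤ 32 * B * (1 / τ ^ 2) := by
    have : 8 * N * p ≤ 32 * B * p := mul_le_mul_of_nonneg_right (by linarith) hp0
    exact this.trans (mul_le_mul_of_nonneg_left hp (by linarith))
  have h4 : 2 * B * (1 / τ ^ 2) ≤ √2 * b / (σ₀ * τ * √(Real.log τ)) := by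
    rw [hbB, show 2 * σ₀ * B / (σ₀ * τ * √(Real.log τ)) = 2 * B * (1 / (τ * √(Real.log τ))) by
      field_simp]
    refine mul_le_mul_of_nonneg_left ?_ (by linarith)
    refine one_div_le_one_div_of_le (by positivity) ?_
    rw [sq]
    exact mul_le_mul_of_nonneg_left hst (by linarith)
  linarith [le_max_left (√2 * b / (σ₀ * τ * √(Real.log τ))) (1 / τ)]

/-- The event on which the noise is small compared to the penalty. -/
lemma IsNoise.exists_small_noise {Ω : Type*} [MeasurableSpace Ω] {P : Measure Ω}
    [IsProbabilityMeasure P] {b : ℝ} {T : ℕ} {ε σ₀ σ₁ τ κ : ℝ} {G : Ω → Fin T → ℝ}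
    (hG : IsNoise P σ₁ G) (hb : 0 < b) (hT : 0 < T) (hσ : 0 < σ₀) (hσ₁ : 0 < σ₁) (hε : 0 < ε)
    (hb1 : 1 ≤ (√2 * σ₀)⁻¹ * b) (hb2 : √2 * σ₀ ≤ min ε 1 / 2 * b)
    (hnorm : ∀ i < 4, ∀ x ∈ scaledSet b (min ε 1 / 2) σ₀, ‖featCurve b T σ₀ i x‖ ^ 2 ≤ normBound)
    (hτ : 0 < τ) (hκ0 : 0 < κ)
    (hκ : 128000 * √normBound * (√2 * σ₁) * √(gridStep b T * Real.log τ) ≤ κ) :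
    ∃ A : Set Ω, MeasurableSet A ∧
      1 - 16 * max (√2 * b / (σ₀ * τ * √(Real.log τ))) (1 / τ) ≤ P.real A ∧
      ∀ ω ∈ A, ∀ i ≤ 2, ∀ y ∈ scaledSet b ε σ₀,
        |⟪featCurve b T σ₀ i y, noiseVec (gridStep b T) (G ω)⟫| ≤ κ / 32000 := by
  -- For `τ ≤ 1` the required probability is negative and the empty event suffices.
  rcases le_or_gt τ 1 with hτ1 | hτ1
  · refine ⟨∅, MeasurableSet.empty, ?_, fun ω hω => absurd hω (Set.notMem_empty ω)⟩
    have h1 : 1 ≤ 1 / τ := by rwa [le_div_iff₀ hτ, one_mul]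
    rw [measureReal_empty]
    linarith [le_max_right (√2 * b / (σ₀ * τ * √(Real.log τ))) (1 / τ)]
  have hΔ := gridStep_pos hb hT
  have hd : 0 < √2 * σ₀ := by positivity
  set d := √2 * σ₀ with hdd
  have hm1 : min ε 1 ≤ 1 := min_le_right _ _
  have hm2 : min ε 1 ≤ ε := min_le_left _ _
  have hm0 : 0 < min ε 1 := lt_min hε one_pos
  -- Truncating `ε` at `1` keeps `B` nonnegative. The cells overshoot `[-B, B]` by at most one
  -- rescaled unit, which half of the margin absorbs: hence norms are controlled on the set with
  -- margin `min ε 1 / 2`.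
  set B := (1 - min ε 1) * (d⁻¹ * b) with hB
  have hB0 : 0 ≤ B := mul_nonneg (by linarith) (by linarith)
  have hBb : B ≤ d⁻¹ * b := mul_le_of_le_one_left (by linarith) (by linarith)
  have hdB : d * B = (1 - min ε 1) * b := by rw [hB]; field_simp
  have hcell : ∀ j ∈ cells B, ∀ x ∈ Set.Icc (j : ℝ) (j + 1), ∀ i < 4,
      ‖featCurve b T σ₀ i x‖ ^ 2 ≤ normBound := by
    intro j hj x hx i hi
    refine hnorm i hi x ?_
    have h1 := abs_le.1 (abs_le_of_mem_cell hj hx)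
    have h2 := mul_le_mul_of_nonneg_left h1.1 hd.le
    have h3 := mul_le_mul_of_nonneg_left h1.2 hd.le
    exact ⟨by linarith, by linarith⟩
  obtain ⟨A, hA, hPA, hAb⟩ := hG.exists_event hT hΔ hσ₁ (featCurve_hasDerivAt hb hT hσ)
    normBound_pos (t := κ / 64000) (by positivity) (cells B) hcell
  refine ⟨A, hA, (prob_bound_le hσ hτ1 (by linarith [card_cells_le hB0]) hb1
    (Real.exp_pos _).le (exp_neg_le_inv_sq hσ₁ hΔ normBound_pos hτ1 hκ)).trans hPA,
    fun ω hω i hi y hy => ?_⟩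
  have hyB : |y| ≤ B := by
    have h1 : d * |y| ≤ d * B := by
      rw [← abs_of_pos hd, ← abs_mul, abs_of_pos hd, hdB]
      have h2 : (1 - ε) * b ≤ (1 - min ε 1) * b :=
        mul_le_mul_of_nonneg_right (by linarith) hb.le
      exact abs_le.2 ⟨by linarith [hy.1], by linarith [hy.2]⟩
    exact le_of_mul_le_mul_left h1 hd
  obtain ⟨j, hj, hyj⟩ := exists_cell hyB
  linarith [hAb ω hω j hj y hyj i hi]

end SpikeDeconv

/-! ### Choice of the constants and of `T₀`. -/

open SpikeDeconv in
theorem corollary8p2 :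
    -- the universal constants
    ∃ C₀ C₁ C₂ C₃ C₄ C₅ : ℝ,
      0 < C₀ ∧ 0 < C₁ ∧ 0 < C₂ ∧ 0 < C₃ ∧ 0 < C₄ ∧ 0 < C₅ ∧
    ∀ (σ₀ ε : ℝ) (s : ℕ) (b : ℕ → ℝ) (r u : ℝ),
      0 < σ₀ → 0 < ε → 1 ≤ s →
      (∀ T, 2 ≤ T → 0 < b T) →
      Tendsto b atTop atTop →
      Tendsto (fun T => gridStep (b T) T) atTop (𝓝 0) →
      -- `r` is the maximizer of `H^{(2)}(·, 2)` on `[0, 1/2]`, and `u` is `u_∞`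
      r ∈ Set.Icc (0 : ℝ) (1 / 2) →
      IsMaxOn (fun r' => H₂ (kernelInf σ₀) Set.univ r' 2) (Set.Icc (0 : ℝ) (1 / 2)) r →
      u = 9 / 10 * H₂ (kernelInf σ₀) Set.univ r 2 →
    ∃ T₀ : ℕ, ∀ T : ℕ, T₀ ≤ T → 2 ≤ T →
      -- the limit regime is reached
      (rhoConst (kernelGrid (b T) T σ₀) (kernelInf σ₀) (paramSet (b T) ε) ≤ 2 ∧
        proximity (kernelGrid (b T) T σ₀) (kernelInf σ₀) (paramSet (b T) ε)
          ≤ H₁ (kernelInf σ₀) Set.univ r 2 ∧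
        ((s : ℝ) - 1) * proximity (kernelGrid (b T) T σ₀) (kernelInf σ₀) (paramSet (b T) ε)
          ≤ (1 - 9 / 10) * H₂ (kernelInf σ₀) Set.univ r 2) ∧
      -- the bounds
      ∀ (Ω : Type*) [MeasurableSpace Ω] (P : Measure Ω) [IsProbabilityMeasure P]
        (σ₁ : ℝ) (G : Ω → Fin T → ℝ) (K : ℕ) (βs ϑs : Fin K → ℝ) (τ κ : ℝ),
        0 < σ₁ → IsNoise P σ₁ G →
        (supp βs).card = s →
        (∀ k ∈ supp βs, ϑs k ∈ paramSet (b T) ε) →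
        (∀ k ∈ supp βs, ∀ l ∈ supp βs, k ≠ l →
          ENNReal.ofReal (√2 * σ₀) * max 1 (4 * deltaFun (kernelInf σ₀) Set.univ u s)
            < ENNReal.ofReal |ϑs k - ϑs l|) →
        0 < τ → 0 < κ →
        C₁ * (√2 * σ₁) * √(gridStep (b T) T * Real.log τ) ≤ κ →
        ∃ A : Set Ω, MeasurableSet A ∧
          1 - C₂ * max (√2 * b T / (σ₀ * τ * √(Real.log τ))) (1 / τ) ≤ P.real A ∧
          ∀ ω ∈ A, ∀ βh ϑh : Fin K → ℝ,
            IsEstimator (gridMeasure (b T) T) σ₀ κ (paramSet (b T) ε)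
              (fun t => mixture (gridMeasure (b T) T) σ₀ βs ϑs t + gridFun (b T) T (G ω) t)
              βh ϑh →
            -- prediction error
            √(gridStep (b T) T) * gridNorm (b T) T (fun t =>
                mixture (gridMeasure (b T) T) σ₀ βh ϑh t -
                  mixture (gridMeasure (b T) T) σ₀ βs ϑs t) ≤ C₀ * √s * κ ∧
            -- difference of the `ℓ₁` norms
            abs (∑ k, |βh k| - ∑ k, |βs k|) ≤ C₃ * κ * s ∧
            -- bounds on the linear coefficients
            ∑ k ∈ supp βs, abs (|βs k| -
                ∑ l ∈ near (kernelGrid (b T) T σ₀) r βh ϑh (ϑs k), |βh l|)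
              ≤ C₃ * κ * s ∧
            ∑ k ∈ supp βs, abs (βs k -
                ∑ l ∈ near (kernelGrid (b T) T σ₀) r βh ϑh (ϑs k), βh l)
              ≤ C₄ * κ * s ∧
            ∑ l ∈ (nearAll (kernelGrid (b T) T σ₀) r βh ϑh βs ϑs)ᶜ, |βh l|
              ≤ C₅ * κ * s := by
  refine ⟨6, 128000 * √normBound, 16, 1000000, 1000000, 1000000, by norm_num,
    by have := Real.sqrt_pos.2 normBound_pos; positivity, by norm_num, by norm_num, by norm_num,
    by norm_num, ?_⟩
  intro σ₀ ε s b r u hσ hε hs hbpos hb hΔ hr hmax hu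
  have hP := profileBounds hσ hr hmax
  have hH₁ := hP.H₁_pos hσ
  set H := H₂ (kernelInf σ₀) Set.univ r 2 with hH
  have hH0 : 0 < H := by linarith [hP.H_ge]
  have hs0 : (0 : ℝ) < s := by exact_mod_cast hs
  have hd : 0 < √2 * σ₀ := by positivity
  have hε' : 0 < min ε 1 / 2 := by positivity
  have hreg : GridLimit b ε σ₀ := ⟨hσ, hε, hbpos, hb, hΔ⟩
  have hreg' : GridLimit b (min ε 1 / 2) σ₀ := ⟨hσ, hε', hbpos, hb, hΔ⟩
  -- Exactly what `u = 9/10 * H` leaves available: `u + s * η = H`. The same `η` gives the bound on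
  -- `(s - 1) * V_T`.
  set η := H / (10 * s) with hη
  have hη0 : 0 < η := by positivity
  have hsη : s * η = H / 10 := by rw [hη]; field_simp
  have hm0 : 0 < min (H₁ (kernelInf σ₀) Set.univ r 2) η := lt_min hH₁ hη0
  -- All asymptotic requirements concern only `σ₀`, `ε`, `s` and `b`, so `T₀` precedes the choice of
  -- the noise, `K`, the true parameters, `τ` and `κ`.
  obtain ⟨T₀, hT₀⟩ := eventually_atTop.1 (hreg.rhoConst_le.and
    ((hreg.kernelDeriv_sub_le 4 hm0).and (hreg.rdist_bounds.and
    ((hreg.inner_featCurve_sub_le 3 hη0).and ((hreg'.inner_featCurve_sub_le 4 one_pos).and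
    ((hb.eventually_ge_atTop (√2 * σ₀)).and
      (hb.eventually_ge_atTop (√2 * σ₀ / (min ε 1 / 2)))))))))
  refine ⟨T₀, fun T hT hT2 => ?_⟩
  obtain ⟨hrho, hker, hdist, hinner, hinner', hb1, hb2⟩ := hT₀ T hT
  have hbT := hbpos T hT2
  have hT0 : 0 < T := by omega
  have hΔT := gridStep_pos hbT hT0
  have hprox := proximity_le hm0.le hker
  refine ⟨⟨hrho, hprox.trans (min_le_left _ _), ?_⟩, ?_⟩
  · have h1 : (1 : ℝ) ≤ s := by exact_mod_cast hs
    have h2 := mul_le_mul_of_nonneg_left (hprox.trans (min_le_right _ _)) (sub_nonneg.2 h1)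
    linarith
  intro Ω _ P _ σ₁ G K βs ϑs τ κ hσ₁ hG hcard hϑ hsep hτ hκ0 hκ
  have hφ : NearGaussian (featCurve (b T) T σ₀) (scaledSet (b T) ε σ₀) η :=
    ⟨featCurve_hasDerivAt hbT hT0 hσ, ordConnected_scaledSet hσ, fun i hi j hj x hx y hy =>
      hinner i (by omega) j (by omega) x y hx hy⟩
  have hu0 : 0 ≤ u := by rw [hu]; positivity
  have hU : u + s * η = H := by rw [hsη, hu]; ring
  have hu1 : u ≤ 1 / 4 := by
    have : 0 ≤ s * η := by positivity
    linarith [hP.H_le]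
  have hinc : Incoherent (fun k : {k // k ∈ supp βs} => (√2 * σ₀)⁻¹ * ϑs k) u :=
    incoherent_of_separated hσ hu0 hu1 (by rw [Fintype.card_coe, hcard])
      (fun k : {k // k ∈ supp βs} => ϑs k)
      fun k l hkl => hsep k k.2 l l.2 fun h => hkl (Subtype.ext h)
  have hb1' : 1 ≤ (√2 * σ₀)⁻¹ * b T := by
    rw [inv_mul_eq_div, le_div_iff₀ hd, one_mul]; exact hb1
  have hb2' : √2 * σ₀ ≤ min ε 1 / 2 * b T := by
    rw [div_le_iff₀ hε'] at hb2; linarith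
  obtain ⟨A, hA, hPA, hAw⟩ := hG.exists_small_noise hbT hT0 hσ hσ₁ hε hb1' hb2'
    (fun i hi x hx => norm_sq_le_normBound hi (by
      have := hinner' i hi i hi x x hx hx
      rwa [sub_self] at this)) hτ hκ0 hκ
  exact ⟨A, hA, hPA, fun ω hω βh ϑh hest =>
    hest.error_bounds hΔT hσ hφ hdist hP hs (by rw [hU]; exact hH0.le) hU.le hκ0 hcard hϑ hinc
      (hAw ω hω)⟩
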